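/- Let $T=(V,E)$ be a tree with $n\ge 1$ nodes and edge costs $c\colon E\to\mathbb{R}_{\ge 0}$, and let $d(u,v)$ be the sum of the edge costs on the path between $u$ and $v$. Every node $u$ has a penalty $\pi(u)\in\mathbb{R}_{\ge 0}$ and a radius $\rho(u)\in\mathbb{R}$. For a (nonempty) subtree $Y$ of $T$ let $c(Y)=\sum_{e\in E(Y)}c(e)$ be its setup cost, let $d(u,Y)=\min_{y\in V(Y)}d(u,y)$, and let $p(Y)=\sum\{\pi(u) : u\in V,\ d(u,Y)>\rho(u)\}$ be the total penalty of the nodes that $Y$ does not cover. The *indirect covering subtree problem* asks for a subtree $Y$ of $T$ that minimizes $c(Y)+p(Y)$ among all subtrees of $T$. The *single maximum coverage location problem* asks for a node $y\in V$ that minimizes this cost among all nodes, that is, among all one-node subtrees (whose setup cost is $0$). The machine model is a unit-cost real RAM. It has natural-number registers and arrays with constants, addition, truncated subtraction, comparison and indirect addressing, and real-number registers and arrays with rational constants, $+,-,\times,/$ and comparison. Programs are finite, independent of the input, and built from assignments, sequencing, conditionals and while loops. Every operation, memory access and test costs one time unit. The input consists of $n$, an arbitrarily ordered list of the $n-1$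 edges (each with its two ends in either order) with their costs, the penalties and the radii. **Theorem.** There is a program that, on every input, outputs an optimal solution of the indirect covering subtree problem (the nodes and the edges of an optimal subtree, and its cost) within $T(n)$ time units, where $T(n)=O(n\log n)$. Likewise there is a program that, on every input, outputs an optimal solution of the single maximum coverage location problem (an optimal node and its cost) within $T'(n)$ time units, where $T'(n)=O(n\log n)$. -/

import Mathlib

open Filter Asymptotics

/-! ## A unit-cost real RAM

The machine has registers and (arbitrarily long) arrays of two kinds: natural numbers, which serve
as node names, counters and addresses, and real numbers.  Programs are structured, and a program is
a fixed finite object that does not depend on the input. -/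

namespace RealRAM

/-- A configuration: natural and real registers, and natural and real arrays
(`nmem a i` is cell `i` of the array `a`). -/
structure State where
  nreg : ℕ → ℕ
  rreg : ℕ → ℝ
  nmem : ℕ → ℕ → ℕ
  rmem : ℕ → ℕ → ℝ

/-- Natural-number expressions: constants, registers, (indirect) memory access, addition and
truncated subtraction.  There is no multiplication or bit operation on addresses. -/
inductive NExpr where
  | const (k : ℕ)
  | reg (r : ℕ)
  | mem (a : ℕ) (i : NExpr)
  | add (x y : NExpr)
  | sub (x y : NExpr)

/-- Real expressions: rational constants, registers, (indirect) memory access and the four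
arithmetic operations.  There is no rounding and no conversion from reals to naturals. -/
inductive RExpr where
  | const (q : ℚ)
  | reg (r : ℕ)
  | mem (a : ℕ) (i : NExpr)
  | add (x y : RExpr)
  | sub (x y : RExpr)
  | mul (x y : RExpr)
  | div (x y : RExpr)

/-- Tests: comparisons of naturals, comparisons of reals, and their Boolean combinations. -/
inductive Test where
  | nle (x y : NExpr)
  | rle (x y : RExpr)
  | not (b : Test)
  | and (b c : Test)

/-- Programs: assignments to registers and memory cells, and flow control. -/
inductive Program where
  | skip
  | setN (r : ℕ) (e : NExpr)
  | setR (r : ℕ) (e : RExpr)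
  | storeN (a : ℕ) (i e : NExpr)
  | storeR (a : ℕ) (i : NExpr) (e : RExpr)
  | seq (P Q : Program)
  | ite (b : Test) (P Q : Program)
  | loop (b : Test) (P : Program)

def NExpr.eval (s : State) : NExpr → ℕ
  | .const k => k
  | .reg r => s.nreg r
  | .mem a i => s.nmem a (i.eval s)
  | .add x y => x.eval s + y.eval s
  | .sub x y => x.eval s - y.eval s

noncomputable def RExpr.eval (s : State) : RExpr → ℝ
  | .const q => (q : ℝ)
  | .reg r => s.rreg r
  | .mem a i => s.rmem a (i.eval s)
  | .add x y => x.eval s + y.eval s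
  | .sub x y => x.eval s - y.eval s
  | .mul x y => x.eval s * y.eval s
  | .div x y => x.eval s / y.eval s

def Test.eval (s : State) : Test → Prop
  | .nle x y => x.eval s ≤ y.eval s
  | .rle x y => x.eval s ≤ y.eval s
  | .not b => ¬ b.eval s
  | .and b c => b.eval s ∧ c.eval s

/-- The time to evaluate an expression: every constant, memory access and operation costs one. -/
def NExpr.cost : NExpr → ℕ
  | .const _ => 1
  | .reg _ => 1
  | .mem _ i => i.cost + 1
  | .add x y => x.cost + y.cost + 1
  | .sub x y => x.cost + y.cost + 1

def RExpr.cost : RExpr → ℕ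
  | .const _ => 1
  | .reg _ => 1
  | .mem _ i => i.cost + 1
  | .add x y => x.cost + y.cost + 1
  | .sub x y => x.cost + y.cost + 1
  | .mul x y => x.cost + y.cost + 1
  | .div x y => x.cost + y.cost + 1

def Test.cost : Test → ℕ
  | .nle x y => x.cost + y.cost + 1
  | .rle x y => x.cost + y.cost + 1
  | .not b => b.cost + 1
  | .and b c => b.cost + c.cost + 1

/-- `Exec P s t s'`: started in configuration `s`, the program `P` halts after exactly `t` time
units in configuration `s'`. -/
inductive Exec : Program → State → ℕ → State → Prop where
  | skip (s : State) : Exec .skip s 1 s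
  | setN (r : ℕ) (e : NExpr) (s : State) :
      Exec (.setN r e) s (e.cost + 1) { s with nreg := Function.update s.nreg r (e.eval s) }
  | setR (r : ℕ) (e : RExpr) (s : State) :
      Exec (.setR r e) s (e.cost + 1) { s with rreg := Function.update s.rreg r (e.eval s) }
  | storeN (a : ℕ) (i e : NExpr) (s : State) :
      Exec (.storeN a i e) s (i.cost + e.cost + 1)
        { s with nmem :=
            Function.update s.nmem a (Function.update (s.nmem a) (i.eval s) (e.eval s)) }
  | storeR (a : ℕ) (i : NExpr) (e : RExpr) (s : State) :
      Exec (.storeR a i e) s (i.cost + e.cost + 1)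
        { s with rmem :=
            Function.update s.rmem a (Function.update (s.rmem a) (i.eval s) (e.eval s)) }
  | seq {P Q : Program} {s s' s'' : State} {t t' : ℕ} :
      Exec P s t s' → Exec Q s' t' s'' → Exec (.seq P Q) s (t + t') s''
  | ite_true {b : Test} {P Q : Program} {s s' : State} {t : ℕ} :
      b.eval s → Exec P s t s' → Exec (.ite b P Q) s (b.cost + t) s'
  | ite_false {b : Test} {P Q : Program} {s s' : State} {t : ℕ} :
      ¬ b.eval s → Exec Q s t s' → Exec (.ite b P Q) s (b.cost + t) s'
  | loop_false {b : Test} {P : Program} {s : State} :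
      ¬ b.eval s → Exec (.loop b P) s b.cost s
  | loop_true {b : Test} {P : Program} {s s' s'' : State} {t t' : ℕ} :
      b.eval s → Exec P s t s' → Exec (.loop b P) s' t' s'' →
        Exec (.loop b P) s (b.cost + t + t') s''

end RealRAM

/-! ## Covering problems on trees -/

/-- An edge-weighted tree on `n` nodes, with a penalty and a radius at every node.
`cost` matters only on the edges of the tree. -/
structure CoverInstance (n : ℕ) where
  graph : SimpleGraph (Fin n)
  isTree : graph.IsTree
  cost : Sym2 (Fin n) → ℝ
  cost_nonneg : ∀ e ∈ graph.edgeSet, 0 ≤ cost e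
  penalty : Fin n → ℝ
  penalty_nonneg : ∀ u, 0 ≤ penalty u
  radius : Fin n → ℝ

namespace CoverInstance

variable {n : ℕ} (I : CoverInstance n)

/-- The distance induced by the edge costs (the infimum is over the one path from `u` to `v`). -/
noncomputable def dist (u v : Fin n) : ℝ :=
  ⨅ p : I.graph.Path u v, (p.1.edges.map I.cost).sum

/-- The distance from the node `u` to the nonempty node set `Y`. -/
noncomputable def setDist (u : Fin n) (Y : Set (Fin n)) : ℝ :=
  ⨅ y : Y, I.dist u y

open Classical in
/-- The penalty imposed by the node `u` on the subgraph `Y`. -/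
noncomputable def imposedPenalty (u : Fin n) (Y : I.graph.Subgraph) : ℝ :=
  if I.setDist u Y.verts ≤ I.radius u then 0 else I.penalty u

/-- The total penalty imposed on `Y`. -/
noncomputable def penaltyCost (Y : I.graph.Subgraph) : ℝ :=
  ∑ u, I.imposedPenalty u Y

open Classical in
/-- The sum of the costs of the edges of `Y`. -/
noncomputable def setupCost (Y : I.graph.Subgraph) : ℝ :=
  ∑ e : Sym2 (Fin n) with e ∈ Y.edgeSet, I.cost e

noncomputable def totalCost (Y : I.graph.Subgraph) : ℝ :=
  I.setupCost Y + I.penaltyCost Y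

/-- `Y` solves the indirect covering subtree problem. -/
def IsOptimalSubtree (Y : I.graph.Subgraph) : Prop :=
  Y.coe.IsTree ∧ ∀ Z : I.graph.Subgraph, Z.coe.IsTree → I.totalCost Y ≤ I.totalCost Z

/-- `y` solves the single maximum coverage location problem: only one-node subtrees compete. -/
def IsOptimalNode (y : Fin n) : Prop :=
  ∀ z : Fin n,
    I.totalCost (I.graph.singletonSubgraph y) ≤ I.totalCost (I.graph.singletonSubgraph z)

/-- A list of the edges of the tree, without repetition, in arbitrary order, each edge with its
two ends in arbitrary order. -/
structure EdgeList where
  src : Fin (n - 1) → Fin n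
  dst : Fin (n - 1) → Fin n
  bijOn : Set.BijOn (fun k => s(src k, dst k)) Set.univ I.graph.edgeSet

namespace EdgeList

variable {I} (L : I.EdgeList)

/-- The input: natural register `0` holds `n`, the natural arrays `0` and `1` hold the ends of the
listed edges, the real array `0` holds their costs, and the real arrays `1` and `2` hold the
penalties and the radii.  Everything else is zero. -/
noncomputable def inputState : RealRAM.State where
  nreg r := if r = 0 then n else 0
  rreg _ := 0
  nmem a k :=
    if h : k < n - 1 then
      if a = 0 then (L.src ⟨k, h⟩ : ℕ) else if a = 1 then (L.dst ⟨k, h⟩ : ℕ) else 0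
    else 0
  rmem a k :=
    if a = 0 then
      if h : k < n - 1 then I.cost s(L.src ⟨k, h⟩, L.dst ⟨k, h⟩) else 0
    else if a = 1 then
      if h : k < n then I.penalty ⟨k, h⟩ else 0
    else if a = 2 then
      if h : k < n then I.radius ⟨k, h⟩ else 0
    else 0

open Classical in
/-- The output is an optimal subtree together with its cost: the natural arrays `2` and `3` hold
the indicator functions of its nodes and of its edges, and real register `0` holds its cost. -/
def OutputsOptimalSubtree (s : RealRAM.State) : Prop :=
  ∃ Y : I.graph.Subgraph, I.IsOptimalSubtree Y ∧
    (∀ v : Fin n, s.nmem 2 v = if v ∈ Y.verts then 1 else 0) ∧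
    (∀ k : Fin (n - 1), s.nmem 3 k = if s(L.src k, L.dst k) ∈ Y.edgeSet then 1 else 0) ∧
    s.rreg 0 = I.totalCost Y

/-- The output is an optimal node together with its cost: natural register `1` holds the node and
real register `0` holds its cost. -/
def OutputsOptimalNode (_ : I.EdgeList) (s : RealRAM.State) : Prop :=
  ∃ y : Fin n, I.IsOptimalNode y ∧ s.nreg 1 = y ∧
    s.rreg 0 = I.totalCost (I.graph.singletonSubgraph y)

end EdgeList

end CoverInstance

/-- A problem on covering instances, given by its relation `good` between inputs and final
configurations, can be solved in time `O(f n)`, where `n` is the number of nodes: there is one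
program that, on every input, halts with a correct output within `T n` time units, where
`T = O(f)`. -/
def SolvableInTime
    (good : ∀ {n : ℕ} {I : CoverInstance n}, I.EdgeList → RealRAM.State → Prop)
    (f : ℕ → ℝ) : Prop :=
  ∃ (P : RealRAM.Program) (T : ℕ → ℕ), (fun n => (T n : ℝ)) =O[atTop] f ∧
    ∀ (n : ℕ) (I : CoverInstance n) (L : I.EdgeList),
      ∃ (t : ℕ) (s : RealRAM.State),
        RealRAM.Exec P L.inputState t s ∧ t ≤ T n ∧ good L s

/-! Root the tree and number its nodes so that parents come before children. Build a subtree with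
root `v` by adding its other nodes in increasing order. When `i` is added, its parent is already
present and nothing below `i` is. For a node outside the subtree of `i` the distance to the set does
not change, because the way to `i` leads through its parent. For a node below `i` the nearest chosen
node was the parent of `i`, and now it is `i`. So the change of the cost, `delta i`, is the edge
cost plus the penalty that the subtree of `i` imposes at `i` minus the one that it imposes at the
parent of `i`. This does not depend on the rest of the chosen set. Hence the cost of a subtree is
the penalty of its root alone plus the sum of `delta` over its other nodes (`IsSub.subCost_eq`), and
a bottom-up recursion that keeps only the branches with negative total finds the best subtree for
every root in linear time (`IsSub.sum_delta`, `IsSub.le_subCost`, `subCost_of_mem_iff`). For the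
one-node problem the penalties of the roots suffice.

There remain three penalty sums for each node: that of the whole tree at the node, and those of its
subtree at the node and at its parent. They are treated as `3 n` queries to `n` clients and answered
by contracting a tree of clusters. A cluster is a part of the tree with two terminals. It keeps its
queries sorted by the distance to a terminal, and its clients sorted by the radius that is left at a
terminal. If two clusters share a terminal that separates them, a client misses a query of the other
cluster exactly if its remaining radius is smaller than the distance of the query. One sweep through
two sorted lists therefore settles all contributions between the clusters (`bump_answers`,
`Cluster.Answered.join`). Passing to a farther terminal adds the same constant to all keys of a
list, so the sorted lists of the union arise by merging (`Cluster.Valid.join`). A union takes time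
linear in the lengths of the lists.

A round of contraction absorbs leaves at branchings and joins consecutive clusters on unbranched
chains. Each cluster takes part in at most one union, so a round costs `O(n)`. The number of nodes
minus one shrinks by the factor 7/8 (`card_contract`), so `O(log n)` rounds suffice
(`run_contractTree`). This gives `O(n log n)`; everything else is linear.

On the machine, sorted lists are segments of a heap that is only appended to, so that older lists
remain valid and can be shared, and recursion over the tree of clusters is replaced by a stack. The
numbering comes from peeling off leaves, the edge at a leaf being known from the sum of the names of
the edges at it (`Peeling.next`, `Peeling.step`). `Numbering.subtree` translates subgraphs into sets
of indices and back. -/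

/-! ## Program logic for the real RAM -/

namespace RealRAM

/-- Started in `s`, the program `P` halts, and `Q` holds of its running time and final state. -/
def Run (P : Program) (s : State) (Q : ℕ → State → Prop) : Prop :=
  ∃ t s', Exec P s t s' ∧ Q t s'

infixr:20 " ;; " => Program.seq

theorem Run.mono {P : Program} {s : State} {Q R : ℕ → State → Prop} (h : Run P s Q)
    (hQR : ∀ t s', Q t s' → R t s') : Run P s R := by
  obtain ⟨t, s', he, hq⟩ := h
  exact ⟨t, s', he, hQR _ _ hq⟩

theorem Run.seq {P P' : Program} {s : State} {R : ℕ → State → Prop}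
    (h : Run P s fun t s' => Run P' s' fun t' s'' => R (t + t') s'') : Run (P ;; P') s R := by
  obtain ⟨t, s', he, t', s'', he', hr⟩ := h
  exact ⟨_, _, .seq he he', hr⟩

theorem Run.ite {b : Test} {P P' : Program} {s : State} {Q : ℕ → State → Prop}
    (h₁ : b.eval s → Run P s fun t s' => Q (b.cost + t) s')
    (h₂ : ¬ b.eval s → Run P' s fun t s' => Q (b.cost + t) s') : Run (.ite b P P') s Q := by
  by_cases hb : b.eval s
  · obtain ⟨t, s', he, hq⟩ := h₁ hb
    exact ⟨_, _, .ite_true hb he, hq⟩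
  · obtain ⟨t, s', he, hq⟩ := h₂ hb
    exact ⟨_, _, .ite_false hb he, hq⟩

/-- Loops with an invariant `I` and a potential `Φ` that pays for the iterations. -/
theorem Run.loop {b : Test} {P : Program} {s : State} {Q : ℕ → State → Prop}
    (I : State → Prop) (Φ : State → ℕ) (hs : I s)
    (step : ∀ s, I s → b.eval s → Run P s fun t s' => I s' ∧ Φ s' + t + b.cost ≤ Φ s)
    (post : ∀ t s', I s' → ¬ b.eval s' → t ≤ Φ s + b.cost → Q t s') : Run (.loop b P) s Q := by
  -- Since every test costs something, the potential strictly decreases in each iteration. This is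
  -- what makes the loop terminate.
  have hb : 0 < b.cost := by cases b <;> simp [Test.cost]
  have key : ∀ m s, Φ s ≤ m → I s →
      Run (.loop b P) s fun t s' => I s' ∧ ¬ b.eval s' ∧ t ≤ Φ s + b.cost := by
    intro m
    induction m with
    | zero =>
      intro s hm hI
      by_cases h : b.eval s
      · obtain ⟨t, s', -, -, h2⟩ := step s hI h
        omega
      · exact ⟨_, _, .loop_false h, hI, h, by omega⟩
    | succ m ih =>
      intro s hm hI
      by_cases h : b.eval s
      · obtain ⟨t, s', he, h1, h2⟩ := step s hI h
        obtain ⟨t', s'', he', h1', h2', h3'⟩ := ih s' (by omega) h1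
        exact ⟨_, _, .loop_true h he he', h1', h2', by omega⟩
      · exact ⟨_, _, .loop_false h, hI, h, by omega⟩
  exact (key _ s le_rfl hs).mono fun t s' h => post t s' h.1 h.2.1 h.2.2

/-- Serves the loops that are verified by induction on the data they consume (lists, stacks, trees
of clusters) instead of an invariant. -/
theorem Run.loop_unfold {b : Test} {P : Program} {s : State} {Q : ℕ → State → Prop}
    (hb : b.eval s) (h : Run P s fun t s' => Run (.loop b P) s' fun t' s'' =>
      Q (b.cost + t + t') s'') : Run (.loop b P) s Q := by
  obtain ⟨t, s', he, t', s'', he', hq⟩ := h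
  exact ⟨_, _, .loop_true hb he he', hq⟩

theorem Run.loop_exit {b : Test} {P : Program} {s : State} {Q : ℕ → State → Prop}
    (hb : ¬ b.eval s) (h : Q b.cost s) : Run (.loop b P) s Q :=
  ⟨_, _, .loop_false hb, h⟩

/-! ### Loop-free programs -/

namespace Program

/-- `P` contains no loop. -/
def straight : Program → Bool
  | seq P Q => P.straight && Q.straight
  | ite _ P Q => P.straight && Q.straight
  | loop _ _ => false
  | _ => true

/-- A bound on the running time of a loop-free program. -/
def bound : Program → ℕ
  | skip => 1
  | setN _ e => e.cost + 1
  | setR _ e => e.cost + 1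
  | storeN _ i e => i.cost + e.cost + 1
  | storeR _ i e => i.cost + e.cost + 1
  | seq P Q => P.bound + Q.bound
  | ite b P Q => b.cost + (P.bound + Q.bound)
  | loop _ _ => 0

open Classical in
/-- The effect of a loop-free program. -/
noncomputable def eff : Program → State → State
  | skip, s => s
  | setN r e, s => { s with nreg := Function.update s.nreg r (e.eval s) }
  | setR r e, s => { s with rreg := Function.update s.rreg r (e.eval s) }
  | storeN a i e, s =>
      { s with nmem := Function.update s.nmem a (Function.update (s.nmem a) (i.eval s) (e.eval s)) }
  | storeR a i e, s =>
      { s with rmem := Function.update s.rmem a (Function.update (s.rmem a) (i.eval s) (e.eval s)) }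
  | seq P Q, s => Q.eff (P.eff s)
  | ite b P Q, s => if b.eval s then P.eff s else Q.eff s
  | loop _ _, s => s

theorem exec_eff {P : Program} (h : P.straight = true) (s : State) :
    ∃ t ≤ P.bound, Exec P s t (P.eff s) := by
  induction P generalizing s with
  | skip => exact ⟨_, le_rfl, .skip s⟩
  | setN r e => exact ⟨_, le_rfl, .setN r e s⟩
  | setR r e => exact ⟨_, le_rfl, .setR r e s⟩
  | storeN a i e => exact ⟨_, le_rfl, .storeN a i e s⟩
  | storeR a i e => exact ⟨_, le_rfl, .storeR a i e s⟩
  | seq P Q hP hQ =>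
    simp only [straight, Bool.and_eq_true] at h
    obtain ⟨t, ht, he⟩ := hP h.1 s
    obtain ⟨t', ht', he'⟩ := hQ h.2 (P.eff s)
    exact ⟨_, by simp only [bound]; omega, .seq he he'⟩
  | ite b P Q hP hQ =>
    simp only [straight, Bool.and_eq_true] at h
    by_cases hb : b.eval s
    · obtain ⟨t, ht, he⟩ := hP h.1 s
      exact ⟨b.cost + t, by simp only [bound]; omega, by simpa [eff, hb] using Exec.ite_true hb he⟩
    · obtain ⟨t, ht, he⟩ := hQ h.2 s
      exact ⟨b.cost + t, by simp only [bound]; omega, by simpa [eff, hb] using Exec.ite_false hb he⟩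
  | loop b P _ => simp [straight] at h

end Program

/-- The standard way through a loop-free block: the final state is computed by unfolding `eff`, and
for a concrete program the bound `K` is a numeral that can be checked by evaluation. -/
theorem Run.straight {P : Program} {s : State} {Q : ℕ → State → Prop} (K : ℕ)
    (h : P.straight = true) (hK : P.bound ≤ K)
    (hQ : ∀ t s', t ≤ K → s' = P.eff s → Q t s') : Run P s Q := by
  obtain ⟨t, ht, he⟩ := P.exec_eff h s
  exact ⟨t, _, he, hQ t _ (ht.trans hK) rfl⟩

/-- A counting loop: `while r < e do (P; r := r + 1)`. -/
def Program.count (r : ℕ) (e : NExpr) (P : Program) : Program :=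
  .loop (.not (.nle e (.reg r))) (P ;; .setN r (.add (.reg r) (.const 1)))

/-- An instance of `Run.loop` with the remaining iterations as potential. The summand `e.cost + 3`
is the cost of the loop test, which is paid once more on exit. The premise `step` includes the
increment, so the invariant needs to hold only at the loop test. -/
theorem Run.count {r : ℕ} {e : NExpr} {P : Program} {s : State} {Q : ℕ → State → Prop}
    (I : ℕ → State → Prop) (N K k₀ : ℕ) (hI : ∀ k s, I k s → s.nreg r = k ∧ e.eval s = N)
    (hk : k₀ ≤ N) (hs : I k₀ s)
    (step : ∀ k < N, k₀ ≤ k → ∀ s, I k s →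
      Run (P ;; .setN r (.add (.reg r) (.const 1))) s fun t s' => t ≤ K ∧ I (k + 1) s')
    (post : ∀ t s', I N s' → t ≤ (N - k₀) * (K + e.cost + 3) + (e.cost + 3) → Q t s') :
    Run (.count r e P) s Q := by
  have hc : (Test.not (.nle e (.reg r))).cost = e.cost + 3 := by simp [Test.cost, NExpr.cost]
  refine Run.loop (fun s => ∃ k, k₀ ≤ k ∧ k ≤ N ∧ I k s)
    (fun s => (N - s.nreg r) * (K + e.cost + 3)) ⟨k₀, le_rfl, hk, hs⟩ ?_ ?_
  · rintro s ⟨k, hk0, hkN, hIk⟩ hb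
    obtain ⟨h1, h2⟩ := hI k s hIk
    simp only [Test.eval, NExpr.eval, h1, h2, not_le] at hb
    refine (step k hb hk0 s hIk).mono ?_
    rintro t s' ⟨ht, hI'⟩
    refine ⟨⟨k + 1, by omega, by omega, hI'⟩, ?_⟩
    rw [h1, (hI _ _ hI').1, hc]
    obtain ⟨d, rfl⟩ : ∃ d, N = k + 1 + d := ⟨N - (k + 1), by omega⟩
    have e1 : k + 1 + d - (k + 1) = d := by omega
    have e2 : k + 1 + d - k = d + 1 := by omega
    rw [e1, e2, Nat.add_mul]
    omega
  · rintro t s' ⟨k, hk0, hkN, hIk⟩ hb ht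
    obtain ⟨h1, h2⟩ := hI k s' hIk
    simp only [Test.eval, NExpr.eval, h1, h2, not_le, not_lt] at hb
    obtain rfl : k = N := by omega
    refine post t s' hIk ?_
    rw [(hI _ _ hs).1, hc] at ht
    exact ht

/-- The states `s` and `s'` differ at most in the listed natural registers, real registers,
natural arrays and real arrays. -/
structure Frame (nr rr nm rm : List ℕ) (s s' : State) : Prop where
  nreg : ∀ r, r ∉ nr → s'.nreg r = s.nreg r
  rreg : ∀ r, r ∉ rr → s'.rreg r = s.rreg r
  nmem : ∀ a, a ∉ nm → s'.nmem a = s.nmem a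
  rmem : ∀ a, a ∉ rm → s'.rmem a = s.rmem a

theorem Frame.refl {nr rr nm rm : List ℕ} (s : State) : Frame nr rr nm rm s s :=
  ⟨fun _ _ => rfl, fun _ _ => rfl, fun _ _ => rfl, fun _ _ => rfl⟩

theorem Frame.trans {nr rr nm rm : List ℕ} {s s' s'' : State} (h : Frame nr rr nm rm s s')
    (h' : Frame nr rr nm rm s' s'') : Frame nr rr nm rm s s'' :=
  ⟨fun r hr => (h'.nreg r hr).trans (h.nreg r hr), fun r hr => (h'.rreg r hr).trans (h.rreg r hr),
    fun r hr => (h'.nmem r hr).trans (h.nmem r hr), fun r hr => (h'.rmem r hr).trans (h.rmem r hr)⟩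

theorem Frame.mono {nr rr nm rm nr' rr' nm' rm' : List ℕ} {s s' : State}
    (h : Frame nr rr nm rm s s') (h₁ : nr ⊆ nr') (h₂ : rr ⊆ rr') (h₃ : nm ⊆ nm')
    (h₄ : rm ⊆ rm') : Frame nr' rr' nm' rm' s s' :=
  ⟨fun r hr => h.nreg r fun h' => hr (h₁ h'), fun r hr => h.rreg r fun h' => hr (h₂ h'),
    fun r hr => h.nmem r fun h' => hr (h₃ h'), fun r hr => h.rmem r fun h' => hr (h₄ h')⟩

/-- The components that a loop-free program assigns to. -/
def Program.writes : Program → List ℕ × List ℕ × List ℕ × List ℕ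
  | .skip => ([], [], [], [])
  | .setN r _ => ([r], [], [], [])
  | .setR r _ => ([], [r], [], [])
  | .storeN a _ _ => ([], [], [a], [])
  | .storeR a _ _ => ([], [], [], [a])
  | .seq P Q | .ite _ P Q =>
    (P.writes.1 ++ Q.writes.1, P.writes.2.1 ++ Q.writes.2.1,
      P.writes.2.2.1 ++ Q.writes.2.2.1, P.writes.2.2.2 ++ Q.writes.2.2.2)
  | .loop _ P => P.writes

/-- The frame is read off from the syntax alone, loops included, so that for concrete programs the
side conditions are decidable. -/
theorem Exec.frame_writes {P : Program} {s s' : State} {t : ℕ} (h : Exec P s t s') :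
    Frame P.writes.1 P.writes.2.1 P.writes.2.2.1 P.writes.2.2.2 s s' := by
  induction h with
  | skip | loop_false => exact .refl _
  | setN r e s =>
    exact ⟨fun r' hr => by simp [Program.writes] at hr; simp [hr], fun _ _ => rfl, fun _ _ => rfl,
      fun _ _ => rfl⟩
  | setR r e s =>
    exact ⟨fun _ _ => rfl, fun r' hr => by simp [Program.writes] at hr; simp [hr], fun _ _ => rfl,
      fun _ _ => rfl⟩
  | storeN a i e s =>
    exact ⟨fun _ _ => rfl, fun _ _ => rfl, fun r' hr => by simp [Program.writes] at hr; simp [hr],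
      fun _ _ => rfl⟩
  | storeR a i e s =>
    exact ⟨fun _ _ => rfl, fun _ _ => rfl, fun _ _ => rfl,
      fun r' hr => by simp [Program.writes] at hr; simp [hr]⟩
  | seq _ _ h h' =>
    exact (h.mono (by simp [Program.writes]) (by simp [Program.writes]) (by simp [Program.writes])
      (by simp [Program.writes])).trans (h'.mono (by simp [Program.writes])
      (by simp [Program.writes]) (by simp [Program.writes]) (by simp [Program.writes]))
  | ite_true _ _ h | ite_false _ _ h =>
    exact h.mono (by simp [Program.writes]) (by simp [Program.writes]) (by simp [Program.writes])
      (by simp [Program.writes])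
  | loop_true _ _ _ h h' => exact h.trans h'

/-- Whatever a program does, it changes only what it assigns to. -/
theorem Run.frame {P : Program} {s : State} {Q : ℕ → State → Prop} {nr rr nm rm : List ℕ}
    (hw : (P.writes.1 ⊆ nr ∧ P.writes.2.1 ⊆ rr) ∧ P.writes.2.2.1 ⊆ nm ∧ P.writes.2.2.2 ⊆ rm)
    (h : Run P s Q) : Run P s fun t s' => Q t s' ∧ Frame nr rr nm rm s s' := by
  obtain ⟨t, s', he, hq⟩ := h
  exact ⟨t, s', he, hq, he.frame_writes.mono hw.1.1 hw.1.2 hw.2.1 hw.2.2⟩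

end RealRAM

/-! ## Keyed lists -/

/-- A list of names with real keys. -/
abbrev KeyList := List (ℕ × ℝ)

namespace KeyList

/-- The keys are in ascending order. -/
def Ascending (l : KeyList) : Prop := l.Pairwise fun x y => x.2 ≤ y.2

/-- Add `δ` to all keys. -/
def shift (δ : ℝ) (l : KeyList) : KeyList := l.map fun x => (x.1, x.2 + δ)

open Classical in
/-- Merge two ascending lists. -/
noncomputable def merge (l l' : KeyList) : KeyList := List.merge l l' fun x y => decide (x.2 ≤ y.2)

open Classical in
/-- The total weight of the entries with key below `k`. -/
noncomputable def weightBelow (w : ℕ → ℝ) (l : KeyList) (k : ℝ) : ℝ :=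
  (l.map fun x => if x.2 < k then w x.1 else 0).sum

/-- Add to the value of each name in the list `l` the weight of the entries of `l'` with a smaller
key. -/
noncomputable def bump (w : ℕ → ℝ) (l l' : KeyList) (acc : ℕ → ℝ) : ℕ → ℝ :=
  l.foldl (fun f x => Function.update f x.1 (f x.1 + l'.weightBelow w x.2)) acc

@[simp] theorem shift_nil (δ : ℝ) : shift δ [] = [] := rfl

@[simp] theorem shift_cons (δ : ℝ) (x : ℕ × ℝ) (l : KeyList) :
    shift δ (x :: l) = (x.1, x.2 + δ) :: shift δ l := rfl

@[simp] theorem length_shift (δ : ℝ) (l : KeyList) : (shift δ l).length = l.length :=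
  List.length_map ..

theorem Ascending.shift {l : KeyList} (h : l.Ascending) (δ : ℝ) : (l.shift δ).Ascending := by
  refine List.pairwise_map.2 (h.imp ?_)
  intro x y hxy
  simpa using hxy

theorem merge_perm (l l' : KeyList) : (l.merge l').Perm (l ++ l') := List.merge_perm_append _

@[simp] theorem length_merge (l l' : KeyList) : (l.merge l').length = l.length + l'.length := by
  rw [(merge_perm l l').length_eq, List.length_append]

@[simp] theorem nil_merge (l : KeyList) : merge [] l = l := List.nil_merge l

@[simp] theorem merge_nil (l : KeyList) : merge l [] = l := List.merge_right l

theorem cons_merge_cons_of_le {x y : ℕ × ℝ} (h : x.2 ≤ y.2) (l l' : KeyList) :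
    merge (x :: l) (y :: l') = x :: merge l (y :: l') := by
  simp [merge, h]

theorem cons_merge_cons_of_not_le {x y : ℕ × ℝ} (h : ¬ x.2 ≤ y.2) (l l' : KeyList) :
    merge (x :: l) (y :: l') = y :: merge (x :: l) l' := by
  simp [merge, h]

theorem Ascending.merge {l l' : KeyList} (h : l.Ascending) (h' : l'.Ascending) :
    (l.merge l').Ascending := by
  have := List.pairwise_merge (le := fun x y : ℕ × ℝ => decide (x.2 ≤ y.2))
    (fun a b c hab hbc => by
      simp only [decide_eq_true_eq] at *
      exact hab.trans hbc)
    (fun a b => by simpa using le_total a.2 b.2)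
    l l' (by simpa [Ascending] using h) (by simpa [Ascending] using h')
  refine List.Pairwise.imp ?_ this
  intro x y h
  simpa using h

theorem weightBelow_perm (w : ℕ → ℝ) {l l' : KeyList} (h : l.Perm l') (k : ℝ) :
    weightBelow w l k = weightBelow w l' k := (h.map _).sum_eq

theorem weightBelow_eq_zero (w : ℕ → ℝ) {l : KeyList} {k : ℝ} (h : ∀ x ∈ l, k ≤ x.2) :
    weightBelow w l k = 0 := by
  refine List.sum_eq_zero fun y hy => ?_
  obtain ⟨x, hx, rfl⟩ := List.mem_map.1 hy
  rw [if_neg (not_lt.2 (h x hx))]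

theorem bump_of_not_mem (w : ℕ → ℝ) (l l' : KeyList) (acc : ℕ → ℝ) {q : ℕ}
    (h : q ∉ l.map Prod.fst) : bump w l l' acc q = acc q := by
  induction l generalizing acc with
  | nil => rfl
  | cons x l ih =>
    simp only [List.map_cons, List.mem_cons, not_or] at h
    rw [bump, List.foldl_cons, ← bump, ih _ h.2, Function.update_of_ne h.1]

/-- Distinct names guarantee that the value of `q` is touched only once in the fold. -/
theorem bump_of_mem (w : ℕ → ℝ) (l l' : KeyList) (acc : ℕ → ℝ) {q : ℕ} {k : ℝ}
    (hl : (l.map Prod.fst).Nodup) (h : (q, k) ∈ l) :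
    bump w l l' acc q = acc q + l'.weightBelow w k := by
  induction l generalizing acc with
  | nil => simp at h
  | cons x l ih =>
    simp only [List.map_cons, List.nodup_cons] at hl
    rw [bump, List.foldl_cons, ← bump]
    rcases List.mem_cons.1 h with rfl | h
    · rw [bump_of_not_mem _ _ _ _ hl.1, Function.update_self]
    · rw [ih _ hl.2 h, Function.update_of_ne]
      rintro rfl
      exact hl.1 (List.mem_map.2 ⟨_, h, rfl⟩)

end KeyList

namespace RealRAM

/-! ## Keyed lists in memory

The natural array `24` and the real array `3` form a heap, in which cells are allocated once and
never changed; the natural register `14` points to the first free cell. -/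

/-- The cells from `a` on hold the list `l`. -/
def Seg (H : ℕ → ℕ) (K : ℕ → ℝ) : ℕ → KeyList → Prop
  | _, [] => True
  | a, x :: l => (H a = x.1 ∧ K a = x.2) ∧ Seg H K (a + 1) l

/-- The allocated cells `a`, …, `e - 1` hold the list `l`. -/
def Holds (s : State) (a e : ℕ) (l : KeyList) : Prop :=
  e = a + l.length ∧ e ≤ s.nreg 14 ∧ Seg (s.nmem 24) (s.rmem 3) a l

/-- The heap of `s'` extends that of `s`. -/
def HeapLE (s s' : State) : Prop :=
  s.nreg 14 ≤ s'.nreg 14 ∧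
    ∀ k < s.nreg 14, s'.nmem 24 k = s.nmem 24 k ∧ s'.rmem 3 k = s.rmem 3 k

theorem HeapLE.refl (s : State) : HeapLE s s := ⟨le_rfl, fun _ _ => ⟨rfl, rfl⟩⟩

theorem HeapLE.trans {s s' s'' : State} (h : HeapLE s s') (h' : HeapLE s' s'') : HeapLE s s'' :=
  ⟨h.1.trans h'.1, fun k hk => ⟨(h'.2 k (hk.trans_le h.1)).1.trans (h.2 k hk).1,
    (h'.2 k (hk.trans_le h.1)).2.trans (h.2 k hk).2⟩⟩

theorem HeapLE.of_eq {s s' : State} (h₁ : s'.nreg 14 = s.nreg 14) (h₂ : s'.nmem 24 = s.nmem 24)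
    (h₃ : s'.rmem 3 = s.rmem 3) : HeapLE s s' :=
  ⟨h₁.ge, fun _ _ => by rw [h₂, h₃]; exact ⟨rfl, rfl⟩⟩

theorem Seg.congr {H H' : ℕ → ℕ} {K K' : ℕ → ℝ} {a : ℕ} {l : KeyList} (h : Seg H K a l)
    (hH : ∀ k < a + l.length, H' k = H k ∧ K' k = K k) : Seg H' K' a l := by
  induction l generalizing a with
  | nil => trivial
  | cons x l ih =>
    simp only [List.length_cons] at hH
    refine ⟨?_, ih h.2 fun k hk => hH k (by omega)⟩
    rw [(hH a (by omega)).1, (hH a (by omega)).2]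
    exact h.1

theorem Holds.mono {s s' : State} {a e : ℕ} {l : KeyList} (h : Holds s a e l) (hs : HeapLE s s') :
    Holds s' a e l := by
  refine ⟨h.1, h.2.1.trans hs.1, h.2.2.congr fun k hk => hs.2 k ?_⟩
  have := h.1
  have := h.2.1
  omega

/-- Merge the lists in the cells `r10`, …, `r11 - 1` and `r12`, …, `r13 - 1` into new cells, adding
the real registers `10` and `11` to their keys. -/
def mergeLoop : Program :=
  .loop (.not (.and (.nle (.reg 11) (.reg 10)) (.nle (.reg 13) (.reg 12))))
    (.ite (.and (.not (.nle (.reg 11) (.reg 10)))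
        (.not (.and (.not (.nle (.reg 13) (.reg 12)))
          (.not (.rle (.add (.mem 3 (.reg 10)) (.reg 10)) (.add (.mem 3 (.reg 12)) (.reg 11)))))))
      (.storeN 24 (.reg 14) (.mem 24 (.reg 10)) ;;
        .storeR 3 (.reg 14) (.add (.mem 3 (.reg 10)) (.reg 10)) ;;
        .setN 10 (.add (.reg 10) (.const 1)) ;; .setN 14 (.add (.reg 14) (.const 1)))
      (.storeN 24 (.reg 14) (.mem 24 (.reg 12)) ;;
        .storeR 3 (.reg 14) (.add (.mem 3 (.reg 12)) (.reg 11)) ;;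
        .setN 12 (.add (.reg 12) (.const 1)) ;; .setN 14 (.add (.reg 14) (.const 1))))

/-- Induction on the number of entries left. The cell written by one iteration lies below the free
pointer afterwards, so by `HeapLE` the rest of the run preserves it, and it becomes the head of the
list that the rest produces. Shifts are applied on the fly, which does not disturb the order. -/
theorem run_mergeLoop (m : ℕ) : ∀ (l l' : KeyList) (s : State), l.length + l'.length = m →
    Holds s (s.nreg 10) (s.nreg 11) l → Holds s (s.nreg 12) (s.nreg 13) l' →
    Run mergeLoop s fun t s' => t ≤ 70 * m + 70 ∧
      Holds s' (s.nreg 14) (s'.nreg 14)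
        (KeyList.merge (l.shift (s.rreg 10)) (l'.shift (s.rreg 11))) ∧ HeapLE s s' := by
  induction m with
  | zero =>
    intro l l' s hm h h'
    obtain rfl : l = [] := List.length_eq_zero_iff.1 (by omega)
    obtain rfl : l' = [] := List.length_eq_zero_iff.1 (by omega)
    refine Run.loop_exit ?_ ⟨by simp [Test.cost, NExpr.cost], ⟨by simp, le_rfl, by simp [Seg]⟩, .refl s⟩
    simp [Test.eval, NExpr.eval, h.1, h'.1]
  | succ m ih =>
    intro l l' s hm h h'
    have hl : (s.nreg 11 ≤ s.nreg 10 ↔ l = []) := by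
      rw [h.1, ← List.length_eq_zero_iff]; omega
    have hl' : (s.nreg 13 ≤ s.nreg 12 ↔ l' = []) := by
      rw [h'.1, ← List.length_eq_zero_iff]; omega
    refine Run.loop_unfold ?_ ?_
    · simp only [Test.eval, NExpr.eval, hl, hl']
      rintro ⟨rfl, rfl⟩
      simp at hm
    -- The test of the machine in its own form: tests offer only negation and conjunction. If a list
    -- is exhausted, a meaningless cell is read, but its value does not influence the truth of the
    -- test.
    by_cases hc : l ≠ [] ∧ ¬ (l' ≠ [] ∧
        ¬ s.rmem 3 (s.nreg 10) + s.rreg 10 ≤ s.rmem 3 (s.nreg 12) + s.rreg 11)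
    · obtain ⟨x, r, rfl⟩ := List.exists_cons_of_ne_nil hc.1
      refine Run.straight 57 rfl (by decide) fun t s₁ ht hs₁ => ?_
      have hmg : KeyList.merge (KeyList.shift (s.rreg 10) (x :: r)) (l'.shift (s.rreg 11)) =
          (x.1, x.2 + s.rreg 10) ::
            KeyList.merge (KeyList.shift (s.rreg 10) r) (l'.shift (s.rreg 11)) := by
        rcases l' with _ | ⟨y, r'⟩
        · simp [KeyList.shift]
        · have := hc.2
          rw [h.2.2.1.2, h'.2.2.1.2] at this
          simp only [KeyList.shift_cons]
          rw [KeyList.cons_merge_cons_of_le]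
          simpa using this
      simp only [Program.eff, Test.eval, NExpr.eval, RExpr.eval, hl, hl'] at hs₁
      rw [if_pos hc] at hs₁
      have e11 : s₁.nreg 11 = s.nreg 11 := by simp [hs₁]
      have e12 : s₁.nreg 12 = s.nreg 12 := by simp [hs₁]
      have e13 : s₁.nreg 13 = s.nreg 13 := by simp [hs₁]
      have d0 : s₁.rreg 10 = s.rreg 10 := by simp [hs₁]
      have d1 : s₁.rreg 11 = s.rreg 11 := by simp [hs₁]
      have hH : HeapLE s s₁ := by
        refine ⟨by simp [hs₁], fun k hk => ?_⟩
        simp [hs₁, hk.ne]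
      refine (ih r l' s₁ (by simp at hm; omega) (e11 ▸ ?_) (e12 ▸ e13 ▸ ?_)).mono ?_
      · have := h.mono hH
        have h1 := h.1
        simp only [List.length_cons] at h1
        exact ⟨by simp [hs₁]; omega, this.2.1, by simpa [hs₁] using this.2.2.2⟩
      · exact h'.mono hH
      · rintro t' s' ⟨ht', h1, h2⟩
        refine ⟨?_, ?_, hH.trans h2⟩
        · simp only [Test.cost, NExpr.cost]
          omega
        · rw [hmg]
          have h14 : s₁.nreg 14 = s.nreg 14 + 1 := by simp [hs₁]
          have hcell := h2.2 (s.nreg 14) (by rw [h14]; omega)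
          rw [h14, d0, d1] at h1
          refine ⟨?_, le_rfl, ⟨?_, ?_⟩, h1.2.2⟩
          · rw [h1.1]; simp; omega
          · rw [hcell.1]; simp [hs₁, h.2.2.1.1]
          · rw [hcell.2]; simp [hs₁, h.2.2.1.2]
    · have hne : l' ≠ [] := by
        rintro rfl
        simp at hc
        simp [hc] at hm
      obtain ⟨y, r', rfl⟩ := List.exists_cons_of_ne_nil hne
      refine Run.straight 57 rfl (by decide) fun t s₁ ht hs₁ => ?_
      have hmg : KeyList.merge (KeyList.shift (s.rreg 10) l) (KeyList.shift (s.rreg 11) (y :: r')) =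
          (y.1, y.2 + s.rreg 11) ::
            KeyList.merge (l.shift (s.rreg 10)) (KeyList.shift (s.rreg 11) r') := by
        rcases l with _ | ⟨x, r⟩
        · simp
        · rw [h.2.2.1.2, h'.2.2.1.2] at hc
          simp only [KeyList.shift_cons]
          rw [KeyList.cons_merge_cons_of_not_le]
          simpa using hc
      simp only [Program.eff, Test.eval, NExpr.eval, RExpr.eval, hl, hl'] at hs₁
      rw [if_neg hc] at hs₁
      have e11 : s₁.nreg 11 = s.nreg 11 := by simp [hs₁]
      have e12 : s₁.nreg 10 = s.nreg 10 := by simp [hs₁]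
      have e13 : s₁.nreg 13 = s.nreg 13 := by simp [hs₁]
      have d0 : s₁.rreg 10 = s.rreg 10 := by simp [hs₁]
      have d1 : s₁.rreg 11 = s.rreg 11 := by simp [hs₁]
      have hH : HeapLE s s₁ := by
        refine ⟨by simp [hs₁], fun k hk => ?_⟩
        simp [hs₁, hk.ne]
      refine (ih l r' s₁ (by simp at hm; omega) (e12 ▸ e11 ▸ ?_) (e13 ▸ ?_)).mono ?_
      · exact h.mono hH
      · have := h'.mono hH
        have h1 := h'.1
        simp only [List.length_cons] at h1
        exact ⟨by simp [hs₁]; omega, this.2.1, by simpa [hs₁] using this.2.2.2⟩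
      · rintro t' s' ⟨ht', h1, h2⟩
        refine ⟨?_, ?_, hH.trans h2⟩
        · simp only [Test.cost, NExpr.cost]
          omega
        · rw [hmg]
          have h14 : s₁.nreg 14 = s.nreg 14 + 1 := by simp [hs₁]
          have hcell := h2.2 (s.nreg 14) (by rw [h14]; omega)
          rw [h14, d0, d1] at h1
          refine ⟨?_, le_rfl, ⟨?_, ?_⟩, h1.2.2⟩
          · rw [h1.1]; simp; omega
          · rw [hcell.1]; simp [hs₁, h'.2.2.1.1]
          · rw [hcell.2]; simp [hs₁, h'.2.2.1.2]

/-- For each query in the cells `r10`, …, `r11 - 1`, in the order of their keys, add to its value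
the penalties of the clients in the cells `r12`, …, `r13 - 1` with a smaller key. Real register
`12` accumulates these penalties. -/
def crossLoop : Program :=
  .loop (.not (.nle (.reg 11) (.reg 10)))
    (.ite (.and (.not (.nle (.reg 13) (.reg 12)))
        (.not (.rle (.mem 3 (.reg 10)) (.mem 3 (.reg 12)))))
      (.setR 12 (.add (.reg 12) (.mem 1 (.mem 10 (.mem 24 (.reg 12))))) ;;
        .setN 12 (.add (.reg 12) (.const 1)))
      (.storeR 5 (.mem 24 (.reg 10)) (.add (.mem 5 (.mem 24 (.reg 10))) (.reg 12)) ;;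
        .setN 10 (.add (.reg 10) (.const 1))))

/-- The penalties that a state stores. -/
def penalties (s : State) (u : ℕ) : ℝ := s.rmem 1 (s.nmem 10 u)

/-- The list `p` of the clients already passed is what makes the induction work. The register holds
their total penalty, and since the queries ascend, a client that is below the current query stays
below all later ones. Each iteration consumes a query or a client, hence the linear time. -/
theorem run_crossLoop (m : ℕ) : ∀ (l l' p : KeyList) (s : State), l.length + l'.length = m →
    l.Ascending → l'.Ascending → (∀ x ∈ l, ∀ y ∈ p, y.2 < x.2) →
    s.rreg 12 = (p.map fun y => penalties s y.1).sum →
    Holds s (s.nreg 10) (s.nreg 11) l → Holds s (s.nreg 12) (s.nreg 13) l' →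
    Run crossLoop s fun t s' => t ≤ 60 * m + 60 ∧
      s'.rmem 5 = KeyList.bump (penalties s) l (p ++ l') (s.rmem 5) := by
  induction m with
  | zero =>
    intro l l' p s hm _ _ _ _ h h'
    obtain rfl : l = [] := List.length_eq_zero_iff.1 (by omega)
    refine Run.loop_exit ?_ ⟨by simp [Test.cost, NExpr.cost], rfl⟩
    simp [Test.eval, NExpr.eval, h.1]
  | succ m ih =>
    intro l l' p s hm hla hla' hp hw h h'
    rcases l with _ | ⟨x, r⟩
    · refine Run.loop_exit ?_ ⟨by simp only [Test.cost, NExpr.cost]; omega, rfl⟩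
      simp [Test.eval, NExpr.eval, h.1]
    have hl' : (s.nreg 13 ≤ s.nreg 12 ↔ l' = []) := by
      rw [h'.1, ← List.length_eq_zero_iff]; omega
    refine Run.loop_unfold ?_ ?_
    · simp [Test.eval, NExpr.eval, h.1]
    refine Run.straight 50 rfl (by decide) fun t s₁ ht hs₁ => ?_
    simp only [Program.eff, Test.eval, NExpr.eval, RExpr.eval, hl', h.2.2.1.1, h.2.2.1.2] at hs₁
    by_cases hc : l' ≠ [] ∧ ¬ x.2 ≤ s.rmem 3 (s.nreg 12)
    · rw [if_pos hc] at hs₁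
      obtain ⟨y, r', rfl⟩ := List.exists_cons_of_ne_nil hc.1
      rw [h'.2.2.1.1, h'.2.2.1.2] at *
      have e10 : s₁.nreg 10 = s.nreg 10 := by simp [hs₁]
      have e11 : s₁.nreg 11 = s.nreg 11 := by simp [hs₁]
      have e13 : s₁.nreg 13 = s.nreg 13 := by simp [hs₁]
      have hH : HeapLE s s₁ := .of_eq (by simp [hs₁]) (by simp [hs₁]) (by simp [hs₁])
      have hpen : penalties s₁ = penalties s := by funext u; simp [penalties, hs₁]
      have hacc : s₁.rmem 5 = s.rmem 5 := by simp [hs₁]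
      refine (ih (x :: r) r' (p ++ [y]) s₁ (by simp at hm ⊢; omega) hla
        (List.pairwise_cons.1 hla').2 ?_ ?_ (e10 ▸ e11 ▸ h.mono hH) ?_).mono ?_
      · intro z hz z' hz'
        rcases List.mem_append.1 hz' with hz' | hz'
        · exact hp z hz z' hz'
        · obtain rfl : z' = y := by simpa using hz'
          rcases List.mem_cons.1 hz with rfl | hz
          · exact not_le.1 hc.2
          · exact (not_le.1 hc.2).trans_le ((List.pairwise_cons.1 hla).1 z hz)
      · simp only [hpen]
        simp [hs₁, hw, penalties]
      · have := h'.mono hH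
        have h1 := h'.1
        simp only [List.length_cons] at h1
        refine ⟨?_, e13 ▸ this.2.1, ?_⟩
        · simp [hs₁]; omega
        · have h2 := this.2.2.2
          have e12 : s₁.nreg 12 = s.nreg 12 + 1 := by simp [hs₁]
          rwa [e12]
      · rintro t' s' ⟨ht', h1⟩
        rw [hpen, hacc, List.append_assoc] at h1
        refine ⟨?_, h1⟩
        simp only [Test.cost, NExpr.cost]
        omega
    · rw [if_neg hc] at hs₁
      have e11 : s₁.nreg 11 = s.nreg 11 := by simp [hs₁]
      have e12 : s₁.nreg 12 = s.nreg 12 := by simp [hs₁]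
      have e13 : s₁.nreg 13 = s.nreg 13 := by simp [hs₁]
      have hH : HeapLE s s₁ := .of_eq (by simp [hs₁]) (by simp [hs₁]) (by simp [hs₁])
      have hpen : penalties s₁ = penalties s := by funext u; simp [penalties, hs₁]
      -- The clients ascend and the first one left is not below the query, so none of those left is.
      -- The register therefore already holds the full contribution to this query.
      have hkey : ∀ y ∈ l', x.2 ≤ y.2 := by
        rcases l' with _ | ⟨y, r'⟩
        · simp
        · rw [h'.2.2.1.2] at hc
          have hxy : x.2 ≤ y.2 := by simpa using hc
          intro z hz
          rcases List.mem_cons.1 hz with rfl | hz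
          · exact hxy
          · exact hxy.trans ((List.pairwise_cons.1 hla').1 z hz)
      have hw' : KeyList.weightBelow (penalties s) (p ++ l') x.2 = s.rreg 12 := by
        rw [KeyList.weightBelow, List.map_append, List.sum_append, ← KeyList.weightBelow,
          ← KeyList.weightBelow, KeyList.weightBelow_eq_zero _ hkey, add_zero, hw]
        refine congrArg _ (List.map_congr_left fun y hy => ?_)
        rw [if_pos (hp x (by simp) y hy)]
      have hacc : s₁.rmem 5 =
          Function.update (s.rmem 5) x.1 (s.rmem 5 x.1 +
            KeyList.weightBelow (penalties s) (p ++ l') x.2) := by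
        rw [hw']; simp [hs₁]
      refine (ih r l' p s₁ (by simp at hm; omega) (List.pairwise_cons.1 hla).2 hla'
        (fun z hz => hp z (List.mem_cons_of_mem _ hz)) ?_ ?_ (e12 ▸ e13 ▸ h'.mono hH)).mono ?_
      · rw [hpen, ← hw]
        simp [hs₁]
      · have := h.mono hH
        have h1 := h.1
        simp only [List.length_cons] at h1
        refine ⟨?_, e11 ▸ this.2.1, ?_⟩
        · simp [hs₁]; omega
        · have h2 := this.2.2.2
          have e12 : s₁.nreg 10 = s.nreg 10 + 1 := by simp [hs₁]
          rwa [e12]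
      · rintro t' s' ⟨ht', h1⟩
        rw [hpen, hacc] at h1
        refine ⟨?_, h1⟩
        simp only [Test.cost, NExpr.cost]
        omega

end RealRAM

/-! ## Clusters -/

/-- A cluster of a tree, seen from its terminals `top` and `bot`, whose distance is `len`. It has
the clients `pts` and the queries `aq`; the queries `tq` also count clients above the cluster, and
the queries `bq` also count clients below it. The lists `qt` and `qb` hold `tq` and `bq`, keyed by
the distance to `top` and `bot`; the lists `ct` and `cb` hold the clients, keyed by the part of
their radius that is left at `top` and `bot`. -/
structure Cluster where
  qt : KeyList
  qb : KeyList
  ct : KeyList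
  cb : KeyList
  len : ℝ
  pts : List ℕ
  tq : List ℕ
  bq : List ℕ
  aq : List ℕ
  top : ℕ
  bot : ℕ

namespace Cluster

/-- The union of a cluster with one that hangs from its bottom terminal. -/
noncomputable def join (X Y : Cluster) : Cluster where
  qt := KeyList.merge (X.qt.shift 0) (Y.qt.shift X.len)
  qb := KeyList.merge (X.qb.shift Y.len) (Y.qb.shift 0)
  ct := KeyList.merge (X.ct.shift 0) (Y.ct.shift (0 - X.len))
  cb := KeyList.merge (X.cb.shift (0 - Y.len)) (Y.cb.shift 0)
  len := X.len + Y.len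
  pts := X.pts ++ Y.pts
  tq := X.tq ++ Y.tq
  bq := X.bq ++ Y.bq
  aq := X.aq ++ Y.aq
  top := X.top
  bot := Y.bot

/-- Regard a cluster as one whose two terminals are its top. -/
def close (X : Cluster) : Cluster :=
  { X with qb := X.qt, cb := X.ct, len := 0, bq := X.tq, bot := X.top }

/-- The total length of the lists of a cluster. -/
def size (X : Cluster) : ℕ := X.qt.length + X.qb.length + X.ct.length + X.cb.length

end Cluster

/-! ### Clusters in memory -/

namespace RealRAM

/-- The lists of the cluster `X` are those of the name `i`: the natural arrays `16`, …, `23` hold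
their bounds, and the real array `4` holds the distance of the terminals. -/
structure StoresCluster (s : State) (i : ℕ) (X : Cluster) : Prop where
  qt : Holds s (s.nmem 16 i) (s.nmem 17 i) X.qt
  qb : Holds s (s.nmem 18 i) (s.nmem 19 i) X.qb
  ct : Holds s (s.nmem 20 i) (s.nmem 21 i) X.ct
  cb : Holds s (s.nmem 22 i) (s.nmem 23 i) X.cb
  len : s.rmem 4 i = X.len

/-- The data stored under the name `i` are the same in both states. -/
def SameAt (i : ℕ) (s s' : State) : Prop :=
  (∀ a, 13 ≤ a → a ≤ 23 → s'.nmem a i = s.nmem a i) ∧ s'.rmem 4 i = s.rmem 4 i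

theorem SameAt.trans {i : ℕ} {s s' s'' : State} (h : SameAt i s s') (h' : SameAt i s' s'') :
    SameAt i s s'' :=
  ⟨fun a h₁ h₂ => (h'.1 a h₁ h₂).trans (h.1 a h₁ h₂), h'.2.trans h.2⟩

theorem StoresCluster.mono {s s' : State} {i : ℕ} {X : Cluster} (h : StoresCluster s i X)
    (hs : HeapLE s s') (hi : SameAt i s s') : StoresCluster s' i X where
  qt := by rw [hi.1 16 (by decide) (by decide), hi.1 17 (by decide) (by decide)]; exact h.qt.mono hs
  qb := by rw [hi.1 18 (by decide) (by decide), hi.1 19 (by decide) (by decide)]; exact h.qb.mono hs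
  ct := by rw [hi.1 20 (by decide) (by decide), hi.1 21 (by decide) (by decide)]; exact h.ct.mono hs
  cb := by rw [hi.1 22 (by decide) (by decide), hi.1 23 (by decide) (by decide)]; exact h.cb.mono hs
  len := by rw [hi.2]; exact h.len

/-- Load the bounds of a list of the name in register `20` and of one of the name in register
`21`. -/
def loadBounds (a b a' b' : ℕ) : Program :=
  .setN 10 (.mem a (.reg 20)) ;; .setN 11 (.mem b (.reg 20)) ;;
    .setN 12 (.mem a' (.reg 21)) ;; .setN 13 (.mem b' (.reg 21))

/-- Merge the lists with bounds in the arrays `a` and `b` of the names in the registers `20` and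
`21`, shifted by `d` and `d'`, and store the result under the former. -/
def mergeLists (a b : ℕ) (d d' : RExpr) : Program :=
  (loadBounds a b a b ;; .setR 10 d ;; .setR 11 d' ;; .setN 15 (.reg 14)) ;; mergeLoop ;;
    .storeN a (.reg 20) (.reg 15) ;; .storeN b (.reg 20) (.reg 14)

/-- The shifts `d` and `d'` are evaluated after some registers have been overwritten. Hence `hd`
asks for their values in all states that agree with `s` in the names of the two clusters and in the
real arrays. -/
theorem run_mergeLists {a b : ℕ} {d d' : RExpr} {s : State} {l l' : KeyList} {v v' : ℝ}
    (hab : a ≠ b) (ha : a ≠ 24) (hb : b ≠ 24)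
    (hd : ∀ s' : State, s'.nreg 20 = s.nreg 20 → s'.nreg 21 = s.nreg 21 → s'.rmem = s.rmem →
      d.eval s' = v ∧ d'.eval s' = v')
    (hcost : d.cost ≤ 5 ∧ d'.cost ≤ 5)
    (h : Holds s (s.nmem a (s.nreg 20)) (s.nmem b (s.nreg 20)) l)
    (h' : Holds s (s.nmem a (s.nreg 21)) (s.nmem b (s.nreg 21)) l') :
    Run (mergeLists a b d d') s fun t s' => (t ≤ 70 * (l.length + l'.length) + 110 ∧
      Holds s' (s'.nmem a (s.nreg 20)) (s'.nmem b (s.nreg 20))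
        (KeyList.merge (l.shift v) (l'.shift v')) ∧ HeapLE s s' ∧
      ∀ j ≠ s.nreg 20, s'.nmem a j = s.nmem a j ∧ s'.nmem b j = s.nmem b j) ∧
      Frame [10, 11, 12, 13, 14, 15] [10, 11] [24, a, b] [3] s s' := by
  refine Run.frame (by simp [mergeLists, loadBounds, mergeLoop, Program.writes]) ?_
  refine Run.seq (Run.straight 26 rfl ?_ ?_)
  · simp only [loadBounds, Program.bound, NExpr.cost]; omega
  intro t s₁ ht hs₁
  have hs₁' : s₁ = ⟨Function.update (Function.update (Function.update (Function.update
      (Function.update s.nreg 10 (s.nmem a (s.nreg 20))) 11 (s.nmem b (s.nreg 20)))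
      12 (s.nmem a (s.nreg 21))) 13 (s.nmem b (s.nreg 21))) 15 (s.nreg 14),
      Function.update (Function.update s.rreg 10 v) 11 v', s.nmem, s.rmem⟩ := by
    rw [hs₁]
    have h1 := fun s' h₁ h₂ h₃ => (hd s' h₁ h₂ h₃).1
    have h2 := fun s' h₁ h₂ h₃ => (hd s' h₁ h₂ h₃).2
    simp [loadBounds, Program.eff, NExpr.eval, h1, h2]
  clear hs₁
  have hH : HeapLE s s₁ := .of_eq (by simp [hs₁']) (by simp [hs₁']) (by simp [hs₁'])
  have e0 : s₁.nreg 10 = s.nmem a (s.nreg 20) := by simp [hs₁']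
  have e1 : s₁.nreg 11 = s.nmem b (s.nreg 20) := by simp [hs₁']
  have e2 : s₁.nreg 12 = s.nmem a (s.nreg 21) := by simp [hs₁']
  have e3 : s₁.nreg 13 = s.nmem b (s.nreg 21) := by simp [hs₁']
  have e4 : s₁.rreg 10 = v := by simp [hs₁']
  have e5 : s₁.rreg 11 = v' := by simp [hs₁']
  have e6 : s₁.nreg 14 = s.nreg 14 := by simp [hs₁']
  refine Run.seq ((Run.frame (nr := [10, 12, 14]) (rr := []) (nm := [24]) (rm := [3])
    (by simp [mergeLoop, Program.writes]) (run_mergeLoop _ l l' s₁ rfl (e0 ▸ e1 ▸ h.mono hH)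
      (e2 ▸ e3 ▸ h'.mono hH))).mono ?_)
  rintro t' s₂ ⟨⟨ht', h1, h2⟩, hf⟩
  refine Run.straight 10 rfl (by simp [Program.bound, NExpr.cost]) fun t'' s₃ ht'' hs₃ => ?_
  rw [e4, e5, e6] at h1
  have f20 : s₂.nreg 20 = s.nreg 20 := by rw [hf.nreg 20 (by decide)]; simp [hs₁']
  have f15 : s₂.nreg 15 = s.nreg 14 := by rw [hf.nreg 15 (by decide)]; simp [hs₁']
  have fa : s₂.nmem a = s.nmem a := by rw [hf.nmem a (by simpa)]; simp [hs₁']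
  have fb : s₂.nmem b = s.nmem b := by rw [hf.nmem b (by simpa)]; simp [hs₁']
  have hs₃' : s₃ = ⟨s₂.nreg, s₂.rreg, Function.update (Function.update s₂.nmem a
      (Function.update (s.nmem a) (s.nreg 20) (s.nreg 14))) b
      (Function.update (s.nmem b) (s.nreg 20) (s₂.nreg 14)), s₂.rmem⟩ := by
    rw [hs₃]
    simp [Program.eff, NExpr.eval, f20, f15, fa, fb, hab.symm]
  have hH' : HeapLE s₂ s₃ := .of_eq (by simp [hs₃'])
    (by simp [hs₃', Function.update_of_ne ha.symm, Function.update_of_ne hb.symm]) (by simp [hs₃'])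
  refine ⟨by omega, ?_, (hH.trans h2).trans hH', fun j hj => ?_⟩
  · have := h1.mono hH'
    simpa [hs₃', hab, Function.update_of_ne hab] using this
  · simp [hs₃', hab, hj]

/-- Let the queries of a list of the name in register `20` count the clients of a list of the name
in register `21`. -/
def crossLists (a b a' b' : ℕ) : Program :=
  (loadBounds a b a' b' ;; .setR 12 (.const 0)) ;; crossLoop

theorem run_crossLists {a b a' b' : ℕ} {s : State} {l l' : KeyList} (hl : l.Ascending)
    (hl' : l'.Ascending)
    (h : Holds s (s.nmem a (s.nreg 20)) (s.nmem b (s.nreg 20)) l)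
    (h' : Holds s (s.nmem a' (s.nreg 21)) (s.nmem b' (s.nreg 21)) l') :
    Run (crossLists a b a' b') s fun t s' => (t ≤ 60 * (l.length + l'.length) + 80 ∧
      s'.rmem 5 = KeyList.bump (penalties s) l l' (s.rmem 5)) ∧
      Frame [10, 11, 12, 13] [12] [] [5] s s' := by
  refine Run.frame (by simp [crossLists, loadBounds, crossLoop, Program.writes]) ?_
  refine Run.seq (Run.straight 20 rfl (by simp [loadBounds, Program.bound, NExpr.cost, RExpr.cost])
    fun t s₁ ht hs₁ => ?_)
  simp only [loadBounds, Program.eff, NExpr.eval, RExpr.eval] at hs₁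
  have hH : HeapLE s s₁ := .of_eq (by simp [hs₁]) (by simp [hs₁]) (by simp [hs₁])
  have e0 : s₁.nreg 10 = s.nmem a (s.nreg 20) := by simp [hs₁]
  have e1 : s₁.nreg 11 = s.nmem b (s.nreg 20) := by simp [hs₁]
  have e2 : s₁.nreg 12 = s.nmem a' (s.nreg 21) := by simp [hs₁]
  have e3 : s₁.nreg 13 = s.nmem b' (s.nreg 21) := by simp [hs₁]
  have hpen : penalties s₁ = penalties s := by funext u; simp [penalties, hs₁]
  have hacc : s₁.rmem 5 = s.rmem 5 := by simp [hs₁]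
  refine (run_crossLoop _ l l' [] s₁ rfl hl hl' (by simp) (by simp [hs₁]) (e0 ▸ e1 ▸ h.mono hH)
    (e2 ▸ e3 ▸ h'.mono hH)).mono ?_
  rintro t' s' ⟨ht', h1⟩
  rw [hpen, hacc] at h1
  exact ⟨by omega, h1⟩

/-- Replace the cluster named by register `20` by its union with the one named by register `21`,
which hangs from its bottom terminal. -/
def joinClusters : Program :=
  crossLists 18 19 20 21 ;;
    (.setN 22 (.reg 20) ;; .setN 20 (.reg 21) ;; .setN 21 (.reg 22)) ;;
    crossLists 16 17 22 23 ;;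
    (.setN 22 (.reg 20) ;; .setN 20 (.reg 21) ;; .setN 21 (.reg 22)) ;;
    mergeLists 16 17 (.const 0) (.mem 4 (.reg 20)) ;;
    mergeLists 18 19 (.mem 4 (.reg 21)) (.const 0) ;;
    mergeLists 20 21 (.const 0) (.sub (.const 0) (.mem 4 (.reg 20))) ;;
    mergeLists 22 23 (.sub (.const 0) (.mem 4 (.reg 21))) (.const 0) ;;
    .storeR 4 (.reg 20) (.add (.mem 4 (.reg 20)) (.mem 4 (.reg 21)))

/-- The crossings precede the merges because a merge overwrites the bounds of the lists of the upper
cluster. The length is updated last because the merges read it. The two names are exchanged for the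
second crossing, in which the lower cluster asks. Crossing costs 60 per entry and merging 70,
together 130. -/
theorem run_joinClusters {s : State} {x y : ℕ} {X Y : Cluster} (hx : s.nreg 20 = x)
    (hy : s.nreg 21 = y) (hxy : x ≠ y) (hX : StoresCluster s x X) (hY : StoresCluster s y Y)
    (hqb : X.qb.Ascending) (hct : Y.ct.Ascending) (hqt : Y.qt.Ascending) (hcb : X.cb.Ascending) :
    Run joinClusters s fun t s' => (t ≤ 130 * (X.size + Y.size) + 700 ∧
      StoresCluster s' x (X.join Y) ∧ HeapLE s s' ∧ s'.nreg 20 = x ∧ s'.nreg 21 = y ∧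
      (∀ j ≠ x, SameAt j s s') ∧
      s'.rmem 5 = KeyList.bump (penalties s) Y.qt X.cb
        (KeyList.bump (penalties s) X.qb Y.ct (s.rmem 5))) ∧
      Frame [10, 11, 12, 13, 14, 15, 20, 21, 22] [10, 11, 12] [16, 17, 18, 19, 20, 21, 22, 23, 24]
        [3, 4, 5] s s' := by
  refine Run.frame (by decide) ?_
  subst hx hy
  refine Run.seq ((run_crossLists hqb hct hX.qb hY.ct).mono ?_)
  rintro t₁ s₁ ⟨⟨ht₁, h₁⟩, f₁⟩
  refine Run.seq (Run.straight 6 rfl (by decide) fun t₂ s₂ ht₂ hs₂ => ?_)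
  simp only [Program.eff, NExpr.eval] at hs₂
  have H₂ : HeapLE s s₂ := .of_eq (by simp [hs₂, f₁.nreg 14]) (by simp [hs₂, f₁.nmem 24])
    (by simp [hs₂, f₁.rmem 3])
  have n₂ : s₂.nmem = s.nmem := by funext a; simp [hs₂, f₁.nmem a]
  have a₂ : s₂.nreg 20 = s.nreg 21 := by simp [hs₂, f₁.nreg 21]
  have b₂ : s₂.nreg 21 = s.nreg 20 := by simp [hs₂, f₁.nreg 20]
  have r₂ : s₂.rmem 1 = s.rmem 1 := by simp [hs₂, f₁.rmem 1]
  have p₂ : penalties s₂ = penalties s := by funext u; simp only [penalties, n₂, r₂]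
  refine Run.seq ((run_crossLists hqt hcb (by rw [n₂, a₂]; exact hY.qt.mono H₂)
    (by rw [n₂, b₂]; exact hX.cb.mono H₂)).mono ?_)
  rintro t₃ s₃ ⟨⟨ht₃, h₃⟩, f₃⟩
  refine Run.seq (Run.straight 6 rfl (by decide) fun t₄ s₄ ht₄ hs₄ => ?_)
  simp only [Program.eff, NExpr.eval] at hs₄
  have H₄ : HeapLE s s₄ := H₂.trans (.of_eq (by simp [hs₄, f₃.nreg 14]) (by simp [hs₄, f₃.nmem 24])
    (by simp [hs₄, f₃.rmem 3]))
  have n₄ : s₄.nmem = s.nmem := by funext a; simp [hs₄, f₃.nmem a, n₂]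
  have a₄ : s₄.nreg 20 = s.nreg 20 := by simp [hs₄, f₃.nreg 21, b₂]
  have b₄ : s₄.nreg 21 = s.nreg 21 := by simp [hs₄, f₃.nreg 20, a₂]
  have l₄ : s₄.rmem 4 = s.rmem 4 := by simp [hs₄, f₃.rmem 4, hs₂, f₁.rmem 4]
  have acc₄ : s₄.rmem 5 = KeyList.bump (penalties s) Y.qt X.cb
        (KeyList.bump (penalties s) X.qb Y.ct (s.rmem 5)) := by
    have : s₂.rmem 5 = s₁.rmem 5 := by simp [hs₂]
    rw [p₂, this, h₁] at h₃
    simp [hs₄, h₃]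
  clear h₁ h₃ f₁ f₃ hs₂ hs₄ H₂ n₂ a₂ b₂ r₂ p₂
  refine Run.seq ((run_mergeLists (v := 0) (v' := X.len) (l := X.qt) (l' := Y.qt) (by decide)
    (by decide) (by decide) ?_ (by decide) ?_ ?_).mono ?_)
  · intro s' h1 h2 h3
    simp [RExpr.eval, NExpr.eval, h1, h3, a₄, l₄, hX.len]
  · rw [n₄, a₄]; exact hX.qt.mono H₄
  · rw [n₄, b₄]; exact hY.qt.mono H₄
  rintro t₅ s₅ ⟨⟨ht₅, q₅, H₅, e₅⟩, f₅⟩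
  have a₅ : s₅.nreg 20 = s.nreg 20 := by rw [f₅.nreg 20 (by decide), a₄]
  have b₅ : s₅.nreg 21 = s.nreg 21 := by rw [f₅.nreg 21 (by decide), b₄]
  have l₅ : s₅.rmem 4 = s.rmem 4 := by rw [f₅.rmem 4 (by decide), l₄]
  rw [a₄] at q₅ e₅
  refine Run.seq ((run_mergeLists (v := Y.len) (v' := 0) (l := X.qb) (l' := Y.qb) (by decide)
    (by decide) (by decide) ?_ (by decide) ?_ ?_).mono ?_)
  · intro s' h1 h2 h3
    simp [RExpr.eval, NExpr.eval, h2, h3, b₅, l₅, hY.len]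
  · rw [f₅.nmem 18 (by decide), f₅.nmem 19 (by decide), n₄, a₅]; exact hX.qb.mono (H₄.trans H₅)
  · rw [f₅.nmem 18 (by decide), f₅.nmem 19 (by decide), n₄, b₅]; exact hY.qb.mono (H₄.trans H₅)
  rintro t₆ s₆ ⟨⟨ht₆, q₆, H₆, e₆⟩, f₆⟩
  have a₆ : s₆.nreg 20 = s.nreg 20 := by rw [f₆.nreg 20 (by decide), a₅]
  have b₆ : s₆.nreg 21 = s.nreg 21 := by rw [f₆.nreg 21 (by decide), b₅]
  have l₆ : s₆.rmem 4 = s.rmem 4 := by rw [f₆.rmem 4 (by decide), l₅]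
  rw [a₅] at q₆ e₆
  refine Run.seq ((run_mergeLists (v := 0) (v' := 0 - X.len) (l := X.ct) (l' := Y.ct) (by decide)
    (by decide) (by decide) ?_ (by decide) ?_ ?_).mono ?_)
  · intro s' h1 h2 h3
    simp [RExpr.eval, NExpr.eval, h1, h3, a₆, l₆, hX.len]
  · rw [f₆.nmem 20 (by decide), f₆.nmem 21 (by decide), f₅.nmem 20 (by decide),
      f₅.nmem 21 (by decide), n₄, a₆]
    exact hX.ct.mono ((H₄.trans H₅).trans H₆)
  · rw [f₆.nmem 20 (by decide), f₆.nmem 21 (by decide), f₅.nmem 20 (by decide),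
      f₅.nmem 21 (by decide), n₄, b₆]
    exact hY.ct.mono ((H₄.trans H₅).trans H₆)
  rintro t₇ s₇ ⟨⟨ht₇, q₇, H₇, e₇⟩, f₇⟩
  have a₇ : s₇.nreg 20 = s.nreg 20 := by rw [f₇.nreg 20 (by decide), a₆]
  have b₇ : s₇.nreg 21 = s.nreg 21 := by rw [f₇.nreg 21 (by decide), b₆]
  have l₇ : s₇.rmem 4 = s.rmem 4 := by rw [f₇.rmem 4 (by decide), l₆]
  rw [a₆] at q₇ e₇
  refine Run.seq ((run_mergeLists (v := 0 - Y.len) (v' := 0) (l := X.cb) (l' := Y.cb) (by decide)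
    (by decide) (by decide) ?_ (by decide) ?_ ?_).mono ?_)
  · intro s' h1 h2 h3
    simp [RExpr.eval, NExpr.eval, h2, h3, b₇, l₇, hY.len]
  · rw [f₇.nmem 22 (by decide), f₇.nmem 23 (by decide), f₆.nmem 22 (by decide),
      f₆.nmem 23 (by decide), f₅.nmem 22 (by decide), f₅.nmem 23 (by decide), n₄, a₇]
    exact hX.cb.mono (((H₄.trans H₅).trans H₆).trans H₇)
  · rw [f₇.nmem 22 (by decide), f₇.nmem 23 (by decide), f₆.nmem 22 (by decide),
      f₆.nmem 23 (by decide), f₅.nmem 22 (by decide), f₅.nmem 23 (by decide), n₄, b₇]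
    exact hY.cb.mono (((H₄.trans H₅).trans H₆).trans H₇)
  rintro t₈ s₈ ⟨⟨ht₈, q₈, H₈, e₈⟩, f₈⟩
  have a₈ : s₈.nreg 20 = s.nreg 20 := by rw [f₈.nreg 20 (by decide), a₇]
  have b₈ : s₈.nreg 21 = s.nreg 21 := by rw [f₈.nreg 21 (by decide), b₇]
  have l₈ : s₈.rmem 4 = s.rmem 4 := by rw [f₈.rmem 4 (by decide), l₇]
  rw [a₇] at q₈ e₈
  refine Run.straight 20 rfl (by decide) fun t₉ s₉ ht₉ hs₉ => ?_
  simp only [Program.eff, NExpr.eval, RExpr.eval, a₈, b₈, l₈, hX.len, hY.len] at hs₉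
  have n₉ : s₉.nmem = s₈.nmem := by simp [hs₉]
  have H₉ : HeapLE s₈ s₉ := .of_eq (by simp [hs₉]) (by simp [hs₉]) (by simp [hs₉])
  refine ⟨?_, ⟨?_, ?_, ?_, ?_, ?_⟩, ((((H₄.trans H₅).trans H₆).trans H₇).trans H₈).trans H₉,
    by simp [hs₉, a₈], by simp [hs₉, b₈], fun j hj => ⟨fun a h1 h2 => ?_, ?_⟩, ?_⟩
  · simp only [Cluster.size]
    omega
  · rw [n₉, f₈.nmem 16 (by decide), f₈.nmem 17 (by decide), f₇.nmem 16 (by decide),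
      f₇.nmem 17 (by decide), f₆.nmem 16 (by decide), f₆.nmem 17 (by decide)]
    exact q₅.mono (((H₆.trans H₇).trans H₈).trans H₉)
  · rw [n₉, f₈.nmem 18 (by decide), f₈.nmem 19 (by decide), f₇.nmem 18 (by decide),
      f₇.nmem 19 (by decide)]
    exact q₆.mono ((H₇.trans H₈).trans H₉)
  · rw [n₉, f₈.nmem 20 (by decide), f₈.nmem 21 (by decide)]
    exact q₇.mono (H₈.trans H₉)
  · rw [n₉]
    exact q₈.mono H₉
  · simp [hs₉, Cluster.join]
  · rw [n₉, ← n₄]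
    have h5 := e₅ j hj
    have h6 := e₆ j hj
    have h7 := e₇ j hj
    have h8 := e₈ j hj
    have g5 := f₅.nmem a
    have g6 := f₆.nmem a
    have g7 := f₇.nmem a
    have g8 := f₈.nmem a
    interval_cases a <;> simp_all
  · simp [hs₉, hj]
  · rw [← acc₄]
    simp [hs₉, f₈.rmem 5, f₇.rmem 5, f₆.rmem 5, f₅.rmem 5]

end RealRAM

/-! ## Trees of clusters -/

/-- A metric with clients and queries. The client `u` has the penalty `pen u` and the radius
`rad u`; the query `q` asks at the place `loc q` for the total penalty of the clients it cares about
whose radius is exceeded. Free queries care about all clients above their cluster. -/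
structure QuerySystem where
  dist : ℕ → ℕ → ℝ
  dist_self : ∀ v, dist v v = 0
  dist_comm : ∀ u v, dist u v = dist v u
  pen : ℕ → ℝ
  rad : ℕ → ℝ
  loc : ℕ → ℕ
  cares : ℕ → ℕ → Prop
  free : ℕ → Prop

open Classical in
/-- The contribution of the client `u` to the query `q`. -/
noncomputable def QuerySystem.val (S : QuerySystem) (q u : ℕ) : ℝ :=
  if S.cares q u ∧ S.rad u < S.dist u (S.loc q) then S.pen u else 0

namespace Cluster

/-- The places that a cluster refers to, apart from its top. -/
def places (S : QuerySystem) (X : Cluster) : List ℕ := X.bot :: X.pts ++ X.aq.map S.loc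

/-- The lists of a cluster are what they should be. -/
structure Valid (S : QuerySystem) (X : Cluster) : Prop where
  qt_asc : X.qt.Ascending
  qb_asc : X.qb.Ascending
  ct_asc : X.ct.Ascending
  cb_asc : X.cb.Ascending
  qt_perm : X.qt.Perm (X.tq.map fun q => (q, S.dist (S.loc q) X.top))
  qb_perm : X.qb.Perm (X.bq.map fun q => (q, S.dist (S.loc q) X.bot))
  ct_perm : X.ct.Perm (X.pts.map fun u => (u, S.rad u - S.dist u X.top))
  cb_perm : X.cb.Perm (X.pts.map fun u => (u, S.rad u - S.dist u X.bot))
  len_eq : X.len = S.dist X.top X.bot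
  mem_tq : ∀ q ∈ X.aq, q ∈ X.tq ↔ S.free q
  tq_subset : X.tq ⊆ X.aq
  bq_subset : X.bq ⊆ X.aq
  tq_nodup : X.tq.Nodup
  bq_nodup : X.bq.Nodup

/-- The queries of `X` have their values with respect to the clients of `X`. -/
def Answered (S : QuerySystem) (acc : ℕ → ℝ) (X : Cluster) : Prop :=
  ∀ q ∈ X.aq, acc q = (X.pts.map (S.val q)).sum

variable {S : QuerySystem} {X Y : Cluster}

/-- Each query and each client occurs at most once per terminal, so the lists stay linear in the
number of queries and clients however often clusters have been joined. -/
theorem Valid.size_le (h : X.Valid S) : X.size ≤ 2 * (X.aq.length + X.pts.length) := by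
  have h1 := (h.tq_nodup.subperm h.tq_subset).length_le
  have h2 := (h.bq_nodup.subperm h.bq_subset).length_le
  rw [size, h.qt_perm.length_eq, h.qb_perm.length_eq, h.ct_perm.length_eq, h.cb_perm.length_eq]
  simp only [List.length_map]
  omega

theorem Valid.close (h : X.Valid S) : X.close.Valid S :=
  { h with
    qb_asc := h.qt_asc
    cb_asc := h.ct_asc
    qb_perm := h.qt_perm
    cb_perm := h.ct_perm
    len_eq := (S.dist_self _).symm
    bq_subset := h.tq_subset
    bq_nodup := h.tq_nodup }

/-- All connections between the two parts lead through `X.bot`. Seen from the far terminal,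
distances grow by the length of the other cluster and remaining radii shrink by it. These are the
constant shifts in `Cluster.join`. -/
theorem Valid.join (hX : X.Valid S) (hY : Y.Valid S) (htop : Y.top = X.bot)
    (hgate : ∀ v ∈ X.top :: X.places S, ∀ v' ∈ Y.places S,
      S.dist v v' = S.dist v X.bot + S.dist X.bot v')
    (hnd : (X.aq ++ Y.aq).Nodup) : (X.join Y).Valid S where
  qt_asc := (hX.qt_asc.shift _).merge (hY.qt_asc.shift _)
  qb_asc := (hX.qb_asc.shift _).merge (hY.qb_asc.shift _)
  ct_asc := (hX.ct_asc.shift _).merge (hY.ct_asc.shift _)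
  cb_asc := (hX.cb_asc.shift _).merge (hY.cb_asc.shift _)
  qt_perm := by
    refine (KeyList.merge_perm _ _).trans ?_
    simp only [Cluster.join, List.map_append]
    refine List.Perm.append ?_ ?_
    · refine (hX.qt_perm.map _).trans (List.Perm.of_eq ?_)
      simp
    · refine (hY.qt_perm.map _).trans (List.Perm.of_eq ?_)
      rw [List.map_map]
      refine List.map_congr_left fun q hq => ?_
      have := hgate X.top (by simp) (S.loc q) (by simp [places]; exact .inr (.inr ⟨q, hY.tq_subset hq, rfl⟩))
      simp only [Function.comp, hX.len_eq, htop]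
      rw [S.dist_comm _ X.top, this, S.dist_comm _ X.bot, add_comm]
  qb_perm := by
    refine (KeyList.merge_perm _ _).trans ?_
    simp only [Cluster.join, List.map_append]
    refine List.Perm.append ?_ ?_
    · refine (hX.qb_perm.map _).trans (List.Perm.of_eq ?_)
      rw [List.map_map]
      refine List.map_congr_left fun q hq => ?_
      have := hgate (S.loc q) (by simp [places]; exact .inr (.inr (.inr ⟨q, hX.bq_subset hq, rfl⟩))) Y.bot
        (by simp [places])
      simp only [Function.comp, hY.len_eq, htop]
      rw [this]
    · refine (hY.qb_perm.map _).trans (List.Perm.of_eq ?_)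
      simp
  ct_perm := by
    refine (KeyList.merge_perm _ _).trans ?_
    simp only [Cluster.join, List.map_append]
    refine List.Perm.append ?_ ?_
    · refine (hX.ct_perm.map _).trans (List.Perm.of_eq ?_)
      simp
    · refine (hY.ct_perm.map _).trans (List.Perm.of_eq ?_)
      rw [List.map_map]
      refine List.map_congr_left fun u hu => ?_
      have := hgate X.top (by simp) u (by simp [places, hu])
      simp only [Function.comp, hX.len_eq, htop]
      rw [S.dist_comm _ X.top, this, S.dist_comm _ X.bot]
      congr 1
      ring
  cb_perm := by
    refine (KeyList.merge_perm _ _).trans ?_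
    simp only [Cluster.join, List.map_append]
    refine List.Perm.append ?_ ?_
    · refine (hX.cb_perm.map _).trans (List.Perm.of_eq ?_)
      rw [List.map_map]
      refine List.map_congr_left fun u hu => ?_
      have := hgate u (by simp [places, hu]) Y.bot (by simp [places])
      simp only [Function.comp, hY.len_eq, htop]
      rw [this]
      congr 1
      ring
    · refine (hY.cb_perm.map _).trans (List.Perm.of_eq ?_)
      simp
  len_eq := by
    have := hgate X.top (by simp) Y.bot (by simp [places])
    simp only [Cluster.join]
    rw [this, hX.len_eq, hY.len_eq, htop]
  mem_tq q hq := by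
    simp only [Cluster.join, List.mem_append] at hq ⊢
    have hd := List.disjoint_of_nodup_append hnd
    rcases hq with hq | hq
    · rw [← hX.mem_tq q hq]
      exact or_iff_left fun h => hd hq (hY.tq_subset h)
    · rw [← hY.mem_tq q hq]
      exact or_iff_right fun h => hd (hX.tq_subset h) hq
  tq_subset := List.append_subset.2 ⟨List.subset_append_of_subset_left _ hX.tq_subset,
    List.subset_append_of_subset_right _ hY.tq_subset⟩
  bq_subset := List.append_subset.2 ⟨List.subset_append_of_subset_left _ hX.bq_subset,
    List.subset_append_of_subset_right _ hY.bq_subset⟩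
  tq_nodup := hX.tq_nodup.append hY.tq_nodup fun _ h h' =>
    List.disjoint_of_nodup_append hnd (hX.tq_subset h) (hY.tq_subset h')
  bq_nodup := hX.bq_nodup.append hY.bq_nodup fun _ h h' =>
    List.disjoint_of_nodup_append hnd (hX.bq_subset h) (hY.bq_subset h')

/-- A query at distance `k` from a terminal learns from a list of clients. -/
theorem weightBelow_eq {l : KeyList} {pts : List ℕ} {s q : ℕ}
    (hl : l.Perm (pts.map fun u => (u, S.rad u - S.dist u s)))
    (hgate : ∀ u ∈ pts, S.dist u (S.loc q) = S.dist u s + S.dist s (S.loc q))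
    (hc : ∀ u ∈ pts, S.cares q u) :
    l.weightBelow S.pen (S.dist (S.loc q) s) = (pts.map (S.val q)).sum := by
  rw [KeyList.weightBelow_perm _ hl, KeyList.weightBelow, List.map_map]
  refine congrArg _ (List.map_congr_left fun u hu => ?_)
  have h1 := hgate u hu
  have h2 := hc u hu
  simp only [Function.comp, QuerySystem.val, h2, true_and, h1, S.dist_comm (S.loc q)]
  refine if_congr ?_ rfl rfl
  constructor <;> intro h <;> linarith

theorem sum_val_eq_zero {pts : List ℕ} {q : ℕ} (hc : ∀ u ∈ pts, ¬ S.cares q u) :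
    (pts.map (S.val q)).sum = 0 := by
  refine List.sum_eq_zero fun y hy => ?_
  obtain ⟨u, hu, rfl⟩ := List.mem_map.1 hy
  simp [QuerySystem.val, hc u hu]

/-- A query in the list learns its sum from `weightBelow_eq`. A query outside the list cares about
none of these clients, so it misses nothing by being skipped. -/
theorem bump_answers {l l' : KeyList} {qs pts : List ℕ} {acc : ℕ → ℝ} {q s : ℕ}
    (hl : l.Perm (qs.map fun q => (q, S.dist (S.loc q) s))) (hqs : qs.Nodup)
    (hl' : l'.Perm (pts.map fun u => (u, S.rad u - S.dist u s)))
    (hgate : ∀ u ∈ pts, S.dist u (S.loc q) = S.dist u s + S.dist s (S.loc q))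
    (hc : ∀ u ∈ pts, S.cares q u ↔ q ∈ qs) :
    KeyList.bump S.pen l l' acc q = acc q + (pts.map (S.val q)).sum := by
  have hnames : (l.map Prod.fst).Perm qs := by
    have := hl.map Prod.fst
    rwa [List.map_map, show (Prod.fst ∘ fun q => (q, S.dist (S.loc q) s)) = id from rfl,
      List.map_id] at this
  by_cases hq : q ∈ qs
  · rw [KeyList.bump_of_mem (k := S.dist (S.loc q) s) _ _ _ _ (hnames.nodup_iff.2 hqs),
      weightBelow_eq hl' hgate fun u hu => (hc u hu).2 hq]
    exact hl.mem_iff.2 (List.mem_map.2 ⟨q, hq, rfl⟩)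
  · rw [KeyList.bump_of_not_mem _ _ _ _ (by rwa [hnames.mem_iff]),
      sum_val_eq_zero fun u hu h => hq ((hc u hu).1 h), add_zero]

theorem bump_of_not_mem_queries {l l' : KeyList} {qs : List ℕ} {acc : ℕ → ℝ} {q s : ℕ}
    (hl : l.Perm (qs.map fun q => (q, S.dist (S.loc q) s))) (hq : q ∉ qs) :
    KeyList.bump S.pen l l' acc q = acc q := by
  refine KeyList.bump_of_not_mem _ _ _ _ fun h => hq ?_
  obtain ⟨x, hx, rfl⟩ := List.mem_map.1 h
  obtain ⟨q', hq', rfl⟩ := List.mem_map.1 (hl.mem_iff.1 hx)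
  exact hq'

/-- The queries of the two clusters are disjoint, so each query can be changed by only one of the
two crossings, namely the one that adds the clients of the other cluster to those already counted.
-/
theorem Answered.join {acc : ℕ → ℝ} (hX : X.Valid S) (hY : Y.Valid S) (htop : Y.top = X.bot)
    (hgate : ∀ v ∈ X.top :: X.places S, ∀ v' ∈ Y.places S,
      S.dist v v' = S.dist v X.bot + S.dist X.bot v')
    (hnd : (X.aq ++ Y.aq).Nodup)
    (hcX : ∀ q ∈ X.aq, ∀ u ∈ Y.pts, S.cares q u ↔ q ∈ X.bq)
    (hcY : ∀ q ∈ Y.aq, ∀ u ∈ X.pts, S.cares q u ↔ S.free q)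
    (h : X.Answered S acc) (h' : Y.Answered S acc) :
    (X.join Y).Answered S (KeyList.bump S.pen Y.qt X.cb (KeyList.bump S.pen X.qb Y.ct acc)) := by
  intro q hq
  have hd := List.disjoint_of_nodup_append hnd
  simp only [Cluster.join, List.mem_append, List.map_append, List.sum_append] at hq ⊢
  rcases hq with hq | hq
  · rw [bump_of_not_mem_queries hY.qt_perm fun h => hd hq (hY.tq_subset h),
      bump_answers hX.qb_perm hX.bq_nodup (htop ▸ hY.ct_perm) ?_ (hcX q hq), h q hq]
    intro u hu
    have := hgate (S.loc q) (by simp [places]; exact .inr (.inr (.inr ⟨q, hq, rfl⟩))) u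
      (by simp [places, hu])
    rw [S.dist_comm u, this, S.dist_comm u, S.dist_comm X.bot (S.loc q), add_comm]
  · rw [bump_answers hY.qt_perm hY.tq_nodup (htop ▸ hX.cb_perm) ?_ ?_,
      bump_of_not_mem_queries hX.qb_perm fun h => hd (hX.bq_subset h) hq, h' q hq, add_comm]
    · intro u hu
      rw [htop]
      exact hgate u (by simp [places, hu]) (S.loc q)
        (by simp [places]; exact .inr (.inr ⟨q, hq, rfl⟩))
    · intro u hu
      rw [hcY q hq u hu, hY.mem_tq q hq]

end Cluster

/-- A tree whose nodes are clusters: `leaf` has nothing below it, `un` has one tree hanging from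
its bottom terminal, and `bin` is a place where two trees hang. The numbers name the nodes. -/
inductive ClTree where
  | leaf (i : ℕ) (X : Cluster)
  | un (i : ℕ) (X : Cluster) (t : ClTree)
  | bin (i : ℕ) (l r : ClTree)

namespace ClTree

def root : ClTree → ℕ
  | leaf i _ => i
  | un i _ _ => i
  | bin i _ _ => i

def ids : ClTree → List ℕ
  | leaf i _ => [i]
  | un i _ t => i :: t.ids
  | bin i l r => i :: (l.ids ++ r.ids)

/-- The number of nodes. -/
def card : ClTree → ℕ
  | leaf _ _ => 1
  | un _ _ t => t.card + 1
  | bin _ l r => l.card + r.card + 1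

def pts : ClTree → List ℕ
  | leaf _ X => X.pts
  | un _ X t => X.pts ++ t.pts
  | bin _ l r => l.pts ++ r.pts

def aq : ClTree → List ℕ
  | leaf _ X => X.aq
  | un _ X t => X.aq ++ t.aq
  | bin _ l r => l.aq ++ r.aq

def places (S : QuerySystem) : ClTree → List ℕ
  | leaf _ X => X.places S
  | un _ X t => X.places S ++ t.places S
  | bin _ l r => l.places S ++ r.places S

/-- The tree hangs from the place `p`, its clusters are valid, and every connection between
different parts of the tree leads through the terminals between them. -/
def Valid (S : QuerySystem) (p : ℕ) : ClTree → Prop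
  | leaf _ X => X.top = p ∧ X.Valid S
  | un _ X t => (X.top = p ∧ X.Valid S) ∧ t.Valid S X.bot ∧
      (∀ v ∈ X.top :: X.places S, ∀ v' ∈ t.places S,
        S.dist v v' = S.dist v X.bot + S.dist X.bot v') ∧
      (∀ q ∈ X.aq, ∀ u ∈ t.pts, S.cares q u ↔ q ∈ X.bq) ∧
      (∀ q ∈ t.aq, ∀ u ∈ X.pts, S.cares q u ↔ S.free q)
  | bin _ l r => (l.Valid S p ∧ r.Valid S p) ∧
      (∀ v ∈ l.places S, ∀ v' ∈ r.places S, S.dist v v' = S.dist v p + S.dist p v') ∧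
      (∀ q ∈ l.aq, ∀ u ∈ r.pts, S.cares q u ↔ S.free q) ∧
      (∀ q ∈ r.aq, ∀ u ∈ l.pts, S.cares q u ↔ S.free q)

/-- The queries of each cluster have their values with respect to this cluster. -/
def Answered (S : QuerySystem) (acc : ℕ → ℝ) : ClTree → Prop
  | leaf _ X => X.Answered S acc
  | un _ X t => X.Answered S acc ∧ t.Answered S acc
  | bin _ l r => l.Answered S acc ∧ r.Answered S acc

/-- One round of contraction: clusters without branches below them are joined with their parents
in such a way that each cluster takes part in one union at most. -/
noncomputable def contract : ClTree → ClTree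
  | leaf i X => leaf i X
  | un i X (leaf _ Y) => leaf i (X.join Y)
  | un i X (un _ Y t) => un i (X.join Y) t.contract
  | un i X (bin j l r) => un i X (bin j l r).contract
  | bin i (leaf _ Y) r => un i Y.close r.contract
  | bin i l (leaf _ Y) => un i Y.close l.contract
  | bin i l r => bin i l.contract r.contract

theorem root_contract (t : ClTree) : t.contract.root = t.root := by
  fun_cases contract t <;> rfl

theorem pts_contract (t : ClTree) : t.contract.pts.Perm t.pts := by
  fun_induction contract t with
  | case1 => rfl
  | case2 => rfl
  | case3 i X j Y t ih =>
    simp only [pts, Cluster.join, List.append_assoc]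
    exact (ih.append_left _).append_left _
  | case4 i X j l r ih => exact ih.append_left _
  | case5 i j Y r ih => exact ih.append_left _
  | case6 i l j Y _ ih => exact (ih.append_left _).trans List.perm_append_comm
  | case7 i l r _ _ ih ih' => exact ih.append ih'

theorem aq_contract (t : ClTree) : t.contract.aq.Perm t.aq := by
  fun_induction contract t with
  | case1 => rfl
  | case2 => rfl
  | case3 i X j Y t ih =>
    simp only [aq, Cluster.join, List.append_assoc]
    exact (ih.append_left _).append_left _
  | case4 i X j l r ih => exact ih.append_left _
  | case5 i j Y r ih => exact ih.append_left _
  | case6 i l j Y _ ih => exact (ih.append_left _).trans List.perm_append_comm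
  | case7 i l r _ _ ih ih' => exact ih.append ih'

theorem ids_contract (t : ClTree) : t.contract.ids.Sublist t.ids := by
  fun_induction contract t with
  | case1 => rfl
  | case2 => simp [ids]
  | case3 i X j Y t ih => exact (ih.cons j).cons_cons i
  | case4 i X j l r ih => exact ih.cons_cons i
  | case5 i j Y r ih => exact (ih.cons j).cons_cons i
  | case6 i l j Y _ ih => exact (ih.trans (List.sublist_append_left _ _)).cons_cons i
  | case7 i l r _ _ ih ih' => exact (ih.append ih').cons_cons i

/-- A node that is kept costs 1 and a node that disappears brings 7. Nothing disappears at the root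
of a branching with two non-leaves or of a unary node above a branching. For these the induction
carries savings: 2 for every tree that is not a leaf, 3 for every branching. The branching earns 2 +
2 - 1 = 3 from its children, and the unary node retains 3 - 1 = 2. -/
theorem card_contract (t : ClTree) : 8 * t.contract.card ≤ 7 * t.card + 1 := by
  have key : 8 * t.contract.card ≤ 7 * t.card + 1 ∧
      ((∀ i X, t ≠ leaf i X) → 8 * t.contract.card + 2 ≤ 7 * t.card) ∧
      (∀ i l r, t = bin i l r → 8 * t.contract.card + 3 ≤ 7 * t.card) := by
    fun_induction contract t with
    | case1 => simp [card]
    | case2 => simp [card]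
    | case3 i X j Y t ih =>
      have := ih.1
      refine ⟨by simp only [card]; omega, fun _ => by simp only [card]; omega, by simp⟩
    | case4 i X j l r ih =>
      have := ih.2.2 _ _ _ rfl
      refine ⟨by simp only [card] at *; omega, fun _ => by simp only [card] at *; omega, by simp⟩
    | case5 i j Y r ih =>
      have := ih.1
      refine ⟨by simp only [card]; omega, fun _ => by simp only [card]; omega,
        fun _ _ _ _ => by simp only [card]; omega⟩
    | case6 i l j Y _ ih =>
      have := ih.1
      refine ⟨by simp only [card]; omega, fun _ => by simp only [card]; omega,
        fun _ _ _ _ => by simp only [card]; omega⟩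
    | case7 i l r h h' ih ih' =>
      have h1 := ih.2.1 (fun i X hl => h i X hl)
      have h2 := ih'.2.1 (fun i X hr => h' i X hr)
      refine ⟨by simp only [card]; omega, fun _ => by simp only [card]; omega,
        fun _ _ _ _ => by simp only [card]; omega⟩
  exact key.1

/-- The exception `v = p` comes from `Cluster.close`, which makes the place of attachment the bottom
terminal of the closed leaf. -/
theorem Valid.places_contract {S : QuerySystem} {p : ℕ} {t : ClTree} (h : t.Valid S p) :
    ∀ v ∈ t.contract.places S, v ∈ t.places S ∨ v = p := by
  fun_induction contract t generalizing p with
  | case1 => exact fun v hv => .inl hv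
  | case2 i X j Y =>
    intro v hv
    simp only [places, Cluster.places, Cluster.join, List.mem_cons, List.mem_append,
      List.cons_append, List.map_append] at hv ⊢
    tauto
  | case3 i X j Y t ih =>
    intro v hv
    have := ih h.2.1.2.1 v
    simp only [places, Cluster.places, Cluster.join, List.mem_cons, List.mem_append,
      List.cons_append, List.map_append] at hv this ⊢
    tauto
  | case4 i X j l r ih =>
    intro v hv
    have := ih h.2.1 v
    simp only [places, Cluster.places, List.mem_cons, List.mem_append,
      List.cons_append] at hv this ⊢
    tauto
  | case5 i j Y r ih =>
    intro v hv
    have := ih h.1.2 v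
    have h1 : Y.top = p := h.1.1.1
    simp only [places, Cluster.places, Cluster.close, List.mem_cons, List.mem_append,
      List.cons_append, h1] at hv this ⊢
    tauto
  | case6 i l j Y _ ih =>
    intro v hv
    have := ih h.1.1 v
    have h1 : Y.top = p := h.1.2.1
    simp only [places, Cluster.places, Cluster.close, List.mem_cons, List.mem_append,
      List.cons_append, h1] at hv this ⊢
    tauto
  | case7 i l r _ _ ih ih' =>
    intro v hv
    have := ih h.1.1 v
    have := ih' h.1.2 v
    simp only [places, List.mem_append] at hv this ⊢
    tauto

/-- Contraction neither adds nor loses clients or queries, so the conditions on `cares` carry over.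
The only possible new place is a terminal, for which the distance equation is trivial. Queries must
be distinct in order that membership in the list of one cluster is not confused with membership in
that of another. -/
theorem Valid.contract {S : QuerySystem} {p : ℕ} {t : ClTree} (h : t.Valid S p)
    (hnd : t.aq.Nodup) : t.contract.Valid S p := by
  fun_induction ClTree.contract t generalizing p with
  | case1 => exact h
  | case2 i X j Y =>
    obtain ⟨⟨h1, h2⟩, ⟨h3, h4⟩, h5, h6, h7⟩ := h
    exact ⟨h1, h2.join h4 h3 h5 hnd⟩
  | case3 i X j Y t ih =>
    obtain ⟨⟨h1, h2⟩, ⟨⟨h3, h4⟩, h8, h9, h10, h11⟩, h5, h6, h7⟩ := h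
    have hd : (X.aq ++ Y.aq).Nodup := by
      rw [aq, aq, ← List.append_assoc] at hnd
      exact (List.nodup_append.1 hnd).1
    have hd' := List.disjoint_of_nodup_append hnd
    simp only [aq, List.nodup_append] at hnd
    refine ⟨⟨h1, h2.join h4 h3 (fun v hv v' hv' => h5 v hv v' (List.mem_append_left _ hv')) hd⟩,
      ih h8 hnd.2.1.2.1, ?_, ?_, ?_⟩
    · intro v hv v' hv'
      simp only [Cluster.join] at hv ⊢
      rcases h8.places_contract v' hv' with hv' | rfl
      · have g1 := h9 Y.top (by simp) v' hv'
        have hb : Y.bot ∈ (un j Y t).places S := by simp [places, Cluster.places]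
        have hv2 : v' ∈ (un j Y t).places S := by simp [places, hv']
        -- From `X` to a place below `Y` the way leads through both `X.bot` and `Y.bot`; splitting
        -- at the former twice gives the splitting at the latter.
        have key : ∀ w ∈ X.top :: X.places S,
            S.dist w v' = S.dist w Y.bot + S.dist Y.bot v' := by
          intro w hw
          rw [h5 w hw v' hv2, h5 w hw _ hb, ← h3, g1]
          ring
        simp only [Cluster.places, List.mem_cons, List.mem_append, List.cons_append,
          List.map_append] at hv
        rcases hv with rfl | rfl | (hv | hv) | hv | hv
        · exact key _ (by simp)
        · exact h9 _ (by simp [Cluster.places]) _ hv'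
        · exact key _ (by simp [Cluster.places, hv])
        · exact h9 _ (by simp [Cluster.places, hv]) _ hv'
        · exact key _ (by simp only [Cluster.places, List.mem_cons, List.mem_append,
            List.cons_append]; tauto)
        · exact h9 _ (by simp only [Cluster.places, List.mem_cons, List.mem_append,
            List.cons_append]; tauto) _ hv'
      · rw [S.dist_self, add_zero]
    · intro q hq u hu
      rw [(pts_contract t).mem_iff] at hu
      simp only [Cluster.join, List.mem_append] at hq ⊢
      rcases hq with hq | hq
      · rw [h6 q hq u (by simp [pts, hu])]
        exact (or_iff_left fun h => hd' hq (by simp [aq, h4.bq_subset h])).symm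
      · rw [h10 q hq u hu]
        exact (or_iff_right fun h => hd' (h2.bq_subset h) (by simp [aq, hq])).symm
    · intro q hq u hu
      rw [(aq_contract t).mem_iff] at hq
      simp only [Cluster.join, List.mem_append] at hu
      rcases hu with hu | hu
      · exact h7 q (by simp [aq, hq]) u hu
      · exact h11 q hq u hu
  | case4 i X j l r ih =>
    obtain ⟨h1, h2, h3, h4, h5⟩ := h
    refine ⟨h1, ih h2 (List.nodup_append.1 hnd).2.1, ?_, ?_, ?_⟩
    · intro v hv v' hv'
      rcases h2.places_contract v' hv' with hv' | rfl
      · exact h3 v hv v' hv'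
      · rw [S.dist_self, add_zero]
    · intro q hq u hu
      exact h4 q hq u ((pts_contract _).mem_iff.1 hu)
    · intro q hq u hu
      exact h5 q ((aq_contract _).mem_iff.1 hq) u hu
  | case5 i j Y r ih =>
    obtain ⟨⟨⟨h1, h2⟩, h3⟩, h4, h5, h6⟩ := h
    refine ⟨⟨h1, h2.close⟩, ?_, ?_, ?_, ?_⟩
    · simpa only [Cluster.close, h1] using ih h3 (List.nodup_append.1 hnd).2.1
    · intro v hv v' hv'
      simp only [Cluster.close, Cluster.places, h1, List.mem_cons, List.cons_append] at hv ⊢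
      rcases h3.places_contract v' hv' with hv' | rfl
      · rcases hv with rfl | rfl | hv
        · rw [S.dist_self, zero_add]
        · rw [S.dist_self, zero_add]
        · exact h4 v (by simp only [places, Cluster.places, List.mem_cons, List.cons_append]; tauto)
            v' hv'
      · rw [S.dist_self, add_zero]
    · intro q hq u hu
      rw [h5 q hq u ((pts_contract _).mem_iff.1 hu), ← h2.mem_tq q hq]
      rfl
    · intro q hq u hu
      exact h6 q ((aq_contract _).mem_iff.1 hq) u hu
  | case6 i l j Y _ ih =>
    obtain ⟨⟨h3, ⟨h1, h2⟩⟩, h4, h5, h6⟩ := h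
    refine ⟨⟨h1, h2.close⟩, ?_, ?_, ?_, ?_⟩
    · simpa only [Cluster.close, h1] using ih h3 (List.nodup_append.1 hnd).1
    · intro v hv v' hv'
      simp only [Cluster.close, Cluster.places, h1, List.mem_cons, List.cons_append] at hv ⊢
      rcases h3.places_contract v' hv' with hv' | rfl
      · rcases hv with rfl | rfl | hv
        · rw [S.dist_self, zero_add]
        · rw [S.dist_self, zero_add]
        · rw [S.dist_comm v, h4 v' hv' v (by
            simp only [places, Cluster.places, List.mem_cons, List.cons_append]; tauto),
            S.dist_comm v', S.dist_comm v, add_comm]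
      · rw [S.dist_self, add_zero]
    · intro q hq u hu
      rw [h6 q hq u ((pts_contract _).mem_iff.1 hu), ← h2.mem_tq q hq]
      rfl
    · intro q hq u hu
      exact h5 q ((aq_contract _).mem_iff.1 hq) u hu
  | case7 i l r _ _ ih ih' =>
    obtain ⟨⟨h1, h2⟩, h3, h4, h5⟩ := h
    have hn := List.nodup_append.1 hnd
    refine ⟨⟨ih h1 hn.1, ih' h2 hn.2.1⟩, ?_, ?_, ?_⟩
    · intro v hv v' hv'
      rcases h1.places_contract v hv with hv | rfl
      · rcases h2.places_contract v' hv' with hv' | rfl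
        · exact h3 v hv v' hv'
        · rw [S.dist_self, add_zero]
      · rw [S.dist_self, zero_add]
    · intro q hq u hu
      exact h4 q ((aq_contract _).mem_iff.1 hq) u ((pts_contract _).mem_iff.1 hu)
    · intro q hq u hu
      exact h5 q ((aq_contract _).mem_iff.1 hq) u ((pts_contract _).mem_iff.1 hu)

theorem Answered.congr {S : QuerySystem} {acc acc' : ℕ → ℝ} {t : ClTree} (h : t.Answered S acc)
    (hacc : ∀ q ∈ t.aq, acc' q = acc q) : t.Answered S acc' := by
  induction t with
  | leaf i X => exact fun q hq => (hacc q hq).trans (h q hq)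
  | un i X t ih =>
    exact ⟨fun q hq => (hacc q (by simp [aq, hq])).trans (h.1 q hq),
      ih h.2 fun q hq => hacc q (by simp [aq, hq])⟩
  | bin i l r ih ih' =>
    exact ⟨ih h.1 fun q hq => hacc q (by simp [aq, hq]),
      ih' h.2 fun q hq => hacc q (by simp [aq, hq])⟩

end ClTree

/-! ## Contraction in memory -/

namespace ClTree

/-- The number of clusters that a node refers to directly. -/
def kind : ClTree → ℕ
  | leaf _ _ => 0
  | un _ _ _ => 1
  | bin _ _ _ => 2

/-- A bound for the total length of the lists of a tree. -/
def weight (t : ClTree) : ℕ := t.card + t.aq.length + t.pts.length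

end ClTree

namespace RealRAM

/-- The tree `t` is stored under the names of its nodes: the natural arrays `13`, `14`, `15` hold
the kinds of the nodes and their children. -/
def StoresTree (s : State) : ClTree → Prop
  | .leaf i X => s.nmem 13 i = 0 ∧ StoresCluster s i X
  | .un i X t => s.nmem 13 i = 1 ∧ s.nmem 14 i = t.root ∧ StoresCluster s i X ∧ StoresTree s t
  | .bin i l r => s.nmem 13 i = 2 ∧ s.nmem 14 i = l.root ∧ s.nmem 15 i = r.root ∧
      StoresTree s l ∧ StoresTree s r

theorem StoresTree.kind_eq {s : State} {t : ClTree} (h : StoresTree s t) :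
    s.nmem 13 t.root = t.kind := by
  cases t <;> exact h.1

theorem StoresTree.mono {s s' : State} {t : ClTree} (h : StoresTree s t) (hs : HeapLE s s')
    (hi : ∀ i ∈ t.ids, SameAt i s s') : StoresTree s' t := by
  induction t with
  | leaf i X =>
    have := hi i (by simp [ClTree.ids])
    exact ⟨(this.1 13 (by decide) (by decide)).trans h.1, h.2.mono hs this⟩
  | un i X t ih =>
    have := hi i (by simp [ClTree.ids])
    exact ⟨(this.1 13 (by decide) (by decide)).trans h.1,
      (this.1 14 (by decide) (by decide)).trans h.2.1, h.2.2.1.mono hs this,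
      ih h.2.2.2 fun j hj => hi j (by simp [ClTree.ids, hj])⟩
  | bin i l r ih ih' =>
    have := hi i (by simp [ClTree.ids])
    exact ⟨(this.1 13 (by decide) (by decide)).trans h.1,
      (this.1 14 (by decide) (by decide)).trans h.2.1,
      (this.1 15 (by decide) (by decide)).trans h.2.2.1,
      ih h.2.2.2.1 fun j hj => hi j (by simp [ClTree.ids, hj]),
      ih' h.2.2.2.2 fun j hj => hi j (by simp [ClTree.ids, hj])⟩

/-- The first `n` cells of the array `a` are a stack that holds `L`, the top first. -/
def Stack (a : ℕ → ℕ) : ℕ → List ℕ → Prop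
  | n, [] => n = 0
  | n, x :: L => 0 < n ∧ a (n - 1) = x ∧ Stack a (n - 1) L

theorem Stack.update {a : ℕ → ℕ} {n k x : ℕ} {L : List ℕ} (h : Stack a n L) (hk : n ≤ k) :
    Stack (Function.update a k x) n L := by
  induction L generalizing n with
  | nil => exact h
  | cons y L ih =>
    refine ⟨h.1, ?_, ih h.2.2 (by omega)⟩
    rw [Function.update_of_ne (by have := h.1; omega)]
    exact h.2.1

theorem Stack.push {a : ℕ → ℕ} {n : ℕ} {L : List ℕ} (h : Stack a n L) (x : ℕ) :
    Stack (Function.update a n x) (n + 1) (x :: L) :=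
  ⟨by omega, by simp, by simpa using h.update le_rfl⟩

/-- Push a number onto the stack in the natural array `25`, of the height in register `23`. -/
def push (e : NExpr) : Program :=
  .storeN 25 (.reg 23) e ;; .setN 23 (.add (.reg 23) (.const 1))

/-- Turn the node in register `20`, at which the leaf in register `21` and the tree in register `22`
hang, into the cluster of this leaf with this tree below. -/
def closeLeaf : Program :=
  .storeN 16 (.reg 20) (.mem 16 (.reg 21)) ;; .storeN 17 (.reg 20) (.mem 17 (.reg 21)) ;;
  .storeN 18 (.reg 20) (.mem 16 (.reg 21)) ;; .storeN 19 (.reg 20) (.mem 17 (.reg 21)) ;;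
  .storeN 20 (.reg 20) (.mem 20 (.reg 21)) ;; .storeN 21 (.reg 20) (.mem 21 (.reg 21)) ;;
  .storeN 22 (.reg 20) (.mem 20 (.reg 21)) ;; .storeN 23 (.reg 20) (.mem 21 (.reg 21)) ;;
  .storeR 4 (.reg 20) (.const 0) ;; .storeN 13 (.reg 20) (.const 1) ;;
  .storeN 14 (.reg 20) (.reg 22) ;; push (.reg 22)

/-- Carry out the contraction at the node in register `20`, and push those trees below it on which
it is to be continued. -/
def visit : Program :=
  .ite (.nle (.const 2) (.mem 13 (.reg 20)))
    ((.setN 21 (.mem 14 (.reg 20)) ;; .setN 22 (.mem 15 (.reg 20)) ;;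
      .ite (.nle (.mem 13 (.reg 21)) (.const 0)) .skip
        (.setN 24 (.reg 21) ;; .setN 21 (.reg 22) ;; .setN 22 (.reg 24))) ;;
      .ite (.nle (.mem 13 (.reg 21)) (.const 0)) closeLeaf (push (.reg 21) ;; push (.reg 22)))
    (.ite (.nle (.const 1) (.mem 13 (.reg 20)))
      (.setN 21 (.mem 14 (.reg 20)) ;;
        .ite (.nle (.const 2) (.mem 13 (.reg 21))) (push (.reg 21))
          (joinClusters ;; .storeN 13 (.reg 20) (.mem 13 (.reg 21)) ;;
            .storeN 14 (.reg 20) (.mem 14 (.reg 21)) ;;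
            .ite (.nle (.const 1) (.mem 13 (.reg 21))) (push (.mem 14 (.reg 21))) .skip))
      .skip)

/-- What a visit of the tree `t` achieves: it is contracted as soon as the trees `G` on the stack
are. -/
structure Visited (S : QuerySystem) (s : State) (t : ClTree) (L : List ℕ) (G : List ClTree) (k : ℕ)
    (s' : State) : Prop where
  stack : Stack (s'.nmem 25) (s'.nreg 23) (G.map ClTree.root ++ L)
  time : k + 1000 * (G.map ClTree.weight).sum + 20 ≤ 1000 * t.weight
  heap : HeapLE s s'
  stores : ∀ u ∈ G, StoresTree s' u
  valid : ∀ u ∈ G, ∃ p, u.Valid S p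
  answered : ∀ u ∈ G, u.Answered S (s'.rmem 5)
  ids_sub : (G.flatMap ClTree.ids).Subperm t.ids
  root_not_mem : t.root ∉ G.flatMap ClTree.ids
  aq_sub : (G.flatMap ClTree.aq).Subperm t.aq
  same : ∀ j ∉ t.ids, SameAt j s s'
  acc_eq : ∀ q ∉ t.aq, s'.rmem 5 q = s.rmem 5 q
  rebuild : ∀ s'', HeapLE s' s'' → SameAt t.root s' s'' →
    (∀ u ∈ G, StoresTree s'' u.contract) → StoresTree s'' t.contract
  reanswer : ∀ acc, (∀ q ∉ G.flatMap ClTree.aq, acc q = s'.rmem 5 q) →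
    (∀ u ∈ G, u.contract.Answered S acc) → t.contract.Answered S acc

theorem closeLeaf_spec {s s' : State} {i y z : ℕ} {Y : Cluster} {L : List ℕ}
    (hs : s' = closeLeaf.eff s) (hi : s.nreg 20 = i) (hy : s.nreg 21 = y) (hz : s.nreg 22 = z)
    (hiy : i ≠ y) (hY : StoresCluster s y Y) (hst : Stack (s.nmem 25) (s.nreg 23) L) :
    (s'.nmem 13 i = 1 ∧ s'.nmem 14 i = z ∧ StoresCluster s' i Y.close) ∧
      Stack (s'.nmem 25) (s'.nreg 23) (z :: L) ∧ HeapLE s s' ∧ s'.rmem 5 = s.rmem 5 ∧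
      ∀ j ≠ i, SameAt j s s' := by
  simp only [closeLeaf, push, Program.eff, NExpr.eval, RExpr.eval, hi, hy, hz] at hs
  have hH : HeapLE s s' := .of_eq (by simp [hs]) (by simp [hs]) (by simp [hs])
  refine ⟨⟨by simp [hs], by simp [hs], ?_, ?_, ?_, ?_, ?_⟩, ?_, hH, by simp [hs], ?_⟩
  · have : Holds s' _ _ Y.close.qt := hY.qt.mono hH
    simpa [hs, hiy.symm] using this
  · have : Holds s' _ _ Y.close.qb := hY.qt.mono hH
    simpa [hs, hiy.symm] using this
  · have : Holds s' _ _ Y.close.ct := hY.ct.mono hH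
    simpa [hs, hiy.symm] using this
  · have : Holds s' _ _ Y.close.cb := hY.ct.mono hH
    simpa [hs, hiy.symm] using this
  · simp [hs, Cluster.close]
  · have := hst.push z
    simpa [hs] using this
  · refine fun j hj => ⟨fun a h1 h2 => ?_, by simp [hs, hj]⟩
    interval_cases a <;> simp [hs, hj]

/-- The closed leaf has the same clients and queries as before, so no answer changes. The branching
inherits the lists of the leaf by reference, since the heap is never overwritten, and the name of
the leaf is dropped. -/
theorem visited_close {S : QuerySystem} {s s' : State} {p i j k : ℕ} {Y : Cluster} {t u : ClTree}
    {L : List ℕ} (ht : t = .bin i (.leaf j Y) u ∨ t = .bin i u (.leaf j Y))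
    (htc : t.contract = .un i Y.close u.contract) (hst : StoresTree s t) (hv : t.Valid S p)
    (ha : t.Answered S (s.rmem 5)) (hid : t.ids.Nodup)
    (haq : t.aq.Nodup) (hs : (s'.nmem 13 i = 1 ∧ s'.nmem 14 i = u.root ∧ StoresCluster s' i Y.close) ∧
      Stack (s'.nmem 25) (s'.nreg 23) (u.root :: L) ∧ HeapLE s s' ∧ s'.rmem 5 = s.rmem 5 ∧
      ∀ j ≠ i, SameAt j s s') (hk : k ≤ 900) : Visited S s t L [u] k s' := by
  obtain ⟨⟨h1, h2, h3⟩, h4, h5, h6, h7⟩ := hs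
  have hroot : t.root = i := by rcases ht with rfl | rfl <;> rfl
  have hmem : i ∈ t.ids := by rcases ht with rfl | rfl <;> simp [ClTree.ids]
  have hiu : i ∉ u.ids := by
    rcases ht with rfl | rfl <;> simp [ClTree.ids] at hid <;> tauto
  have hsu : StoresTree s u := by rcases ht with rfl | rfl; exacts [hst.2.2.2.2, hst.2.2.2.1]
  have hau : u.Answered S (s.rmem 5) ∧ Y.Answered S (s.rmem 5) := by
    rcases ht with rfl | rfl; exacts [⟨ha.2, ha.1⟩, ⟨ha.1, ha.2⟩]
  have hdisj : ∀ q ∈ Y.aq, q ∉ u.aq := by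
    rcases ht with rfl | rfl
    · exact fun q h h' => List.disjoint_of_nodup_append haq h h'
    · exact fun q h h' => List.disjoint_of_nodup_append haq h' h
  refine
    { stack := h4
      time := ?_
      heap := h5
      stores := ?_
      valid := ?_
      answered := ?_
      ids_sub := ?_
      root_not_mem := ?_
      aq_sub := ?_
      same := ?_
      acc_eq := fun q _ => by rw [h6]
      rebuild := ?_
      reanswer := ?_ }
  · rcases ht with rfl | rfl <;>
      simp [ClTree.weight, ClTree.card, ClTree.aq, ClTree.pts] <;> omega
  · simpa using hsu.mono h5 fun j hj => h7 j (by rintro rfl; exact hiu hj)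
  · rcases ht with rfl | rfl
    · simpa using ⟨p, hv.1.2⟩
    · simpa using ⟨p, hv.1.1⟩
  · simpa [h6] using hau.1
  · rcases ht with rfl | rfl
    · simpa [ClTree.ids] using ((List.sublist_cons_self j u.ids).cons i).subperm
    · simpa [ClTree.ids] using ((List.sublist_append_left u.ids [j]).cons i).subperm
  · simpa [hroot] using hiu
  · rcases ht with rfl | rfl
    · simpa [ClTree.aq] using (List.sublist_append_right Y.aq u.aq).subperm
    · simpa [ClTree.aq] using (List.sublist_append_left u.aq Y.aq).subperm
  · exact fun j hj => h7 j (by rintro rfl; exact hj hmem)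
  · intro s'' hh hsame hG
    rw [hroot] at hsame
    rw [htc]
    exact ⟨(hsame.1 13 (by decide) (by decide)).trans h1,
      by rw [hsame.1 14 (by decide) (by decide), h2, ClTree.root_contract],
      h3.mono hh hsame, hG u (by simp)⟩
  · intro acc hacc hG
    rw [htc]
    refine ⟨fun q hq => ?_, hG u (by simp)⟩
    rw [hacc q (by simpa using hdisj q hq), h6]
    exact hau.2 q hq

theorem StoresTree.cluster {s : State} {i : ℕ} {X : Cluster} {t : ClTree}
    (h : StoresTree s (.un i X t)) : StoresCluster s i X := h.2.2.1

/-- The three shapes at which contraction leaves the root alone. Only the stack changes, so all that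
was stored or answered remains so. -/
theorem visited_push {S : QuerySystem} {s s' : State} {t : ClTree} {L : List ℕ} {G : List ClTree}
    {k p : ℕ} (hst : StoresTree s t) (hv : t.Valid S p)
    (ha : t.Answered S (s.rmem 5)) (hid : t.ids.Nodup) (haq : t.aq.Nodup)
    (hG : (∃ i X j l r, t = .un i X (.bin j l r) ∧ G = [.bin j l r]) ∨
      (∃ i l r, t = .bin i l r ∧ l.kind ≠ 0 ∧ r.kind ≠ 0 ∧ G = [l, r]) ∨
      ∃ i X, t = .leaf i X ∧ G = [])
    (hstack : Stack (s'.nmem 25) (s'.nreg 23) (G.map ClTree.root ++ L)) (hH : HeapLE s s')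
    (hacc : s'.rmem 5 = s.rmem 5) (hsame : ∀ j, SameAt j s s') (hk : k ≤ 900) :
    Visited S s t L G k s' := by
  have hmono := fun u (h : StoresTree s u) => h.mono hH fun j _ => hsame j
  rcases hG with ⟨i, X, j, l, r, rfl, rfl⟩ | ⟨i, l, r, rfl, hl, hr, rfl⟩ | ⟨i, X, rfl, rfl⟩
  · refine ⟨hstack, ?_, hH, by simpa using hmono _ hst.2.2.2, by simpa using ⟨_, hv.2.1⟩,
      by simpa [hacc] using ha.2, ?_, ?_, ?_, fun j _ => hsame j, fun q _ => by rw [hacc], ?_, ?_⟩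
    · simp [ClTree.weight, ClTree.card, ClTree.aq, ClTree.pts]; omega
    · simpa [ClTree.ids] using (List.sublist_cons_self i _).subperm
    · rw [ClTree.ids, List.nodup_cons] at hid
      simpa [ClTree.root] using hid.1
    · simpa [ClTree.aq] using (List.sublist_append_right X.aq _).subperm
    · intro s'' hh hs hG
      have h13 := (hsame i).1 13 (by decide) (by decide)
      have h14 := (hsame i).1 14 (by decide) (by decide)
      rw [ClTree.contract]
      exact ⟨(hs.1 13 (by decide) (by decide)).trans (h13.trans hst.1),
        by rw [(show SameAt i s' s'' from hs).1 14 (by decide) (by decide), h14, hst.2.1, ClTree.root_contract],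
        hst.cluster.mono (hH.trans hh) ((hsame i).trans hs), hG _ (by simp)⟩
    · intro acc hacc' hG
      rw [ClTree.contract]
      refine ⟨fun q hq => ?_, hG _ (by simp)⟩
      rw [hacc' q (by simpa using fun h => List.disjoint_of_nodup_append haq hq h), hacc]
      exact ha.1 q hq
  · have hc : (ClTree.bin i l r).contract = .bin i l.contract r.contract := by
      cases l <;> cases r <;> simp_all [ClTree.contract, ClTree.kind]
    refine ⟨hstack, ?_, hH, by simpa using ⟨hmono _ hst.2.2.2.1, hmono _ hst.2.2.2.2⟩,
      by simpa using ⟨⟨_, hv.1.1⟩, ⟨_, hv.1.2⟩⟩,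
      by simpa [hacc] using (show _ ∧ _ from ha), ?_, ?_, ?_, fun j _ => hsame j, fun q _ => by rw [hacc], ?_, ?_⟩
    · simp [ClTree.weight, ClTree.card, ClTree.aq, ClTree.pts]; omega
    · simpa [ClTree.ids] using (List.sublist_cons_self i _).subperm
    · rw [ClTree.ids, List.nodup_cons] at hid
      simpa [ClTree.root] using hid.1
    · simp [ClTree.aq, List.Subperm.refl]
    · intro s'' hh hs hG
      have h13 := (hsame i).1 13 (by decide) (by decide)
      have h14 := (hsame i).1 14 (by decide) (by decide)
      have h15 := (hsame i).1 15 (by decide) (by decide)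
      rw [hc]
      exact ⟨(hs.1 13 (by decide) (by decide)).trans (h13.trans hst.1),
        by rw [(show SameAt i s' s'' from hs).1 14 (by decide) (by decide), h14, hst.2.1, ClTree.root_contract],
        by rw [(show SameAt i s' s'' from hs).1 15 (by decide) (by decide), h15, hst.2.2.1, ClTree.root_contract],
        hG _ (by simp), hG _ (by simp)⟩
    · intro acc hacc' hG
      rw [hc]
      exact ⟨hG _ (by simp), hG _ (by simp)⟩
  · refine ⟨hstack, ?_, hH, by simp, by simp, by simp, by simp,
      by simp, by simp, fun j _ => hsame j, fun q _ => by rw [hacc], ?_, ?_⟩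
    · simp [ClTree.weight, ClTree.card, ClTree.aq, ClTree.pts]; omega
    · intro s'' hh hs hG
      have h13 := (hsame i).1 13 (by decide) (by decide)
      rw [ClTree.contract]
      exact ⟨(hs.1 13 (by decide) (by decide)).trans (h13.trans hst.1),
        hst.2.mono (hH.trans hh) ((hsame i).trans hs)⟩
    · intro acc hacc' hG q hq
      rw [hacc' q (by simp), hacc]
      exact ha q hq

/-- The time is paid by what leaves the stack: by `size_le` the joined lists have at most twice as
many entries as the two clusters have queries and clients, all of which count in `weight` and do not
occur in `G`. -/
theorem visited_join {S : QuerySystem} {s s' : State} {t y : ClTree} {L : List ℕ} {G : List ClTree}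
    {i j k p : ℕ} {X Y : Cluster} (ht : t = .un i X y)
    (hy : y = .leaf j Y ∧ G = [] ∨ ∃ z, y = .un j Y z ∧ G = [z])
    (hst : StoresTree s t) (hv : t.Valid S p)
    (ha : t.Answered S (s.rmem 5)) (hid : t.ids.Nodup) (haq : t.aq.Nodup)
    (hstack : Stack (s'.nmem 25) (s'.nreg 23) (G.map ClTree.root ++ L)) (hH : HeapLE s s')
    (hX : StoresCluster s' i (X.join Y)) (h13 : s'.nmem 13 i = y.kind)
    (h14 : ∀ z ∈ G, s'.nmem 14 i = z.root)
    (hacc : s'.rmem 5 = KeyList.bump S.pen Y.qt X.cb (KeyList.bump S.pen X.qb Y.ct (s.rmem 5)))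
    (hsame : ∀ j ≠ i, SameAt j s s') (hk : k ≤ 130 * (X.size + Y.size) + 900) :
    Visited S s t L G k s' := by
  subst ht
  have hXv := hv.1.2
  have hYv : Y.top = X.bot ∧ Y.Valid S := by
    rcases hy with ⟨rfl, rfl⟩ | ⟨z, rfl, rfl⟩; exacts [hv.2.1, hv.2.1.1]
  have hXs := hXv.size_le
  have hYs := hYv.2.size_le
  have hplaces : ∀ v ∈ Y.places S, v ∈ y.places S := by
    rcases hy with ⟨rfl, rfl⟩ | ⟨z, rfl, rfl⟩
    · exact fun v h => h
    · exact fun v h => List.mem_append_left _ h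
  have hYaq : ∀ q ∈ Y.aq, q ∈ y.aq := by
    rcases hy with ⟨rfl, rfl⟩ | ⟨z, rfl, rfl⟩
    · exact fun v h => h
    · exact fun v h => List.mem_append_left _ h
  have hYpts : ∀ q ∈ Y.pts, q ∈ y.pts := by
    rcases hy with ⟨rfl, rfl⟩ | ⟨z, rfl, rfl⟩
    · exact fun v h => h
    · exact fun v h => List.mem_append_left _ h
  have hYa : Y.Answered S (s.rmem 5) := by
    rcases hy with ⟨rfl, rfl⟩ | ⟨z, rfl, rfl⟩; exacts [ha.2, ha.2.1]
  have hnd : (X.aq ++ Y.aq).Nodup := by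
    rcases hy with ⟨rfl, rfl⟩ | ⟨z, rfl, rfl⟩
    · exact haq
    · rw [ClTree.aq, ClTree.aq, ← List.append_assoc] at haq
      exact (List.nodup_append.1 haq).1
  have hjoin : (X.join Y).Answered S (s'.rmem 5) := by
    rw [hacc]
    exact Cluster.Answered.join hXv hYv.2 hYv.1
      (fun v hv1 v' hv2 => hv.2.2.1 v hv1 v' (hplaces v' hv2)) hnd
      (fun q hq u hu => hv.2.2.2.1 q hq u (hYpts u hu))
      (fun q hq u hu => hv.2.2.2.2 q (hYaq q hq) u hu) ha.1 hYa
  have hout : ∀ q, q ∉ X.aq → q ∉ Y.aq → s'.rmem 5 q = s.rmem 5 q := by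
    intro q h1 h2
    rw [hacc, Cluster.bump_of_not_mem_queries hYv.2.qt_perm fun h => h2 (hYv.2.tq_subset h),
      Cluster.bump_of_not_mem_queries hXv.qb_perm fun h => h1 (hXv.bq_subset h)]
  rw [ClTree.ids, List.nodup_cons] at hid
  rcases hy with ⟨rfl, rfl⟩ | ⟨z, rfl, rfl⟩
  · refine ⟨hstack, ?_, hH, by simp, by simp, by simp, by simp, by simp, by simp, ?_, ?_, ?_, ?_⟩
    · simp [ClTree.weight, ClTree.card, ClTree.aq, ClTree.pts]; omega
    · exact fun j' hj' => hsame j' (by rintro rfl; simp [ClTree.ids] at hj')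
    · exact fun q hq => hout q (fun h => hq (by simp [ClTree.aq, h]))
        (fun h => hq (by simp [ClTree.aq, h]))
    · intro s'' hh hs hG
      rw [ClTree.contract]
      exact ⟨(hs.1 13 (by decide) (by decide)).trans h13, hX.mono hh hs⟩
    · intro acc hacc' hG q hq
      rw [hacc' q (by simp)]
      exact hjoin q hq
  · have hiz : i ∉ z.ids := fun h => hid.1 (by simp [ClTree.ids, h])
    rw [ClTree.aq, ClTree.aq, ← List.append_assoc] at haq
    have hd := List.disjoint_of_nodup_append haq
    refine ⟨hstack, ?_, hH, ?_, by simpa using ⟨_, hv.2.1.2.1⟩, ?_, ?_, by simpa [ClTree.root] using hiz, ?_,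
      ?_, ?_, ?_, ?_⟩
    · simp [ClTree.weight, ClTree.card, ClTree.aq, ClTree.pts]; omega
    · simpa using hst.2.2.2.2.2.2.mono hH fun j' hj' => hsame j' (by rintro rfl; exact hiz hj')
    · simp only [List.mem_singleton, forall_eq]
      exact ha.2.2.congr fun q hq => hout q (fun h => hd (List.mem_append_left _ h) hq)
        (fun h => hd (List.mem_append_right _ h) hq)
    · simpa [ClTree.ids] using ((List.sublist_cons_self j z.ids).cons i).subperm
    · simpa [ClTree.aq, ← List.append_assoc] using
        (List.sublist_append_right (X.aq ++ Y.aq) z.aq).subperm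
    · exact fun j' hj' => hsame j' (by rintro rfl; simp [ClTree.ids] at hj')
    · exact fun q hq => hout q (fun h => hq (by simp [ClTree.aq, h]))
        (fun h => hq (by simp [ClTree.aq, h]))
    · intro s'' hh hs hG
      rw [ClTree.contract]
      exact ⟨(hs.1 13 (by decide) (by decide)).trans h13,
        by rw [(show SameAt i s' s'' from hs).1 14 (by decide) (by decide), h14 z (by simp), ClTree.root_contract], hX.mono hh hs, hG _ (by simp)⟩
    · intro acc hacc' hG
      rw [ClTree.contract]
      refine ⟨fun q hq => ?_, hG _ (by simp)⟩
      rw [hacc' q (by simpa using hd hq)]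
      exact hjoin q hq

/-- The cases are those of `ClTree.contract`. At a branching the program first arranges that a leaf,
if there is one, is the child in register `21`, so that one piece of code closes both a left and a
right leaf. -/
theorem run_visit {S : QuerySystem} {s : State} {t : ClTree} {L : List ℕ} {p : ℕ}
    (hroot : s.nreg 20 = t.root) (hstack : Stack (s.nmem 25) (s.nreg 23) L)
    (hst : StoresTree s t) (hv : t.Valid S p) (ha : t.Answered S (s.rmem 5)) (hid : t.ids.Nodup)
    (haq : t.aq.Nodup) (hpen : penalties s = S.pen) :
    Run visit s fun k s' => ∃ G, Visited S s t L G k s' := by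
  have hkind := hst.kind_eq
  rcases t with ⟨i, X⟩ | ⟨i, X, y⟩ | ⟨i, l, r⟩
  · simp only [ClTree.root, ClTree.kind] at hroot hkind
    refine Run.ite (fun h => ?_) fun _ => Run.ite (fun h => ?_) fun _ => ?_
    · simp [Test.eval, NExpr.eval, hroot, hkind] at h
    · simp [Test.eval, NExpr.eval, hroot, hkind] at h
    · refine Run.straight 1 rfl (by decide) fun k s' hk hs' => ⟨[], ?_⟩
      obtain rfl : s' = s := hs'
      exact visited_push hst hv ha hid haq (.inr (.inr ⟨_, _, rfl, rfl⟩)) hstack (.refl _) rfl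
        (fun _ => ⟨fun _ _ _ => rfl, rfl⟩) (by simp only [Test.cost, NExpr.cost]; omega)
  · simp only [ClTree.root, ClTree.kind] at hroot hkind
    have h14 : s.nmem 14 i = y.root := hst.2.1
    have hyk := hst.2.2.2.kind_eq
    refine Run.ite (fun h => ?_) fun _ => Run.ite (fun _ => ?_) fun h => ?_
    · simp [Test.eval, NExpr.eval, hroot, hkind] at h
    · refine Run.seq (Run.straight 3 rfl (by decide) fun k₁ s₁ hk₁ hs₁ => ?_)
      simp only [Program.eff, NExpr.eval, hroot, h14] at hs₁
      have e21 : s₁.nreg 21 = y.root := by simp [hs₁]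
      have e20 : s₁.nreg 20 = i := by simp [hs₁, hroot]
      have e23 : s₁.nreg 23 = s.nreg 23 := by simp [hs₁]
      have n₁ : s₁.nmem = s.nmem := by simp [hs₁]
      have r₁ : s₁.rmem = s.rmem := by simp [hs₁]
      have H₁ : HeapLE s s₁ := .of_eq (by simp [hs₁]) (by simp [hs₁]) (by simp [hs₁])
      clear hs₁
      have hsame₁ : ∀ j, SameAt j s s₁ := fun j => ⟨fun _ _ _ => by rw [n₁], by rw [r₁]⟩
      refine Run.ite (fun h => ?_) fun h => ?_
      · simp only [Test.eval, NExpr.eval, e21, n₁, hyk] at h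
        refine Run.straight 10 rfl (by decide) fun k s' hk hs' => ⟨[y], ?_⟩
        simp only [push, Program.eff, NExpr.eval, e21, e23, n₁, r₁] at hs'
        rcases y with ⟨j, Y⟩ | ⟨j, Y, z⟩ | ⟨j, l, r⟩
        · simp [ClTree.kind] at h
        · simp [ClTree.kind] at h
        · refine visited_push hst hv ha hid haq (.inl ⟨_, _, _, _, _, rfl, rfl⟩) ?_
            (H₁.trans (.of_eq (by simp [hs']) (by simp [hs', n₁]) (by simp [hs', r₁])))
            (by simp [hs']) ?_ (by simp only [Test.cost, NExpr.cost]; omega)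
          · simpa [hs'] using hstack.push _
          · refine fun j => ⟨fun a h1 h2 => ?_, by simp [hs']⟩
            interval_cases a <;> simp [hs']
      · simp only [Test.eval, NExpr.eval, e21, n₁, hyk] at h
        have hy : ∃ j Y, y.root = j ∧ j ≠ i ∧ StoresCluster s j Y ∧ (Y.Valid S) ∧
            (y = .leaf j Y ∨ ∃ z, y = .un j Y z) := by
          rcases y with ⟨j, Y⟩ | ⟨j, Y, z⟩ | ⟨j, l, r⟩
          · exact ⟨j, Y, rfl, by rintro rfl; simp [ClTree.ids] at hid, hst.2.2.2.2, hv.2.1.2,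
              .inl rfl⟩
          · exact ⟨j, Y, rfl, by rintro rfl; simp [ClTree.ids] at hid, hst.2.2.2.2.2.1,
              hv.2.1.1.2, .inr ⟨z, rfl⟩⟩
          · simp [ClTree.kind] at h
        obtain ⟨j, Y, hj, hji, hYs, hYv, hy⟩ := hy
        rw [hj] at e21 hyk
        refine Run.seq ((run_joinClusters e20 e21 hji.symm (hst.cluster.mono H₁ (hsame₁ i))
          (hYs.mono H₁ (hsame₁ j)) hv.1.2.qb_asc hYv.ct_asc hYv.qt_asc hv.1.2.cb_asc).mono ?_)
        rintro k₂ s₂ ⟨⟨hk₂, hX₂, H₂, c20, c21, hs₂, hacc₂⟩, f₂⟩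
        refine Run.straight 30 rfl (by decide) fun k s' hk hs' => ?_
        have g13 : s₂.nmem 13 j = y.kind := by rw [f₂.nmem 13 (by decide), n₁, hyk]
        have g14 : s₂.nmem 14 j = s.nmem 14 j := by rw [f₂.nmem 14 (by decide), n₁]
        have g25 : s₂.nmem 25 = s.nmem 25 := by rw [f₂.nmem 25 (by decide), n₁]
        have c23 : s₂.nreg 23 = s.nreg 23 := by rw [f₂.nreg 23 (by decide), e23]
        have hpen₁ : penalties s₁ = S.pen := by rw [← hpen]; funext u; simp [penalties, n₁, r₁]
        rw [hpen₁, r₁] at hacc₂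
        have hs₂' : ∀ j ≠ i, SameAt j s s₂ := fun j hj => (hsame₁ j).trans (hs₂ j hj)
        simp only [push, Program.eff, NExpr.eval, Test.eval, c20, c21] at hs'
        rcases hy with rfl | ⟨z, rfl⟩
        · refine ⟨[], ?_⟩
          simp [g13, ClTree.kind, hji] at hs'
          refine visited_join rfl (.inl ⟨rfl, rfl⟩) hst hv ha hid haq ?_
            ((H₁.trans H₂).trans (.of_eq (by simp [hs']) (by simp [hs']) (by simp [hs'])))
            ?_ (by simp [hs', ClTree.kind]) (by simp) (by simp [hs', hacc₂]) ?_
            (by simp only [Test.cost, NExpr.cost]; omega)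
          · simpa [hs', g25, c23] using hstack
          · have hH : HeapLE s₂ s' := .of_eq (by simp [hs']) (by simp [hs']) (by simp [hs'])
            exact ⟨by simpa [hs'] using hX₂.qt.mono hH, by simpa [hs'] using hX₂.qb.mono hH,
              by simpa [hs'] using hX₂.ct.mono hH, by simpa [hs'] using hX₂.cb.mono hH,
              by simpa [hs'] using hX₂.len⟩
          · refine fun j' hj' => (hs₂' j' hj').trans ⟨fun a h1 h2 => ?_, by simp [hs']⟩
            interval_cases a <;> simp [hs', hj']
        · refine ⟨[z], ?_⟩
          have h14z : s.nmem 14 j = z.root := hst.2.2.2.2.1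
          simp [g13, ClTree.kind, hji, g14, h14z, g25, c23] at hs'
          refine visited_join rfl (.inr ⟨z, rfl, rfl⟩) hst hv ha hid haq ?_
            ((H₁.trans H₂).trans (.of_eq (by simp [hs']) (by simp [hs']) (by simp [hs'])))
            ?_ (by simp [hs', ClTree.kind]) (by simp [hs']) (by simp [hs', hacc₂]) ?_
            (by simp only [Test.cost, NExpr.cost]; omega)
          · simpa [hs'] using hstack.push z.root
          · have hH : HeapLE s₂ s' := .of_eq (by simp [hs']) (by simp [hs']) (by simp [hs'])
            exact ⟨by simpa [hs'] using hX₂.qt.mono hH, by simpa [hs'] using hX₂.qb.mono hH,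
              by simpa [hs'] using hX₂.ct.mono hH, by simpa [hs'] using hX₂.cb.mono hH,
              by simpa [hs'] using hX₂.len⟩
          · refine fun j' hj' => (hs₂' j' hj').trans ⟨fun a h1 h2 => ?_, by simp [hs']⟩
            interval_cases a <;> simp [hs', hj']
    · simp [Test.eval, NExpr.eval, hroot, hkind] at h
  · simp only [ClTree.root, ClTree.kind] at hroot hkind
    have h14 : s.nmem 14 i = l.root := hst.2.1
    have h15 : s.nmem 15 i = r.root := hst.2.2.1
    have hlk := hst.2.2.2.1.kind_eq
    have hrk := hst.2.2.2.2.kind_eq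
    refine Run.ite (fun _ => ?_) fun h => ?_
    · refine Run.seq (Run.straight 30 rfl (by decide) fun k₁ s₁ hk₁ hs₁ => ?_)
      simp [Program.eff, NExpr.eval, Test.eval, hroot, h14, h15, hlk] at hs₁
      have n₁ : s₁.nmem = s.nmem := by rw [hs₁]; split_ifs <;> rfl
      have r₁ : s₁.rmem = s.rmem := by rw [hs₁]; split_ifs <;> rfl
      have e20 : s₁.nreg 20 = i := by rw [hs₁]; split_ifs <;> simp [hroot]
      have e23 : s₁.nreg 23 = s.nreg 23 := by rw [hs₁]; split_ifs <;> simp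
      have e14 : s₁.nreg 14 = s.nreg 14 := by rw [hs₁]; split_ifs <;> simp
      have H₁ : HeapLE s s₁ := .of_eq e14 (by rw [n₁]) (by rw [r₁])
      have hsame₁ : ∀ j, SameAt j s s₁ := fun j => ⟨fun _ _ _ => by rw [n₁], by rw [r₁]⟩
      have hclose : ∀ {j Y u}, (ClTree.bin i l r = .bin i (.leaf j Y) u ∨
          ClTree.bin i l r = .bin i u (.leaf j Y)) →
          (ClTree.bin i l r).contract = .un i Y.close u.contract → s₁.nreg 21 = j →
          s₁.nreg 22 = u.root → Run (.ite (.nle (.mem 13 (.reg 21)) (.const 0)) closeLeaf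
            (push (.reg 21) ;; push (.reg 22))) s₁ fun k s' =>
            ∃ G, Visited S s (.bin i l r) L G ((Test.nle (.const 2) (.mem 13 (.reg 20))).cost +
              (k₁ + k)) s' := by
        intro j Y u h hc h21 h22
        have hY : s.nmem 13 j = 0 ∧ StoresCluster s j Y := by
          rcases h with h | h <;> rw [h] at hst
          exacts [hst.2.2.2.1, hst.2.2.2.2]
        have hij : i ≠ j := by
          rintro rfl
          rcases h with h | h <;> rw [h] at hid <;> simp [ClTree.ids] at hid
        refine Run.ite (fun _ => ?_) fun h' => ?_
        · refine Run.straight 70 rfl (by decide) fun k s' hk hs' => ⟨[u], ?_⟩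
          obtain ⟨g1, g2, g3, g4, g5⟩ := closeLeaf_spec hs' e20 h21 h22 hij
            (hY.2.mono H₁ (hsame₁ j)) (L := L) (by rw [n₁, e23]; exact hstack)
          exact visited_close h hc hst hv ha hid haq ⟨g1, g2, H₁.trans g3, by rw [g4, r₁],
            fun j' hj' => (hsame₁ j').trans (g5 j' hj')⟩
            (by simp only [Test.cost, NExpr.cost]; omega)
        · simp [Test.eval, NExpr.eval, h21, n₁, hY.1] at h'
      by_cases hl : l.kind = 0
      · rcases l with ⟨j, Y⟩ | ⟨j, Y, y⟩ | ⟨j, y, z⟩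
        · exact hclose (.inl rfl) rfl (by simp [hs₁, hl, ClTree.root]) (by simp [hs₁, hl])
        · simp [ClTree.kind] at hl
        · simp [ClTree.kind] at hl
      · have e21 : s₁.nreg 21 = r.root := by simp [hs₁, hl]
        have e22 : s₁.nreg 22 = l.root := by simp [hs₁, hl]
        by_cases hr : r.kind = 0
        · rcases r with ⟨j, Y⟩ | ⟨j, Y, y⟩ | ⟨j, y, z⟩
          · refine hclose (.inr rfl) ?_ e21 e22
            cases l <;> simp_all [ClTree.contract, ClTree.kind]
          · simp [ClTree.kind] at hr
          · simp [ClTree.kind] at hr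
        · refine Run.ite (fun h => ?_) fun _ => ?_
          · simp [Test.eval, NExpr.eval, e21, n₁, hrk, hr] at h
          · refine Run.straight 20 rfl (by decide) fun k s' hk hs' => ⟨[l, r], ?_⟩
            simp only [push, Program.eff, NExpr.eval] at hs'
            simp [e21, e22, e23, n₁, r₁] at hs'
            refine visited_push hst hv ha hid haq (.inr (.inl ⟨_, _, _, rfl, hl, hr, rfl⟩)) ?_
              (.of_eq (by simp [hs', e14]) (by simp [hs']) (by simp [hs']))
              (by simp [hs']) ?_ (by simp only [Test.cost, NExpr.cost]; omega)
            · simpa [hs'] using (hstack.push r.root).push l.root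
            · refine fun j => ⟨fun a h1 h2 => ?_, by simp [hs']⟩
              interval_cases a <;> simp [hs']
    · simp [Test.eval, NExpr.eval, hroot, hkind] at h

end RealRAM

/-! ### Contraction of a whole tree in logarithmically many rounds -/

namespace RealRAM

theorem nodup_of_subperm {l l' : List ℕ} (h : l.Subperm l') (h' : l'.Nodup) : l.Nodup := by
  obtain ⟨l₁, hp, hs⟩ := h
  exact hp.nodup_iff.1 (hs.nodup h')

/-- Contract all trees on the stack. -/
def contractStack : Program :=
  .loop (.nle (.const 1) (.reg 23))
    ((.setN 23 (.sub (.reg 23) (.const 1)) ;; .setN 20 (.mem 25 (.reg 23))) ;; visit)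

/-- Induction on the total weight on the stack: a visit replaces the top tree by trees `G` of
smaller total weight, and the difference pays for it. Disjoint names and queries keep the trees on
the stack independent. When the induction hypothesis has contracted `G`, the fields `rebuild` and
`reanswer` of `Visited` give the contraction of the visited tree. -/
theorem run_contractStack {S : QuerySystem} (m : ℕ) : ∀ (F : List ClTree) (s : State),
    (F.map ClTree.weight).sum ≤ m → Stack (s.nmem 25) (s.nreg 23) (F.map ClTree.root) →
    (∀ t ∈ F, StoresTree s t) → (∀ t ∈ F, ∃ p, t.Valid S p) →
    (∀ t ∈ F, t.Answered S (s.rmem 5)) → (F.flatMap ClTree.ids).Nodup →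
    (F.flatMap ClTree.aq).Nodup → penalties s = S.pen →
    Run contractStack s fun k s' => k ≤ 1000 * (F.map ClTree.weight).sum + 10 ∧
      (∀ t ∈ F, StoresTree s' t.contract) ∧ (∀ t ∈ F, t.contract.Answered S (s'.rmem 5)) ∧
      HeapLE s s' ∧ (∀ j ∉ F.flatMap ClTree.ids, SameAt j s s') ∧
      ∀ q ∉ F.flatMap ClTree.aq, s'.rmem 5 q = s.rmem 5 q := by
  induction m with
  | zero =>
    intro F s hm hst _ _ _ _ _ _
    rcases F with _ | ⟨t, F⟩
    · refine Run.loop_exit ?_ ⟨by simp [Test.cost, NExpr.cost], by simp, by simp, .refl s,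
        fun _ _ => ⟨fun _ _ _ => rfl, rfl⟩, fun _ _ => rfl⟩
      simp [Test.eval, NExpr.eval, show s.nreg 23 = 0 from hst]
    · have : 0 < t.card := by cases t <;> simp [ClTree.card]
      simp [ClTree.weight] at hm
      omega
  | succ m ih =>
    intro F s hm hst hS hV hA hid haq hpen
    rcases F with _ | ⟨t, F⟩
    · refine Run.loop_exit ?_ ⟨by simp [Test.cost, NExpr.cost], by simp, by simp, .refl s,
        fun _ _ => ⟨fun _ _ _ => rfl, rfl⟩, fun _ _ => rfl⟩
      simp [Test.eval, NExpr.eval, show s.nreg 23 = 0 from hst]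
    obtain ⟨hpos, htop, hrest⟩ := hst
    have hS := List.forall_mem_cons.1 hS
    have hV := List.forall_mem_cons.1 hV
    have hA := List.forall_mem_cons.1 hA
    rw [List.flatMap_cons] at hid haq
    obtain ⟨hid₁, hid₂, hid₃⟩ := List.nodup_append'.1 hid
    obtain ⟨haq₁, haq₂, haq₃⟩ := List.nodup_append'.1 haq
    refine Run.loop_unfold (by simp only [Test.eval, NExpr.eval]; omega) (Run.seq
      (Run.straight 8 rfl (by decide) fun k₁ s₁ hk₁ hs₁ => ?_))
    simp [Program.eff, NExpr.eval, htop] at hs₁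
    have H₁ : HeapLE s s₁ := .of_eq (by simp [hs₁]) (by simp [hs₁]) (by simp [hs₁])
    have n₁ : s₁.nmem = s.nmem := by simp [hs₁]
    have r₁ : s₁.rmem = s.rmem := by simp [hs₁]
    have hsame₁ : ∀ j, SameAt j s s₁ := fun j => ⟨fun _ _ _ => by rw [n₁], by rw [r₁]⟩
    have hpen₁ : penalties s₁ = S.pen := by rw [← hpen]; funext u; simp [penalties, n₁, r₁]
    obtain ⟨p, hVt⟩ := hV.1
    refine (Run.frame (nr := visit.writes.1) (rr := visit.writes.2.1) (nm := visit.writes.2.2.1)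
      (rm := visit.writes.2.2.2) (by simp) (run_visit (S := S) (t := t) (L := F.map ClTree.root)
      (by simp [hs₁]) (by simpa [hs₁] using hrest) (hS.1.mono H₁ fun j _ => hsame₁ j) hVt
      (by rw [r₁]; exact hA.1) hid₁ haq₁ hpen₁)).mono ?_
    rintro k₂ s₂ ⟨⟨G, hG⟩, f⟩
    have hpen₂ : penalties s₂ = S.pen := by
      rw [← hpen₁]; funext u
      simp only [penalties, f.nmem 10 (by decide), f.rmem 1 (by decide)]
    have hids : ∀ j ∈ G.flatMap ClTree.ids, j ∈ t.ids := fun j hj => hG.ids_sub.subset hj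
    have haqs : ∀ j ∈ G.flatMap ClTree.aq, j ∈ t.aq := fun j hj => hG.aq_sub.subset hj
    have htime := hG.time
    have hF₂ : ∀ u ∈ F, StoresTree s₂ u := fun u hu => (hS.2 u hu).mono (H₁.trans hG.heap)
      fun j hj => (hsame₁ j).trans (hG.same j fun h =>
        hid₃ h (List.mem_flatMap.2 ⟨u, hu, hj⟩))
    simp only [List.map_cons, List.sum_cons] at hm
    refine (ih (G ++ F) s₂ ?_ (by simpa using hG.stack) ?_ ?_ ?_ ?_ ?_ hpen₂).mono ?_
    · simp only [List.map_append, List.sum_append]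
      omega
    · intro u hu
      rcases List.mem_append.1 hu with hu | hu
      exacts [hG.stores u hu, hF₂ u hu]
    · intro u hu
      rcases List.mem_append.1 hu with hu | hu
      exacts [hG.valid u hu, hV.2 u hu]
    · intro u hu
      rcases List.mem_append.1 hu with hu | hu
      · exact hG.answered u hu
      · refine (hA.2 u hu).congr fun q hq => ?_
        rw [hG.acc_eq q fun h => haq₃ h (List.mem_flatMap.2 ⟨u, hu, hq⟩), r₁]
    · rw [List.flatMap_append]
      exact List.nodup_append'.2 ⟨nodup_of_subperm hG.ids_sub hid₁, hid₂,
        fun j h h' => hid₃ (hids j h) h'⟩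
    · rw [List.flatMap_append]
      exact List.nodup_append'.2 ⟨nodup_of_subperm hG.aq_sub haq₁, haq₂,
        fun j h h' => haq₃ (haqs j h) h'⟩
    rintro k₃ s₃ ⟨hk₃, hS₃, hA₃, hH₃, hsame₃, hacc₃⟩
    simp only [List.flatMap_append, List.mem_append, not_or] at hsame₃ hacc₃
    have hroot : t.root ∈ t.ids := by cases t <;> simp [ClTree.root, ClTree.ids]
    refine ⟨?_, List.forall_mem_cons.2 ⟨?_, fun u hu => hS₃ u (by simp [hu])⟩,
      List.forall_mem_cons.2 ⟨?_, fun u hu => hA₃ u (by simp [hu])⟩, (H₁.trans hG.heap).trans hH₃,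
      ?_, ?_⟩
    · simp only [List.map_append, List.sum_append, List.map_cons, List.sum_cons, Test.cost,
        NExpr.cost] at hk₃ ⊢
      omega
    · exact hG.rebuild s₃ hH₃ (hsame₃ _ ⟨hG.root_not_mem, fun h => hid₃ hroot h⟩)
        fun u hu => hS₃ u (by simp [hu])
    -- The later run also changes the answers of the other trees on the stack, which `reanswer` does
    -- not allow. The final answers are therefore used for the queries of `t` only.
    · refine (hG.reanswer (fun q => if q ∈ t.aq then s₃.rmem 5 q else s₂.rmem 5 q) ?_ ?_).congr ?_
      · intro q hq
        by_cases h : q ∈ t.aq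
        · simp only [h, if_true]
          exact hacc₃ q ⟨hq, fun h' => haq₃ h h'⟩
        · simp [h]
      · intro u hu
        refine (hA₃ u (by simp [hu])).congr fun q hq => ?_
        rw [(ClTree.aq_contract u).mem_iff] at hq
        simp [haqs q (List.mem_flatMap.2 ⟨u, hu, hq⟩)]
      · intro q hq
        rw [(ClTree.aq_contract t).mem_iff] at hq
        simp [hq]
    · intro j hj
      simp only [List.flatMap_cons, List.mem_append, not_or] at hj
      exact ((hsame₁ j).trans (hG.same j hj.1)).trans (hsame₃ j ⟨fun h => hj.1 (hids j h), hj.2⟩)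
    · intro q hq
      simp only [List.flatMap_cons, List.mem_append, not_or] at hq
      rw [hacc₃ q ⟨fun h => hq.1 (haqs q h), hq.2⟩, hG.acc_eq q hq.1, r₁]

/-- Contract the tree with root `0` until a single cluster is left. -/
def contractTree : Program :=
  .loop (.nle (.const 1) (.mem 13 (.const 0)))
    ((.storeN 25 (.const 0) (.const 0) ;; .setN 23 (.const 1)) ;; contractStack)

/-- A round costs at most `1000 * N + 40`, because contraction does not increase the weight. The
measure `card - 1` shrinks by the factor 7/8 in each round. It is 0 for a single cluster, whose
queries are then answered with respect to all clients. -/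
theorem run_contractTree {S : QuerySystem} (N : ℕ) (m : ℕ) : ∀ (t : ClTree) (s : State),
    t.card - 1 < 2 ^ m → t.weight ≤ N → t.root = 0 →
    StoresTree s t → (∃ p, t.Valid S p) → t.Answered S (s.rmem 5) → t.ids.Nodup →
    t.aq.Nodup → penalties s = S.pen →
    Run contractTree s fun k s' => k ≤ 6 * m * (1000 * N + 40) + 10 ∧
      ∀ q ∈ t.aq, s'.rmem 5 q = (t.pts.map (S.val q)).sum := by
  have round : ∀ (t : ClTree) (s : State) (Q : ℕ → State → Prop), t.kind ≠ 0 →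
      t.weight ≤ N → t.root = 0 →
      StoresTree s t → (∃ p, t.Valid S p) → t.Answered S (s.rmem 5) → t.ids.Nodup →
      t.aq.Nodup → penalties s = S.pen → 
      (∀ k s', k ≤ 1000 * N + 40 → StoresTree s' t.contract → t.contract.Answered S (s'.rmem 5) →
        penalties s' = S.pen → Run contractTree s' fun k' s'' => Q (k + k') s'') →
      Run contractTree s Q := by
    intro t s Q hk hN hroot hst hv ha hid haq hpen hQ
    have := hst.kind_eq
    rw [hroot] at this
    refine Run.loop_unfold (by simp [Test.eval, NExpr.eval]; omega) ?_
    refine Run.seq (Run.straight 20 rfl (by decide) fun k₁ s₁ hk₁ hs₁ => ?_)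
    simp [Program.eff, NExpr.eval] at hs₁
    refine (Run.frame (nr := contractStack.writes.1) (rr := contractStack.writes.2.1)
      (nm := contractStack.writes.2.2.1) (rm := contractStack.writes.2.2.2) (by simp)
      (run_contractStack (S := S) _ [t] s₁ le_rfl ?_ ?_ (by simpa using hv) ?_ (by simpa using hid)
      (by simpa using haq) ?_)).mono ?_
    · simp [hs₁, hroot, Stack]
    · simp only [List.mem_singleton, forall_eq]
      refine hst.mono (.of_eq (by simp [hs₁]) (by simp [hs₁]) (by simp [hs₁]))
        fun i _ => ⟨fun a h1 h2 => ?_, by simp [hs₁]⟩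
      have : a ≠ 25 := by omega
      simp [hs₁, this]
    · simpa [hs₁] using ha
    · rw [← hpen]; funext u; simp [penalties, hs₁]
    · rintro k₂ s₂ ⟨⟨hk₂, h1, h2, -⟩, f⟩
      simp only [List.map_cons, List.map_nil, List.sum_singleton] at hk₂
      refine (hQ _ s₂ ?_ (h1 t (by simp)) (h2 t (by simp)) ?_)
      · simp only [Test.cost, NExpr.cost]
        omega
      · rw [← hpen]; funext u
        simp only [penalties, f.nmem 10 (by decide), f.rmem 1 (by decide)]
        simp [hs₁]
  have rounds : ∀ (r : ℕ) (t : ClTree) (s : State) (Q : ℕ → State → Prop),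
      t.weight ≤ N → t.root = 0 →
      StoresTree s t → (∃ p, t.Valid S p) → t.Answered S (s.rmem 5) → t.ids.Nodup →
      t.aq.Nodup → penalties s = S.pen →
      (∀ (t' : ClTree) k s', 8 ^ r * (t'.card - 1) ≤ 7 ^ r * (t.card - 1) → t'.weight ≤ N →
        t'.root = 0 → t'.pts.Perm t.pts → t'.aq.Perm t.aq → (∃ p, t'.Valid S p) → t'.ids.Nodup →
        k ≤ r * (1000 * N + 40) → StoresTree s' t' →
        t'.Answered S (s'.rmem 5) → penalties s' = S.pen →
        Run contractTree s' fun k' s'' => Q (k + k') s'') →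
      Run contractTree s Q := by
    intro r
    induction r with
    | zero =>
      intro t s Q hN hroot hst hv ha hid haq hpen hQ
      exact (hQ t 0 s (by simp) hN hroot (.refl _) (.refl _) hv hid (by simp) hst ha hpen).mono
        fun t s h => by simpa using h
    | succ r ih =>
      intro t s Q hN hroot hst hv ha hid haq hpen hQ
      refine ih t s Q hN hroot hst hv ha hid haq hpen ?_
      intro t' k s' hc hN' hroot' hpts' haq' hv' hid' hk hst' ha' hpen'
      have hnd' := haq'.nodup_iff.2 haq
      by_cases hkind : t'.kind = 0
      · refine hQ t' k s' ?_ hN' hroot' hpts' haq' hv' hid' (by rw [Nat.add_mul]; omega) hst' ha' hpen'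
        cases t' <;> simp [ClTree.kind] at hkind
        simp [ClTree.card]
      · refine round t' s' _ hkind hN' hroot' hst' hv' ha' hid' hnd' hpen' ?_
        intro k₂ s₂ hk₂ hst₂ ha₂ hpen₂
        have hcc := t'.card_contract
        have h8 := t'.pts_contract
        have h9 := t'.aq_contract
        refine (hQ t'.contract (k + k₂) s₂ ?_ ?_ (by rw [ClTree.root_contract, hroot'])
          (h8.trans hpts') (h9.trans haq') (hv'.imp fun p h => h.contract hnd')
          (t'.ids_contract.nodup hid') (by rw [Nat.add_mul]; omega) hst₂ ha₂ hpen₂).mono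
          fun _ _ h => by rwa [← Nat.add_assoc]
        · calc 8 ^ (r + 1) * (t'.contract.card - 1) = 8 ^ r * (8 * (t'.contract.card - 1)) := by ring
            _ ≤ 8 ^ r * (7 * (t'.card - 1)) :=
              Nat.mul_le_mul_left _ (by omega)
            _ = 7 * (8 ^ r * (t'.card - 1)) := by ring
            _ ≤ 7 * (7 ^ r * (t.card - 1)) := by gcongr
            _ = 7 ^ (r + 1) * (t.card - 1) := by ring
        · have hpos : 0 < t'.card := by cases t' <;> simp [ClTree.card]
          have h8' := h8.length_eq
          have h9' := h9.length_eq
          simp only [ClTree.weight] at *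
          omega
  induction m with
  | zero =>
    intro t s hm hN hroot hst hv ha hid haq hpen
    rcases t with ⟨i, X⟩ | ⟨i, X, t⟩ | ⟨i, l, r⟩
    · obtain rfl : i = 0 := hroot
      refine Run.loop_exit ?_ ⟨by simp [Test.cost, NExpr.cost], ?_⟩
      · simp [Test.eval, NExpr.eval, hst.1]
      · exact ha
    · have : 0 < t.card := by cases t <;> simp [ClTree.card]
      simp [ClTree.card] at hm
      omega
    · have : 0 < l.card := by cases l <;> simp [ClTree.card]
      simp [ClTree.card] at hm
      omega
  | succ m ih =>
    intro t s hm hN hroot hst hv ha hid haq hpen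
    -- Six rounds halve the measure, since 2 · 7^6 < 8^6.
    refine rounds 6 t s _ hN hroot hst hv ha hid haq hpen ?_
    intro t' k s' hc hN' hroot' hpts' haq' hv' hid' hk hst' ha' hpen'
    refine (ih t' s' ?_ hN' hroot' hst' hv' ha' hid' (haq'.nodup_iff.2 haq) hpen').mono ?_
    · norm_num at hc
      rw [pow_succ] at hm
      omega
    · rintro k' s'' ⟨hk', h⟩
      refine ⟨?_, fun q hq => ?_⟩
      · have : 6 * (m + 1) * (1000 * N + 40) = 6 * m * (1000 * N + 40) + 6 * (1000 * N + 40) := by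
          ring
        omega
      · rw [h q (haq'.mem_iff.2 hq)]
        exact (hpts'.map _).sum_eq

end RealRAM

/-! ## Rooted trees on the natural numbers -/

/-- A weighted tree in which every node but the root `0` has a smaller node as its parent. -/
structure IndexedTree where
  parent : ℕ → ℕ
  parent_lt : ∀ i, 0 < i → parent i < i
  parent_zero : parent 0 = 0
  cost : ℕ → ℝ
  cost_nonneg : ∀ i, 0 ≤ cost i
  cost_zero : cost 0 = 0
  pen : ℕ → ℝ
  rad : ℕ → ℝ

namespace IndexedTree

variable (T : IndexedTree)

/-- The distance of two nodes. -/
noncomputable def dist (i j : ℕ) : ℝ :=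
  if i = j then 0
  else if j < i then T.cost i + dist (T.parent i) j
  else T.cost j + dist i (T.parent j)
termination_by i + j
decreasing_by
  · have := T.parent_lt i (by omega); omega
  · have := T.parent_lt j (by omega); omega

/-- `T.Below w u` means that `u` lies in the subtree of `w`. -/
inductive Below (w : ℕ) : ℕ → Prop
  | refl : Below w w
  | step {u : ℕ} : w < u → Below w (T.parent u) → Below w u

variable {T}

theorem dist_self (i : ℕ) : T.dist i i = 0 := by rw [dist, if_pos rfl]

theorem dist_of_lt {i j : ℕ} (h : j < i) : T.dist i j = T.cost i + T.dist (T.parent i) j := by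
  rw [dist, if_neg h.ne', if_pos h]

theorem dist_of_gt {i j : ℕ} (h : i < j) : T.dist i j = T.cost j + T.dist i (T.parent j) := by
  rw [dist, if_neg h.ne, if_neg h.not_gt]

theorem dist_comm (i j : ℕ) : T.dist i j = T.dist j i := by
  induction hn : i + j using Nat.strong_induction_on generalizing i j with
  | _ n ih =>
    rcases lt_trichotomy i j with h | rfl | h
    · have := T.parent_lt j (by omega)
      rw [dist_of_gt h, dist_of_lt h, ih _ (by omega) i _ rfl]
    · rfl
    · have := T.parent_lt i (by omega)
      rw [dist_of_gt h, dist_of_lt h, ih _ (by omega) _ j rfl]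

theorem dist_parent (i : ℕ) : T.dist i (T.parent i) = T.cost i := by
  rcases Nat.eq_zero_or_pos i with rfl | h
  · rw [T.parent_zero, dist_self, T.cost_zero]
  · rw [dist_of_lt (T.parent_lt i h), dist_self, add_zero]

theorem Below.le {w u : ℕ} (h : T.Below w u) : w ≤ u := by
  cases h with
  | refl => exact le_rfl
  | step h _ => exact h.le

theorem Below.parent {w u : ℕ} (h : T.Below w u) (hne : u ≠ w) : T.Below w (T.parent u) := by
  cases h with
  | refl => exact absurd rfl hne
  | step _ h => exact h

theorem Below.trans {v w u : ℕ} (h : T.Below v w) (h' : T.Below w u) : T.Below v u := by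
  induction h' with
  | refl => exact h
  | step hlt _ ih => exact .step (h.le.trans_lt hlt) ih

theorem below_of_parent {w : ℕ} (hw : 0 < w) : T.Below (T.parent w) w :=
  .step (T.parent_lt w hw) .refl

/-- The ancestors of a node form a chain. -/
theorem Below.total {w w' u : ℕ} (h : T.Below w u) (h' : T.Below w' u) :
    T.Below w w' ∨ T.Below w' w := by
  induction h with
  | refl => exact .inr h'
  | @step u hlt h1 ih =>
    by_cases hu : u = w'
    · exact .inl (hu ▸ .step hlt h1)
    · exact ih (h'.parent hu)

/-- The subtrees of different siblings are disjoint. -/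
theorem Below.sibling_eq {w w' u : ℕ} (hw : 0 < w) (hw' : 0 < w')
    (hp : T.parent w = T.parent w') (h : T.Below w u) (h' : T.Below w' u) : w = w' := by
  by_contra hne
  have h1 := T.parent_lt w hw
  have h2 := T.parent_lt w' hw'
  rcases h.total h' with h3 | h3
  · have := (h3.parent (Ne.symm hne)).le
    omega
  · have := (h3.parent hne).le
    omega

theorem dist_parent_of_below {w u : ℕ} (hw : 0 < w) (h : T.Below w u) :
    T.dist (T.parent w) u = T.cost w + T.dist w u := by
  have hp := T.parent_lt w hw
  induction h with
  | refl => rw [dist_comm, dist_parent, dist_self, add_zero]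
  | @step u hlt _ ih =>
    rw [dist_of_gt (hp.trans hlt), ih, dist_of_gt hlt]
    ring

/-- Paths leave a subtree through the parent of its root. -/
theorem dist_of_below {w x y : ℕ} (hw : 0 < w) (hx : T.Below w x) (hy : ¬ T.Below w y) :
    T.dist x y = T.dist x (T.parent w) + T.dist (T.parent w) y := by
  have hp := T.parent_lt w hw
  induction hn : x + y using Nat.strong_induction_on generalizing x y with
  | _ n ih =>
    have hle := hx.le
    rcases lt_trichotomy x y with h | rfl | h
    · have hpy : ¬ T.Below w (T.parent y) := fun h' => hy (.step (hle.trans_lt h) h')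
      have := T.parent_lt y (by omega)
      rw [dist_of_gt h, ih _ (by omega) hx hpy rfl, dist_of_gt (show T.parent w < y by omega)]
      ring
    · exact absurd hx hy
    · rcases eq_or_ne x w with rfl | hxw
      · rw [dist_of_lt h, dist_parent]
      · have := T.parent_lt x (by omega)
        rw [dist_of_lt h, ih _ (by omega) (hx.parent hxw) hy rfl,
          dist_of_lt (show T.parent w < x by omega)]
        ring

/-! ### The queries of a rooted tree and its tree of clusters -/

variable (T)

/-- The queries of a tree with `n` nodes: for each node `v`, the query `v` asks for the total penalty
at `v`, and the queries `n + v` and `2 n + v` ask for the penalty of the subtree of `v` at the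
parent of `v` and at `v`. -/
noncomputable def queries (n : ℕ) : QuerySystem where
  dist := T.dist
  dist_self := dist_self
  dist_comm := dist_comm
  pen := T.pen
  rad := T.rad
  loc q := if q < n then q else if q < n + n then T.parent (q - n) else q - (n + n)
  cares q u := q < n ∨ (n ≤ q ∧ q < n + n ∧ T.Below (q - n) u) ∨
    (n + n ≤ q ∧ T.Below (q - (n + n)) u)
  free q := q < n

/-- The cluster that consists of a single node, seen from its parent and from itself. -/
noncomputable def single (n i : ℕ) : Cluster where
  qt := [(i, T.cost i)]
  qb := [(i, 0), (n + n + i, 0), (n + i, T.cost i)]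
  ct := [(i, T.rad i - T.cost i)]
  cb := [(i, T.rad i)]
  len := T.cost i
  pts := [i]
  tq := [i]
  bq := [i, n + n + i, n + i]
  aq := [i, n + n + i, n + i]
  top := T.parent i
  bot := i

/-- The empty cluster at a node. -/
def emptyCluster (v : ℕ) : Cluster where
  qt := []
  qb := []
  ct := []
  cb := []
  len := 0
  pts := []
  tq := []
  bq := []
  aq := []
  top := v
  bot := v

/-- The tree that hangs from the node `v` when the nodes `n - j`, …, `n - 1` have been linked to
their parents. -/
noncomputable def kids (n : ℕ) : ℕ → ℕ → ClTree
  | 0 => fun v => .leaf (n + n + v) (emptyCluster v)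
  | j + 1 => Function.update (kids n j) (T.parent (n - 1 - j))
      (.bin (n + (n - 1 - j))
        (.un (n - 1 - j) (T.single n (n - 1 - j)) (kids n j (n - 1 - j)))
        (kids n j (T.parent (n - 1 - j))))

variable {T} {n : ℕ}

theorem single_valid {i : ℕ} (hi : i < n) : (T.single n i).Valid (T.queries n) where
  qt_asc := by simp [single, KeyList.Ascending]
  -- The two queries at the node itself have distance 0 to it, and the one at its parent has the
  -- edge cost; the order of the list rests on nonnegative costs.
  qb_asc := by simp [single, KeyList.Ascending, T.cost_nonneg]
  ct_asc := by simp [single, KeyList.Ascending]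
  cb_asc := by simp [single, KeyList.Ascending]
  qt_perm := by simp [single, queries, hi, dist_parent]
  qb_perm := by
    have h1 : ¬ n + i < n := by omega
    have h2 : ¬ n + n + i < n := by omega
    simp [single, queries, hi, h1, h2, dist_self, dist_comm _ i, dist_parent]
  ct_perm := by simp [single, queries, dist_parent]
  cb_perm := by simp [single, queries, dist_self]
  len_eq := by simp [single, queries, dist_comm _ i, dist_parent]
  mem_tq := by simp [single, queries, hi]; omega
  tq_subset := by simp [single]
  bq_subset := by simp [single]
  tq_nodup := by simp [single]
  bq_nodup := by simp [single]; omega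

theorem emptyCluster_valid (v : ℕ) : (emptyCluster v).Valid (T.queries n) := by
  constructor <;> simp [emptyCluster, KeyList.Ascending, queries, dist_self]

/-- Hides the function update in `kids`. Linking the node `w = n - 1 - j` changes only the tree at
the parent of `w`, and the trees at all other nodes just pass from `j` to `j + 1`, hence the premise
`hmono`. -/
theorem kids_induction (P : ℕ → ℕ → ClTree → Prop)
    (h0 : ∀ v, P 0 v (.leaf (n + n + v) (emptyCluster v)))
    (hstep : ∀ j w v, j + w + 1 = n → 0 < w → T.parent w = v → v < w → (∀ v, P j v (T.kids n j v)) →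
      (∀ v, P (j + 1) v (T.kids n j v)) →
      P (j + 1) v (.bin (n + w) (.un w (T.single n w) (T.kids n j w)) (T.kids n j v)))
    (hmono : ∀ j v, P j v (T.kids n j v) → P (j + 1) v (T.kids n j v)) :
    ∀ j v, j < n → P j v (T.kids n j v) := by
  intro j
  induction j with
  | zero => exact fun v _ => h0 v
  | succ j ih =>
    intro v hj
    obtain ⟨w, hw⟩ : ∃ w, j + w + 1 = n := ⟨n - 1 - j, by omega⟩
    have hw' : n - 1 - j = w := by omega
    rw [kids, hw']
    by_cases hv : v = T.parent w
    · subst hv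
      rw [Function.update_self]
      exact hstep j w _ hw (by omega) rfl (T.parent_lt w (by omega)) (fun v => ih v (by omega))
        fun v => hmono _ _ (ih v (by omega))
    · rw [Function.update_of_ne hv]
      exact hmono _ _ (ih v (by omega))

/-- The nodes in the tree at `v` are those below the children of `v` that have been linked so far.
None occurs twice because subtrees of different siblings are disjoint. -/
theorem kids_pts (j v : ℕ) (hj : j < n) :
    (∀ u ∈ (T.kids n j v).pts, u < n ∧ n ≤ u + j ∧
      ∃ w, n ≤ w + j ∧ 0 < w ∧ T.parent w = v ∧ T.Below w u) ∧ (T.kids n j v).pts.Nodup := by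
  refine kids_induction (T := T) (fun j v t => (∀ u ∈ t.pts, u < n ∧ n ≤ u + j ∧
      ∃ w, n ≤ w + j ∧ 0 < w ∧ T.parent w = v ∧ T.Below w u) ∧ t.pts.Nodup) ?_ ?_ ?_ j v hj
  · simp [ClTree.pts, emptyCluster]
  · rintro j w v hw hw0 rfl hlt ih ih'
    simp only [ClTree.pts, single, List.cons_append, List.nil_append, List.mem_cons,
      List.mem_append, List.nodup_cons]
    refine ⟨?_, ?_, List.nodup_append'.2 ⟨(ih w).2, (ih _).2, fun u h h' => ?_⟩⟩
    · rintro u (rfl | h | h)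
      · exact ⟨by omega, by omega, u, by omega, hw0, rfl, .refl⟩
      · obtain ⟨h1, h2, w', h3, h4, h5, h6⟩ := (ih w).1 u h
        exact ⟨h1, by omega, w, by omega, hw0, rfl, (h5 ▸ below_of_parent h4 : T.Below w w').trans h6⟩
      · exact (ih' _).1 u h
    · rintro (h | h)
      · have := ((ih w).1 w h).2.1; omega
      · have := ((ih _).1 w h).2.1; omega
    · obtain ⟨h1, h2, w', h3, h4, h5, h6⟩ := (ih w).1 u h
      obtain ⟨g1, g2, w'', g3, g4, g5, g6⟩ := (ih _).1 u h'
      have hb : T.Below w w' := h5 ▸ below_of_parent h4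
      have := Below.sibling_eq hw0 g4 g5.symm (hb.trans h6) g6
      omega
  · rintro j v ⟨h, h'⟩
    refine ⟨fun u hu => ?_, h'⟩
    obtain ⟨h1, h2, w, h3, h4⟩ := h u hu
    exact ⟨h1, by omega, w, by omega, h4⟩

/-- A linked node is always found at a node that has not been linked yet: when `w` is linked, all
that hung from `w` moves to its parent. For `j = n - 1` only the root is left. -/
theorem mem_kids_pts (j : ℕ) (hj : j < n) :
    ∀ u < n, n ≤ u + j → ∃ v, v + j < n ∧ u ∈ (T.kids n j v).pts := by
  induction j with
  | zero => intro u h h'; omega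
  | succ j ih =>
    intro u hu huj
    obtain ⟨w, hw⟩ : ∃ w, j + w + 1 = n := ⟨n - 1 - j, by omega⟩
    have hw' : n - 1 - j = w := by omega
    have hp := T.parent_lt w (by omega)
    rw [kids, hw']
    by_cases huw : u = w
    · refine ⟨T.parent w, by omega, ?_⟩
      simp [ClTree.pts, single, huw]
    · obtain ⟨v, hv, hmem⟩ := ih (by omega) u hu (by omega)
      by_cases hvw : v = w
      · subst hvw
        refine ⟨T.parent v, by omega, ?_⟩
        simp [ClTree.pts, hmem]
      · refine ⟨v, by omega, ?_⟩
        by_cases hvp : v = T.parent w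
        · subst hvp
          simp [ClTree.pts, hmem]
        · rwa [Function.update_of_ne hvp]

theorem kids_aq (j v : ℕ) (hj : j < n) :
    (T.kids n j v).aq = (T.kids n j v).pts.flatMap fun u => [u, n + n + u, n + u] := by
  refine kids_induction (T := T) (fun j v t => t.aq = t.pts.flatMap fun u => [u, n + n + u, n + u])
    ?_ ?_ ?_ j v hj
  · simp [ClTree.aq, ClTree.pts, emptyCluster]
  · rintro j w v hw hw0 rfl hlt ih -
    simp [ClTree.aq, ClTree.pts, single, ih]
  · exact fun _ _ h => h

/-- Each linked node `u` brings three names: `u` for its cluster, `n + u` for the branching at its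
parent and `n + n + u` for the empty leaf at the end of its own list of children. They are the same
numbers as its queries. -/
theorem kids_ids (j v : ℕ) (hj : j < n) : (T.kids n j v).ids.Perm
    ((n + n + v) :: (T.kids n j v).pts.flatMap fun u => [u, n + n + u, n + u]) := by
  refine kids_induction (T := T) (fun j v t => t.ids.Perm
    ((n + n + v) :: t.pts.flatMap fun u => [u, n + n + u, n + u])) ?_ ?_ ?_ j v hj
  · simp [ClTree.ids, ClTree.pts, emptyCluster]
  · rintro j w v hw hw0 rfl hlt ih -
    have h1 := ih w
    have h2 := ih (T.parent w)
    rw [List.perm_iff_count] at h1 h2 ⊢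
    intro a
    have h1 := h1 a
    have h2 := h2 a
    simp only [ClTree.ids, ClTree.pts, single, List.count_cons, List.count_append,
      List.flatMap_append, List.flatMap_cons, List.flatMap_nil, List.append_nil,
      List.count_nil] at h1 h2 ⊢
    rw [h1, h2]
    ring
  · exact fun _ _ h => h

theorem kids_card (j v : ℕ) (hj : j < n) :
    (T.kids n j v).card = 3 * (T.kids n j v).pts.length + 1 := by
  refine kids_induction (T := T) (fun j v t => t.card = 3 * t.pts.length + 1) ?_ ?_ ?_ j v hj
  · simp [ClTree.card, ClTree.pts, emptyCluster]
  · rintro j w v hw hw0 rfl hlt ih -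
    simp [ClTree.card, ClTree.pts, single, ih]
    ring
  · exact fun _ _ h => h

theorem kids_places (j v : ℕ) (hj : j < n) : ∀ x ∈ (T.kids n j v).places (T.queries n),
    x = v ∨ ∃ w, n ≤ w + j ∧ 0 < w ∧ T.parent w = v ∧ T.Below w x := by
  refine kids_induction (T := T) (fun j v t => ∀ x ∈ t.places (T.queries n),
    x = v ∨ ∃ w, n ≤ w + j ∧ 0 < w ∧ T.parent w = v ∧ T.Below w x) ?_ ?_ ?_ j v hj
  · simp [ClTree.places, Cluster.places, emptyCluster]
  · rintro j w v hw hw0 rfl hlt ih ih' x hx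
    have h1 : w < n := by omega
    have h2 : ¬ n + w < n := by omega
    have h3 : ¬ n + n + w < n := by omega
    have hx' : x = w ∨ x = T.parent w ∨ x ∈ (T.kids n j w).places (T.queries n) ∨
        x ∈ (T.kids n j (T.parent w)).places (T.queries n) := by
      simp [ClTree.places, Cluster.places, single, queries, h1, h2, h3] at hx ⊢
      tauto
    rcases hx' with rfl | rfl | hx' | hx'
    · exact .inr ⟨x, by omega, hw0, rfl, .refl⟩
    · exact .inl rfl
    · refine .inr ⟨w, by omega, hw0, rfl, ?_⟩
      rcases ih w x hx' with rfl | ⟨w', g1, g2, g3, g4⟩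
      · exact .refl
      · exact (g3 ▸ below_of_parent g2 : T.Below w w').trans g4
    · exact ih' _ x hx'
  · rintro j v h x hx
    rcases h x hx with h | ⟨w, g1, g2⟩
    · exact .inl h
    · exact .inr ⟨w, by omega, g2⟩

/-- The two restricted queries of `v` count only clients below `v`. -/
theorem cares_iff_free {q u v : ℕ} (hv : v < n) (hq : q ∈ [v, n + n + v, n + v])
    (h : ¬ T.Below v u) : (T.queries n).cares q u ↔ (T.queries n).free q := by
  simp only [queries]
  refine ⟨fun hc => ?_, .inl⟩
  simp only [List.mem_cons, List.not_mem_nil, or_false] at hq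
  rcases hc with hc | ⟨h1, h2, h3⟩ | ⟨h1, h3⟩
  · exact hc
  · have hqv : q - n = v := by omega
    exact absurd (hqv ▸ h3) h
  · have hqv : q - (n + n) = v := by omega
    exact absurd (hqv ▸ h3) h

/-- Hanging the subtree of a node from this node. -/
theorem un_valid {j w : ℕ} (hj : j < n) (hw : w < n)
    (hv : (T.kids n j w).Valid (T.queries n) w) :
    (ClTree.un w (T.single n w) (T.kids n j w)).Valid (T.queries n) (T.parent w) := by
  have hb : ∀ x ∈ (T.kids n j w).places (T.queries n), T.Below w x := by
    intro x hx
    rcases kids_places j w hj x hx with rfl | ⟨w', g1, g2, g3, g4⟩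
    · exact .refl
    · exact (g3 ▸ below_of_parent g2 : T.Below w w').trans g4
  have hp : ∀ u ∈ (T.kids n j w).pts, T.Below w u ∧ w < u ∧ u < n := by
    intro x hx
    obtain ⟨h1, h2, w', g1, g2, g3, g4⟩ := (kids_pts j w hj).1 x hx
    have := g4.le
    have := T.parent_lt w' g2
    exact ⟨(g3 ▸ below_of_parent g2 : T.Below w w').trans g4, by omega, h1⟩
  refine ⟨⟨rfl, single_valid hw⟩, hv, ?_, ?_, ?_⟩
  · intro v hv v' hv'
    have h2 : ¬ n + w < n := by omega
    have h3 : ¬ n + n + w < n := by omega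
    have hvw : v = w ∨ v = T.parent w := by
      simp [Cluster.places, single, queries, hw, h2, h3] at hv
      tauto
    show T.dist v v' = T.dist v w + T.dist w v'
    rcases hvw with rfl | rfl
    · rw [dist_self, zero_add]
    · rcases Nat.eq_zero_or_pos w with rfl | hw0
      · rw [T.parent_zero, dist_self, zero_add]
      · rw [dist_parent_of_below hw0 (hb v' hv'), dist_comm _ w, dist_parent]
  · intro q hq u hu
    have hu' := hp u hu
    simp only [single, queries, List.mem_cons, List.not_mem_nil, or_false] at hq ⊢
    refine iff_of_true ?_ hq
    rcases hq with rfl | rfl | rfl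
    · exact .inl hw
    · exact .inr (.inr ⟨by omega, by simpa using hu'.1⟩)
    · exact .inr (.inl ⟨by omega, by omega, by simpa using hu'.1⟩)
  · intro q hq u hu
    rw [kids_aq j w hj, List.mem_flatMap] at hq
    obtain ⟨v, hv, hq⟩ := hq
    obtain rfl : u = w := by simpa [single] using hu
    have := hp v hv
    exact cares_iff_free this.2.2 hq fun h => by have := h.le; omega

/-- At a branching the left part lies in the subtree of the newly linked `w`, apart from the parent
of `w`, and the right part lies outside of it. So `dist_of_below` separates them at the parent, and
by `cares_iff_free` a query of one part counts clients of the other only if it is free. -/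
theorem kids_valid (j v : ℕ) (hj : j < n) : (T.kids n j v).Valid (T.queries n) v := by
  suffices h : j < n → (T.kids n j v).Valid (T.queries n) v from h hj
  refine kids_induction (T := T) (fun j v t => j < n → t.Valid (T.queries n) v) ?_ ?_ ?_ j v hj
  · exact fun v _ => ⟨rfl, emptyCluster_valid v⟩
  · rintro j w v hw hw0 rfl hlt ih - hjn
    have hwn : w < n := by omega
    have hj : j < n := by omega
    have hun := un_valid hj hwn (ih w hj)
    have hl : ∀ x ∈ (ClTree.un w (T.single n w) (T.kids n j w)).places (T.queries n),
        x = T.parent w ∨ T.Below w x := by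
      have h2 : ¬ n + w < n := by omega
      have h3 : ¬ n + n + w < n := by omega
      intro x hx
      have hx' : x = w ∨ x = T.parent w ∨ x ∈ (T.kids n j w).places (T.queries n) := by
        simp [ClTree.places, Cluster.places, single, queries, hwn, h2, h3] at hx ⊢
        tauto
      rcases hx' with rfl | rfl | hx'
      · exact .inr .refl
      · exact .inl rfl
      · rcases kids_places j w hj x hx' with rfl | ⟨w', g1, g2, g3, g4⟩
        · exact .inr .refl
        · exact .inr ((g3 ▸ below_of_parent g2 : T.Below w w').trans g4)
    have hlp : ∀ u ∈ (ClTree.un w (T.single n w) (T.kids n j w)).pts, T.Below w u ∧ u < n := by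
      intro u hu
      simp only [ClTree.pts, single, List.cons_append, List.nil_append, List.mem_cons] at hu
      rcases hu with rfl | hu
      · exact ⟨.refl, hwn⟩
      · obtain ⟨h1, h2, w', g1, g2, g3, g4⟩ := (kids_pts j w hj).1 u hu
        exact ⟨(g3 ▸ below_of_parent g2 : T.Below w w').trans g4, h1⟩
    have hrp : ∀ u ∈ (T.kids n j (T.parent w)).pts, ¬ T.Below w u ∧ u < n := by
      intro u hu
      obtain ⟨h1, h2, w', g1, g2, g3, g4⟩ := (kids_pts j _ hj).1 u hu
      exact ⟨fun h => by have := Below.sibling_eq hw0 g2 g3.symm h g4; omega, h1⟩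
    have hla : (ClTree.un w (T.single n w) (T.kids n j w)).aq =
        (ClTree.un w (T.single n w) (T.kids n j w)).pts.flatMap
          fun u => [u, n + n + u, n + u] := by
      simp [ClTree.aq, ClTree.pts, single, kids_aq j w hj]
    refine ⟨⟨hun, ih _ hj⟩, ?_, ?_, ?_⟩
    · intro x hx y hy
      show T.dist x y = T.dist x (T.parent w) + T.dist (T.parent w) y
      rcases hl x hx with rfl | hx
      · rw [dist_self, zero_add]
      · rcases kids_places j _ hj y hy with rfl | ⟨w', g1, g2, g3, g4⟩
        · rw [dist_self, add_zero]
        · refine dist_of_below hw0 hx fun h => ?_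
          have := Below.sibling_eq hw0 g2 g3.symm h g4
          omega
    · intro q hq u hu
      rw [hla, List.mem_flatMap] at hq
      obtain ⟨v, hv, hq⟩ := hq
      exact cares_iff_free (hlp v hv).2 hq fun h => (hrp u hu).1 ((hlp v hv).1.trans h)
    · intro q hq u hu
      rw [kids_aq j _ hj, List.mem_flatMap] at hq
      obtain ⟨v, hv, hq⟩ := hq
      obtain ⟨h1, h2, w', g1, g2, g3, g4⟩ := (kids_pts j _ hj).1 v hv
      refine cares_iff_free h1 hq fun h => ?_
      have := Below.sibling_eq hw0 g2 g3.symm (hlp u hu).1 (g4.trans h)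
      omega
  · exact fun j v h hj => h (by omega)

variable (T) in
/-- The tree of clusters of a rooted tree with `n` nodes. -/
noncomputable def clTree (n : ℕ) : ClTree := .un 0 (T.single n 0) (T.kids n (n - 1) 0)

theorem clTree_valid (hn : 0 < n) : (T.clTree n).Valid (T.queries n) 0 := by
  have := un_valid (T := T) (n := n) (j := n - 1) (w := 0) (by omega) hn (kids_valid _ _ (by omega))
  rwa [T.parent_zero] at this

theorem clTree_pts (hn : 0 < n) : (T.clTree n).pts.Perm (List.range n) := by
  have hk := kids_pts (T := T) (n := n) (n - 1) 0 (by omega)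
  refine (List.perm_ext_iff_of_nodup ?_ List.nodup_range).2 fun u => ?_
  · simp only [clTree, ClTree.pts, single, List.cons_append, List.nil_append, List.nodup_cons]
    refine ⟨fun h => ?_, hk.2⟩
    have := (hk.1 0 h).2.1
    omega
  · simp only [clTree, ClTree.pts, single, List.cons_append, List.nil_append, List.mem_cons,
      List.mem_range]
    constructor
    · rintro (rfl | h)
      exacts [hn, (hk.1 u h).1]
    · intro hu
      rcases Nat.eq_zero_or_pos u with rfl | h0
      · exact .inl rfl
      · obtain ⟨v, hv, h⟩ := mem_kids_pts (T := T) (n - 1) (by omega) u hu (by omega)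
        obtain rfl : v = 0 := by omega
        exact .inr h

theorem clTree_aq (hn : 0 < n) :
    (T.clTree n).aq = (T.clTree n).pts.flatMap fun u => [u, n + n + u, n + u] := by
  simp [clTree, ClTree.aq, ClTree.pts, single, kids_aq (n - 1) 0 (show n - 1 < n by omega)]

/-- The only query that is not the name of a node of this tree is `n + 0`, as the root hangs at no
branching. -/
theorem clTree_ids (hn : 0 < n) : (T.clTree n).ids.Subperm (T.clTree n).aq := by
  refine List.Perm.subperm ?_ |>.trans ?_ (l₂ := 0 :: ((n + n + 0) ::
    (T.kids n (n - 1) 0).pts.flatMap fun u => [u, n + n + u, n + u]))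
  · exact (kids_ids (T := T) (n - 1) 0 (by omega)).cons 0
  · rw [clTree_aq hn]
    simp only [clTree, ClTree.pts, single, List.flatMap_cons, List.cons_append, List.nil_append]
    exact ((List.sublist_cons_self (n + 0) _).cons_cons _ |>.cons_cons _).subperm

theorem flatMap_queries_nodup {l : List ℕ} (hl : l.Nodup) (h : ∀ u ∈ l, u < n) :
    (l.flatMap fun u => [u, n + n + u, n + u]).Nodup := by
  rw [List.nodup_flatMap]
  refine ⟨fun u hu => ?_, hl.imp_of_mem ?_⟩
  · have := h u hu
    simp
    omega
  · intro u v hu hv huv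
    have := h u hu
    have := h v hv
    intro x hx hx'
    simp only [List.mem_cons, List.not_mem_nil, or_false] at hx hx'
    omega

theorem clTree_aq_nodup (hn : 0 < n) : (T.clTree n).aq.Nodup := by
  rw [clTree_aq hn]
  refine flatMap_queries_nodup ((clTree_pts hn).nodup_iff.2 List.nodup_range) fun u hu => ?_
  simpa using (clTree_pts hn).mem_iff.1 hu

theorem clTree_ids_nodup (hn : 0 < n) : (T.clTree n).ids.Nodup :=
  RealRAM.nodup_of_subperm (clTree_ids hn) (clTree_aq_nodup hn)

/-- There are `3 n - 1` nodes, `3 n` queries and `n` clients. -/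
theorem clTree_weight (hn : 0 < n) : (T.clTree n).weight ≤ 7 * n ∧ (T.clTree n).card < 3 * n := by
  have h1 := (clTree_pts (T := T) hn).length_eq
  have h2 := kids_card (T := T) (n - 1) 0 (show n - 1 < n by omega)
  rw [List.length_range] at h1
  have h3 : (T.clTree n).aq.length = 3 * n := by
    rw [clTree_aq hn, List.length_flatMap]
    simp [h1, mul_comm]
  simp only [ClTree.weight, h3, h1]
  simp only [clTree, ClTree.pts, single, List.length_append, List.length_cons,
    List.length_nil] at h1
  simp only [clTree, ClTree.card, h2]
  omega

theorem answered_kids {acc : ℕ → ℝ} (hacc : ∀ i < n, ∀ q ∈ [i, n + n + i, n + i],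
    acc q = (T.queries n).val q i) (j v : ℕ) (hj : j < n) :
    (T.kids n j v).Answered (T.queries n) acc := by
  suffices h : j < n → (T.kids n j v).Answered (T.queries n) acc from h hj
  refine kids_induction (T := T) (fun j v t => j < n → t.Answered (T.queries n) acc) ?_ ?_ ?_ j v hj
  · exact fun v _ q hq => by simp [emptyCluster] at hq
  · rintro j w v hw hw0 rfl hlt ih - hj
    refine ⟨⟨fun q hq => ?_, ih w (by omega)⟩, ih _ (by omega)⟩
    rw [hacc w (by omega) q hq]
    simp [single]
  · exact fun j v h hj => h (by omega)

theorem answered_clTree {acc : ℕ → ℝ} (hn : 0 < n) (hacc : ∀ i < n, ∀ q ∈ [i, n + n + i, n + i],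
    acc q = (T.queries n).val q i) : (T.clTree n).Answered (T.queries n) acc := by
  refine ⟨fun q hq => ?_, answered_kids hacc _ _ (by omega)⟩
  rw [hacc 0 hn q hq]
  simp [single]

end IndexedTree

/-! ## Setting up the tree of clusters -/

namespace RealRAM

/-- Append a list to the heap; its entries are given by natural and real registers. -/
def writeCells : List (ℕ × ℕ) → Program
  | [] => .skip
  | x :: L => (.storeN 24 (.reg 14) (.reg x.1) ;; .storeR 3 (.reg 14) (.reg x.2) ;;
      .setN 14 (.add (.reg 14) (.const 1))) ;; writeCells L

theorem run_writeCells (L : List (ℕ × ℕ)) : ∀ s : State, (∀ x ∈ L, x.1 ≠ 14) →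
    Run (writeCells L) s fun t s' => t ≤ 10 * L.length + 1 ∧
      Holds s' (s.nreg 14) (s'.nreg 14) (L.map fun x => (s.nreg x.1, s.rreg x.2)) ∧
      HeapLE s s' ∧ Frame [14] [] [24] [3] s s' := by
  induction L with
  | nil =>
    intro s _
    refine Run.straight 1 rfl (by decide) fun t s' ht hs' => ?_
    obtain rfl : s' = s := hs'
    exact ⟨by simpa using ht, ⟨by simp, le_rfl, trivial⟩, .refl _, .refl _⟩
  | cons x L ih =>
    intro s hL
    refine Run.seq (Run.mono (Run.frame (nr := [14]) (rr := []) (nm := [24]) (rm := [3])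
      (by simp [Program.writes]) (Run.straight (Q := fun t s' => t ≤ 10 ∧ s' = Program.eff _ s) 10 rfl
      (by simp [Program.bound, NExpr.cost, RExpr.cost]) fun t s' ht hs' => ⟨ht, hs'⟩)) ?_)
    rintro t s₁ ⟨⟨ht, hs₁⟩, hf⟩
    simp only [Program.eff, NExpr.eval, RExpr.eval] at hs₁
    have h14 : s₁.nreg 14 = s.nreg 14 + 1 := by simp [hs₁]
    refine (ih s₁ fun y hy => hL y (List.mem_cons_of_mem _ hy)).mono ?_
    rintro t' s' ⟨ht', hh, hle, hf'⟩
    have hH : HeapLE s s₁ := ⟨by omega, fun k hk => by simp [hs₁, hk.ne]⟩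
    refine ⟨by simp only [List.length_cons]; omega, ⟨?_, le_rfl, ⟨?_, ?_⟩, ?_⟩, hH.trans hle,
      hf.trans hf'⟩
    · have := hh.1
      simp only [List.length_map, List.length_cons] at this ⊢
      omega
    · rw [(hle.2 _ (by omega)).1]
      simp [hs₁]
    · rw [(hle.2 _ (by omega)).2]
      simp [hs₁]
    · have := hh.2.2
      rw [h14] at this
      convert this using 1
      refine List.map_congr_left fun y hy => ?_
      rw [hf.nreg _ (by simpa using hL y (List.mem_cons_of_mem _ hy)), hf.rreg _ (by simp)]

/-- Store a list under the name in register `20`, with its bounds in the arrays `a` and `b`. -/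
def writeList (a b : ℕ) (L : List (ℕ × ℕ)) : Program :=
  .storeN a (.reg 20) (.reg 14) ;; writeCells L ;; .storeN b (.reg 20) (.reg 14)

theorem run_writeList {a b : ℕ} {L : List (ℕ × ℕ)} {s : State} (hab : a ≠ b) (ha : a ≠ 24)
    (hb : b ≠ 24) (hL : ∀ x ∈ L, x.1 ≠ 14) :
    Run (writeList a b L) s fun t s' => t ≤ 10 * L.length + 7 ∧
      Holds s' (s'.nmem a (s.nreg 20)) (s'.nmem b (s.nreg 20))
        (L.map fun x => (s.nreg x.1, s.rreg x.2)) ∧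
      HeapLE s s' ∧ Frame [14] [] [24, a, b] [3] s s' ∧
      (∀ i, i ≠ s.nreg 20 → s'.nmem a i = s.nmem a i ∧ s'.nmem b i = s.nmem b i) := by
  refine Run.seq (Run.straight 3 rfl (by simp [Program.bound, NExpr.cost]) ?_)
  intro t₁ s₁ ht₁ hs₁
  simp only [Program.eff, NExpr.eval] at hs₁
  refine Run.seq ((run_writeCells L s₁ hL).mono ?_)
  rintro t₂ s₂ ⟨ht₂, hh, hle, hf⟩
  refine Run.straight 3 rfl (by simp [Program.bound, NExpr.cost]) ?_
  intro t₃ s₃ ht₃ hs₃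
  simp only [Program.eff, NExpr.eval] at hs₃
  have h20 : s₂.nreg 20 = s.nreg 20 := by rw [hf.nreg 20 (by decide)]; simp [hs₁]
  have ha2 : s₂.nmem a = s₁.nmem a := hf.nmem a (by simpa using ha)
  have hb2 : s₂.nmem b = s₁.nmem b := hf.nmem b (by simpa using hb)
  have e1 : HeapLE s s₁ := .of_eq (by simp [hs₁]) (by simp [hs₁, ha.symm]) (by simp [hs₁])
  have e3 : HeapLE s₂ s₃ := .of_eq (by simp [hs₃]) (by simp [hs₃, hb.symm]) (by simp [hs₃])
  refine ⟨by omega, ?_, (e1.trans hle).trans e3, ⟨?_, ?_, ?_, ?_⟩, ?_⟩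
  · have := hh.mono e3
    convert this using 1
    · simp [hs₃, hab, ha2, hs₁]
    · simp [hs₃, h20]
    · simp [hs₁]
  · intro r hr; have := hf.nreg r hr; simp [hs₃, this, hs₁]
  · intro r hr; have := hf.rreg r hr; simp [hs₃, this, hs₁]
  · intro r hr
    simp only [List.mem_cons, List.not_mem_nil, or_false, not_or] at hr
    have := hf.nmem r (by simpa using hr.1)
    simp [hs₃, this, hs₁, hr]
  · intro r hr; have := hf.rmem r hr; simp [hs₃, this, hs₁]
  · intro i hi
    constructor
    · simp [hs₃, hab, ha2, hs₁, hi]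
    · simp [hs₃, hb2, h20, hs₁, hi, hab.symm]

/-- Answer the queries of the node in register `20` with respect to this node. -/
def initAnswers : Program :=
  .setR 14 (.mem 1 (.mem 10 (.reg 20))) ;;
  .ite (.rle (.reg 11) (.reg 13)) .skip
    (.storeR 5 (.reg 20) (.reg 14) ;; .storeR 5 (.reg 21) (.reg 14)) ;;
  .ite (.rle (.reg 10) (.reg 13)) .skip (.storeR 5 (.reg 22) (.reg 14))

/-- The node has distance 0 to itself, where two of its queries are placed, and the cost in real
register `10` to its parent, where the third is placed. Whether it counts for them is decided by
comparing these numbers with its radius. -/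
theorem run_initAnswers {s : State} {i j k : ℕ} (hi : s.nreg 20 = i) (hj : s.nreg 21 = j)
    (hk : s.nreg 22 = k) (hij : i ≠ j) (hik : i ≠ k) (hjk : j ≠ k) (h11 : s.rreg 11 = 0)
    (h0 : s.rmem 5 i = 0 ∧ s.rmem 5 j = 0 ∧ s.rmem 5 k = 0) :
    Run initAnswers s fun t s' => t ≤ 40 ∧
      s'.rmem 5 i = (if s.rreg 13 < 0 then penalties s i else 0) ∧
      s'.rmem 5 j = (if s.rreg 13 < 0 then penalties s i else 0) ∧
      s'.rmem 5 k = (if s.rreg 13 < s.rreg 10 then penalties s i else 0) ∧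
      ∀ l, l ≠ i → l ≠ j → l ≠ k → s'.rmem 5 l = s.rmem 5 l := by
  refine Run.straight 40 rfl (by decide) fun t s' ht hs' => ⟨ht, ?_⟩
  obtain ⟨h1, h2, h3⟩ := h0
  by_cases c1 : 0 ≤ s.rreg 13 <;> by_cases c2 : s.rreg 10 ≤ s.rreg 13 <;>
    simp [initAnswers, Program.eff, Test.eval, NExpr.eval, RExpr.eval, h11, c1, c2, hi, hj, hk] at hs' <;>
    simp [hs', c1, c2, not_lt.2, not_le.1, h1, h2, h3, hij, hik, hjk, hik.symm, hjk.symm,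
      penalties] <;>
    intro l l1 l2 l3 <;> simp [l1, l2, l3]

/-- Store the cluster of the node in register `20`. -/
def makeSingle : Program :=
  (.setN 21 (.add (.add (.reg 0) (.reg 0)) (.reg 20)) ;; .setN 22 (.add (.reg 0) (.reg 20)) ;;
    .setR 10 (.mem 0 (.mem 12 (.reg 20))) ;; .setR 11 (.const 0) ;;
    .setR 13 (.mem 2 (.mem 10 (.reg 20))) ;; .setR 12 (.sub (.reg 13) (.reg 10)) ;;
    .storeR 4 (.reg 20) (.reg 10) ;; .storeN 13 (.reg 20) (.const 1) ;;
    .storeN 14 (.reg 20) (.reg 21)) ;;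
  writeList 16 17 [(20, 10)] ;; writeList 18 19 [(20, 11), (21, 11), (22, 10)] ;;
  writeList 20 21 [(20, 12)] ;; writeList 22 23 [(20, 13)] ;;
  initAnswers

end RealRAM

open RealRAM

/-- The tree `T` with `n` nodes is in the memory: the natural arrays `10`, `11` and `12` hold the
names of its nodes, their parents and the names of the edges to the parents. -/
structure IndexedTree.Laid (T : IndexedTree) (n : ℕ) (s : State) : Prop where
  size : s.nreg 0 = n
  parent : ∀ i < n, s.nmem 11 i = T.parent i
  cost : ∀ i < n, s.rmem 0 (s.nmem 12 i) = T.cost i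
  pen : penalties s = T.pen
  rad : ∀ i < n, s.rmem 2 (s.nmem 10 i) = T.rad i

theorem IndexedTree.Laid.congr {T : IndexedTree} {n : ℕ} {s s' : State} (h : T.Laid n s)
    (h0 : s'.nreg 0 = s.nreg 0) (h1 : ∀ a ∈ [10, 11, 12], s'.nmem a = s.nmem a)
    (h2 : ∀ a ∈ [0, 1, 2], s'.rmem a = s.rmem a) : T.Laid n s' := by
  simp only [List.mem_cons, List.not_mem_nil, or_false, forall_eq_or_imp, forall_eq] at h1 h2
  obtain ⟨h10, h11, h12⟩ := h1
  obtain ⟨g0, g1, g2⟩ := h2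
  refine ⟨h0.trans h.size, ?_, ?_, ?_, ?_⟩
  · rw [h11]; exact h.parent
  · rw [h12, g0]; exact h.cost
  · rw [← h.pen]; funext u; simp [penalties, h10, g1]
  · rw [h10, g2]; exact h.rad

theorem IndexedTree.Laid.frame {T : IndexedTree} {n : ℕ} {s s' : State} {nr rr nm rm : List ℕ}
    (h : T.Laid n s) (hf : Frame nr rr nm rm s s') (h0 : 0 ∉ nr) (h1 : ∀ a ∈ [10, 11, 12], a ∉ nm)
    (h2 : ∀ a ∈ [0, 1, 2], a ∉ rm) : T.Laid n s' :=
  h.congr (hf.nreg 0 h0) (fun a ha => hf.nmem a (h1 a ha)) fun a ha => hf.rmem a (h2 a ha)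

namespace RealRAM

variable {T : IndexedTree} {n : ℕ}

theorem run_makeSingle {s : State} {i : ℕ} (hT : T.Laid n s) (hi : i < n) (h20 : s.nreg 20 = i)
    (h0 : s.rmem 5 i = 0 ∧ s.rmem 5 (n + i) = 0 ∧ s.rmem 5 (n + n + i) = 0) :
    Run makeSingle s fun t s' => t ≤ 300 ∧ s'.nreg 20 = i ∧ HeapLE s s' ∧
      StoresCluster s' i (T.single n i) ∧ s'.nmem 13 i = 1 ∧ s'.nmem 14 i = n + n + i ∧
      (∀ j, j ≠ i → SameAt j s s') ∧
      s'.rmem 5 i = (if T.rad i < 0 then T.pen i else 0) ∧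
      s'.rmem 5 (n + n + i) = (if T.rad i < 0 then T.pen i else 0) ∧
      s'.rmem 5 (n + i) = (if T.rad i < T.cost i then T.pen i else 0) ∧
      ∀ j, j ≠ i → j ≠ n + i → j ≠ n + n + i → s'.rmem 5 j = s.rmem 5 j := by
  refine Run.seq (Run.mono (Run.frame (nr := [21, 22]) (rr := [10, 11, 12, 13]) (nm := [13, 14])
    (rm := [4]) (by simp [Program.writes]) (Run.straight
      (Q := fun t s' => t ≤ 40 ∧ s' = Program.eff _ s) 40 rfl
      (by decide) fun t s' ht hs' => ⟨ht, hs'⟩)) ?_)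
  rintro t₁ s₁ ⟨⟨ht₁, hs₁⟩, f₁⟩
  simp only [Program.eff, NExpr.eval, RExpr.eval] at hs₁
  have h20' : s₁.nreg 20 = i := (f₁.nreg 20 (by decide)).trans h20
  have h21' : s₁.nreg 21 = n + n + i := by simp [hs₁, hT.size, h20]
  have h22' : s₁.nreg 22 = n + i := by simp [hs₁, hT.size, h20]
  have k10 : s₁.rreg 10 = T.cost i := by simp [hs₁, h20, hT.cost i hi]
  have k11 : s₁.rreg 11 = 0 := by simp [hs₁]
  have k12 : s₁.rreg 12 = T.rad i - T.cost i := by simp [hs₁, h20, hT.cost i hi, hT.rad i hi]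
  have k13 : s₁.rreg 13 = T.rad i := by simp [hs₁, h20, hT.rad i hi]
  have m4 : s₁.rmem 4 i = T.cost i := by simp [hs₁, h20, hT.cost i hi]
  have m13 : s₁.nmem 13 i = 1 := by simp [hs₁, h20]
  have m14 : s₁.nmem 14 i = n + n + i := by simp [hs₁, h20, hT.size]
  have o4 : ∀ j, j ≠ i → s₁.rmem 4 j = s.rmem 4 j := by intro j hj; simp [hs₁, h20, hj]
  have o13 : ∀ j, j ≠ i → s₁.nmem 13 j = s.nmem 13 j := by intro j hj; simp [hs₁, h20, hj]
  have o14 : ∀ j, j ≠ i → s₁.nmem 14 j = s.nmem 14 j := by intro j hj; simp [hs₁, h20, hj]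
  have H₁ : HeapLE s s₁ := .of_eq (f₁.nreg 14 (by decide)) (f₁.nmem 24 (by decide))
    (f₁.rmem 3 (by decide))
  clear hs₁
  refine Run.seq ((run_writeList (by decide) (by decide) (by decide) (by simp)).mono ?_)
  rintro t₂ s₂ ⟨ht₂, l₂, H₂, f₂, o₂⟩
  refine Run.seq ((run_writeList (by decide) (by decide) (by decide) (by simp)).mono ?_)
  rintro t₃ s₃ ⟨ht₃, l₃, H₃, f₃, o₃⟩
  refine Run.seq ((run_writeList (by decide) (by decide) (by decide) (by simp)).mono ?_)
  rintro t₄ s₄ ⟨ht₄, l₄, H₄, f₄, o₄⟩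
  refine Run.seq ((run_writeList (by decide) (by decide) (by decide) (by simp)).mono ?_)
  rintro t₅ s₅ ⟨ht₅, l₅, H₅, f₅, o₅⟩
  have F₃ : Frame [14] [] [24, 16, 17, 18, 19] [3] s₁ s₃ :=
    (f₂.mono (by simp) (by simp) (by simp) (by simp)).trans
      (f₃.mono (by simp) (by simp) (by simp) (by simp))
  have F₄ : Frame [14] [] [24, 16, 17, 18, 19, 20, 21] [3] s₁ s₄ :=
    (F₃.mono (by simp) (by simp) (by simp) (by simp)).trans
      (f₄.mono (by simp) (by simp) (by simp) (by simp))
  have F₅ : Frame [14] [] [24, 16, 17, 18, 19, 20, 21, 22, 23] [3] s₁ s₅ :=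
    (F₄.mono (by simp) (by simp) (by simp) (by simp)).trans
      (f₅.mono (by simp) (by simp) (by simp) (by simp))
  have H₅' : HeapLE s s₅ := (((H₁.trans H₂).trans H₃).trans H₄).trans H₅
  have hT₅ : T.Laid n s₅ := (hT.frame f₁ (by decide) (by decide) (by decide)).frame F₅ (by decide)
    (by decide) (by decide)
  have hnm : ∀ k, k ≠ 14 → s₅.nreg k = s₁.nreg k := fun k hk => F₅.nreg k (by simpa using hk)
  have hrr : ∀ k, s₅.rreg k = s₁.rreg k := fun k => F₅.rreg k (by simp)
  have z5 : s₅.rmem 5 = s.rmem 5 := (F₅.rmem 5 (by decide)).trans (f₁.rmem 5 (by decide))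
  have hz : s₅.rmem 5 i = 0 ∧ s₅.rmem 5 (n + n + i) = 0 ∧ s₅.rmem 5 (n + i) = 0 := by
    rw [z5]; exact ⟨h0.1, h0.2.2, h0.2.1⟩
  refine (Run.frame (nr := []) (rr := [14]) (nm := []) (rm := [5])
    (by simp [initAnswers, Program.writes]) (run_initAnswers ((hnm 20 (by decide)).trans h20')
      ((hnm 21 (by decide)).trans h21') ((hnm 22 (by decide)).trans h22') (by omega) (by omega)
      (by omega) ((hrr 11).trans k11) hz)).mono ?_
  rintro t₆ s₆ ⟨⟨ht₆, a₁, a₂, a₃, a₄⟩, f₆⟩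
  rw [hrr, k13, hT₅.pen] at a₁ a₂
  rw [hrr, hrr, k13, k10, hT₅.pen] at a₃
  have H₆ : HeapLE s₅ s₆ := .of_eq (f₆.nreg 14 (by decide)) (f₆.nmem 24 (by decide))
    (f₆.rmem 3 (by decide))
  have hlist : ∀ a, s₆.nmem a = s₅.nmem a := fun a => f₆.nmem a (by simp)
  have e20₂ : s₂.nreg 20 = i := (f₂.nreg 20 (by decide)).trans h20'
  have e20₃ : s₃.nreg 20 = i := (F₃.nreg 20 (by decide)).trans h20'
  have e20₄ : s₄.nreg 20 = i := (F₄.nreg 20 (by decide)).trans h20'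
  rw [h20'] at l₂ o₂
  rw [e20₂] at l₃ o₃
  rw [e20₃] at l₄ o₄
  rw [e20₄] at l₅ o₅
  refine ⟨?_, ?_, H₅'.trans H₆, ⟨?_, ?_, ?_, ?_, ?_⟩, ?_, ?_, ?_, ?_, ?_, ?_, ?_⟩
  · simp only [List.length_cons, List.length_nil] at ht₂ ht₃ ht₄ ht₅
    omega
  · rw [f₆.nreg 20 (by decide), hnm 20 (by decide), h20']
  · rw [hlist, hlist, f₅.nmem 16 (by decide), f₅.nmem 17 (by decide), f₄.nmem 16 (by decide),
      f₄.nmem 17 (by decide), f₃.nmem 16 (by decide), f₃.nmem 17 (by decide)]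
    simpa [IndexedTree.single, k10, h20'] using (((l₂.mono H₃).mono H₄).mono H₅).mono H₆
  · rw [hlist, hlist, f₅.nmem 18 (by decide), f₅.nmem 19 (by decide), f₄.nmem 18 (by decide),
      f₄.nmem 19 (by decide)]
    have := ((l₃.mono H₄).mono H₅).mono H₆
    simpa [IndexedTree.single, k10, k11, h20', h21', h22', f₂.nreg, f₂.rreg] using this
  · rw [hlist, hlist, f₅.nmem 20 (by decide), f₅.nmem 21 (by decide)]
    have := (l₄.mono H₅).mono H₆
    simpa [IndexedTree.single, k12, h20', F₃.nreg, F₃.rreg] using this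
  · rw [hlist, hlist]
    have := l₅.mono H₆
    simpa [IndexedTree.single, k13, h20', F₄.nreg, F₄.rreg] using this
  · rw [f₆.rmem 4 (by decide), F₅.rmem 4 (by decide), m4]; rfl
  · rw [hlist, F₅.nmem 13 (by decide), m13]
  · rw [hlist, F₅.nmem 14 (by decide), m14]
  · intro j hj
    refine ⟨fun a h1 h2 => ?_, ?_⟩
    · rw [hlist]
      have q1 := f₁.nmem
      have q2 := f₂.nmem
      have q3 := f₃.nmem
      have q4 := f₄.nmem
      have q5 := f₅.nmem
      interval_cases a <;>
        simp [q1, q2, q3, q4, q5, o13 j hj, o14 j hj, o₂ j hj, o₃ j hj, o₄ j hj, o₅ j hj]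
    · rw [f₆.rmem 4 (by decide), F₅.rmem 4 (by decide), o4 j hj]
  · exact a₁
  · exact a₂
  · exact a₃
  · intro j j1 j2 j3
    rw [a₄ j j1 j3 j2, z5]

end RealRAM

/-! ### Building the tree of clusters and answering all queries -/

namespace RealRAM

variable {T : IndexedTree} {n : ℕ}

/-- The memory for the tree of clusters is empty. -/
structure Blank (s : State) : Prop where
  nmem : ∀ a, 13 ≤ a → a ≤ 23 → s.nmem a = 0
  len : s.rmem 4 = 0
  acc : s.rmem 5 = 0

/-- Store the clusters of all nodes. -/
def makeSingles : Program := .setN 20 (.const 0) ;; .count 20 (.reg 0) makeSingle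

/-- The state after the clusters of the first `k` nodes have been stored. -/
structure Singles (T : IndexedTree) (n k : ℕ) (s : State) : Prop where
  index : s.nreg 20 = k
  laid : T.Laid n s
  leaf : ∀ j, n ≤ j → (∀ a, 13 ≤ a → a ≤ 23 → s.nmem a j = 0) ∧ s.rmem 4 j = 0
  single : ∀ i < k, StoresCluster s i (T.single n i) ∧ s.nmem 13 i = 1 ∧ s.nmem 14 i = n + n + i
  acc : ∀ i < k, s.rmem 5 i = (if T.rad i < 0 then T.pen i else 0) ∧
    s.rmem 5 (n + n + i) = (if T.rad i < 0 then T.pen i else 0) ∧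
    s.rmem 5 (n + i) = (if T.rad i < T.cost i then T.pen i else 0)
  rest : ∀ i, k ≤ i → i < n → s.rmem 5 i = 0 ∧ s.rmem 5 (n + i) = 0 ∧ s.rmem 5 (n + n + i) = 0

theorem run_makeSingles {s : State} (hT : T.Laid n s) (hs : Blank s) :
    Run makeSingles s fun t s' => t ≤ n * 308 + 6 ∧ Singles T n n s' := by
  refine Run.seq (Run.mono (Run.frame (nr := [20]) (rr := []) (nm := [])
    (rm := []) (by simp [Program.writes]) (Run.straight
      (Q := fun t s' => t ≤ 2 ∧ s'.nreg 20 = 0) 2 rfl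
      (by decide) fun t s' ht hs' => ⟨ht, by simp [hs', Program.eff, NExpr.eval]⟩)) ?_)
  rintro t₁ s₁ ⟨⟨ht₁, h20⟩, f₁⟩
  refine Run.count (Singles T n) n 304 0 (fun k s h => ⟨h.index, h.laid.size⟩) (Nat.zero_le _)
    ⟨h20, hT.frame f₁ (by decide) (by decide) (by decide), ?_, ?_, ?_, ?_⟩ ?_ ?_
  · intro j _
    refine ⟨fun a h1 h2 => ?_, ?_⟩
    · rw [f₁.nmem a (by simp), hs.nmem a h1 h2]; rfl
    · rw [f₁.rmem 4 (by simp), hs.len]; rfl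
  · intro i hi; omega
  · intro i hi; omega
  · intro i _ _
    rw [f₁.rmem 5 (by simp), hs.acc]; exact ⟨rfl, rfl, rfl⟩
  · intro k hk _ s h
    refine Run.seq ((Run.frame (nr := makeSingle.writes.1) (rr := makeSingle.writes.2.1)
      (nm := makeSingle.writes.2.2.1) (rm := makeSingle.writes.2.2.2) (by simp)
      (run_makeSingle h.laid hk h.index (h.rest k le_rfl hk))).mono ?_)
    rintro t s' ⟨⟨ht, e20, hH, hst, h13, h14, hsame, a1, a2, a3, ho⟩, f⟩
    refine Run.straight 4 rfl (by decide) fun t' s'' ht' hs' => ?_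
    simp only [Program.eff, NExpr.eval, e20] at hs'
    have g1 : s''.nreg 20 = k + 1 := by simp [hs']
    have g2 : ∀ r, r ≠ 20 → s''.nreg r = s'.nreg r := fun r hr => by simp [hs', hr]
    have g3 : s''.nmem = s'.nmem := by simp [hs']
    have g4 : s''.rmem = s'.rmem := by simp [hs']
    have hT' : T.Laid n s'' :=
      (h.laid.frame f (by decide) (by decide) (by decide)).congr (g2 0 (by decide))
        (fun a _ => by rw [g3]) (fun a _ => by rw [g4])
    have hH' : HeapLE s' s'' := .of_eq (g2 14 (by decide)) (by rw [g3]) (by rw [g4])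
    have hI : ∀ i, SameAt i s' s'' := fun i => ⟨fun a _ _ => by rw [g3], by rw [g4]⟩
    refine ⟨by omega, g1, hT', ?_, ?_, ?_, ?_⟩
    · intro j hj
      have := hsame j (by omega)
      refine ⟨fun a h1 h2 => ?_, ?_⟩
      · rw [g3, this.1 a h1 h2]; exact (h.leaf j hj).1 a h1 h2
      · rw [g4, this.2]; exact (h.leaf j hj).2
    · intro i hi
      rw [g3]
      rcases Nat.lt_succ_iff_lt_or_eq.1 hi with hi | rfl
      · have hs := hsame i (by omega)
        rw [hs.1 13 (by decide) (by decide), hs.1 14 (by decide) (by decide)]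
        exact ⟨((h.single i hi).1.mono hH hs).mono hH' (hI i), (h.single i hi).2⟩
      · exact ⟨hst.mono hH' (hI _), h13, h14⟩
    · intro i hi
      rw [g4]
      rcases Nat.lt_succ_iff_lt_or_eq.1 hi with hi | rfl
      · rw [ho i (by omega) (by omega) (by omega), ho (n + n + i) (by omega) (by omega) (by omega),
          ho (n + i) (by omega) (by omega) (by omega)]
        exact h.acc i hi
      · exact ⟨a1, a2, a3⟩
    · intro i hi hin
      rw [g4, ho i (by omega) (by omega) (by omega), ho (n + n + i) (by omega) (by omega) (by omega),
          ho (n + i) (by omega) (by omega) (by omega)]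
      exact h.rest i (by omega) hin
  · intro t s' h ht
    exact ⟨by simp only [NExpr.cost] at ht; omega, h⟩

/-- Hang the nodes from their parents, the last node first. -/
def linkNodes : Program :=
  .setN 20 (.const 0) ;; .count 20 (.sub (.reg 0) (.const 1))
    (.setN 21 (.sub (.sub (.reg 0) (.const 1)) (.reg 20)) ;; .setN 22 (.add (.reg 0) (.reg 21)) ;;
      .setN 24 (.mem 11 (.reg 21)) ;; .storeN 13 (.reg 22) (.const 2) ;;
      .storeN 14 (.reg 22) (.reg 21) ;; .storeN 15 (.reg 22) (.mem 14 (.reg 24)) ;;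
      .storeN 14 (.reg 24) (.reg 22))

/-- The state after the last `j` nodes have been hung from their parents. -/
structure Linked (T : IndexedTree) (n j : ℕ) (s : State) : Prop where
  index : s.nreg 20 = j
  laid : T.Laid n s
  single : ∀ i < n, StoresCluster s i (T.single n i) ∧ s.nmem 13 i = 1
  kids : ∀ v, v + j < n → s.nmem 14 v = (T.kids n j v).root ∧ StoresTree s (T.kids n j v)

/-- Shows that linking `w = n - 1 - j` is safe: the entries it overwrites belong to the names
`T.parent w` and `n + w`, which occur in none of the trees built so far. -/
theorem mem_kids_ids {j v i : ℕ} (hj : j < n) (hi : i ∈ (T.kids n j v).ids) :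
    n + n ≤ i ∨ ∃ u, n ≤ u + j ∧ u < n ∧ (i = u ∨ i = n + u) := by
  have := (IndexedTree.kids_ids j v hj).mem_iff.1 hi
  simp only [List.mem_cons, List.mem_flatMap, List.not_mem_nil, or_false] at this
  rcases this with rfl | ⟨u, hu, h⟩
  · exact .inl (by omega)
  · obtain ⟨h1, h2, -⟩ := (IndexedTree.kids_pts j v hj).1 u hu
    rcases h with rfl | rfl | rfl
    · exact .inr ⟨i, h2, h1, .inl rfl⟩
    · exact .inl (by omega)
    · exact .inr ⟨u, h2, h1, .inr rfl⟩

/-- The entry of `v` in the natural array `14` always points to the current tree of its children.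
This is at the same time the child pointer of the unary node `v`, so nothing else has to be done
when `v` itself is linked. -/
theorem run_linkNodes (hn : 0 < n) {s : State} (hs : Singles T n n s) :
    Run linkNodes s fun t s' => t ≤ n * 50 + 10 ∧ StoresTree s' (T.clTree n) := by
  refine Run.seq (Run.mono (Run.frame (nr := [20]) (rr := []) (nm := [])
    (rm := []) (by simp [Program.writes]) (Run.straight
      (Q := fun t s' => t ≤ 2 ∧ s'.nreg 20 = 0) 2 rfl
      (by decide) fun t s' ht hs' => ⟨ht, by simp [hs', Program.eff, NExpr.eval]⟩)) ?_)
  rintro t₁ s₁ ⟨⟨ht₁, h20⟩, f₁⟩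
  have hH₁ : HeapLE s s₁ := .of_eq (f₁.nreg 14 (by decide)) (f₁.nmem 24 (by simp))
    (f₁.rmem 3 (by simp))
  have hI₁ : ∀ i, SameAt i s s₁ :=
    fun i => ⟨fun a _ _ => by rw [f₁.nmem a (by simp)], by rw [f₁.rmem 4 (by simp)]⟩
  refine Run.count (Linked T n) (n - 1) 40 0
    (fun k s h => ⟨h.index, by simp [NExpr.eval, h.laid.size]⟩) (Nat.zero_le _)
    ⟨h20, hs.laid.frame f₁ (by decide) (by decide) (by decide), ?_, ?_⟩ ?_ ?_
  · intro i hi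
    rw [f₁.nmem 13 (by simp)]
    exact ⟨(hs.single i hi).1.mono hH₁ (hI₁ i), (hs.single i hi).2.1⟩
  · intro v hv
    rw [f₁.nmem 14 (by simp)]
    obtain ⟨hl, hl'⟩ := hs.leaf (n + n + v) (by omega)
    refine ⟨(hs.single v hv).2.2, by rw [f₁.nmem 13 (by simp)]; exact hl 13 (by decide) (by decide), ?_⟩
    refine StoresCluster.mono ?_ hH₁ (hI₁ _)
    -- Untouched memory already represents the empty leaf: kind 0, length 0, and all lists with the
    -- bounds 0 and 0.
    have hz : ∀ a, 13 ≤ a → a ≤ 23 → Holds s (s.nmem a (n + n + v)) 0 [] := fun a h1 h2 =>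
      ⟨by rw [hl a h1 h2]; rfl, Nat.zero_le _, trivial⟩
    refine ⟨?_, ?_, ?_, ?_, hl'⟩
    · rw [hl 17 (by decide) (by decide)]; exact hz 16 (by decide) (by decide)
    · rw [hl 19 (by decide) (by decide)]; exact hz 18 (by decide) (by decide)
    · rw [hl 21 (by decide) (by decide)]; exact hz 20 (by decide) (by decide)
    · rw [hl 23 (by decide) (by decide)]; exact hz 22 (by decide) (by decide)
  · intro j hj _ s h
    obtain ⟨w, hw⟩ : ∃ w, j + w + 1 = n := ⟨n - 1 - j, by omega⟩
    have hw' : n - 1 - j = w := by omega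
    have hp := T.parent_lt w (by omega)
    have hpw := h.laid.parent w (by omega)
    refine (Run.frame (nr := [20, 21, 22, 24]) (rr := []) (nm := [13, 14, 15]) (rm := [])
      (by simp [Program.writes])
      (Run.straight (Q := fun t s' => t ≤ 40 ∧ s' = Program.eff _ s) 40 rfl
      (by decide) fun t s' ht hs' => ⟨ht, hs'⟩)).mono ?_
    rintro t s' ⟨⟨ht, hs'⟩, f⟩
    simp only [Program.eff, NExpr.eval, h.laid.size, h.index, hw', hpw, Function.update_self, ne_eq,
      Nat.reduceEqDiff, not_false_eq_true, Function.update_of_ne] at hs'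
    have n1 : T.parent w ≠ n + w := by omega
    have e13 : s'.nmem 13 = Function.update (s.nmem 13) (n + w) 2 := by simp [hs']
    have e14 : s'.nmem 14 = Function.update (Function.update (s.nmem 14) (n + w) w) (T.parent w)
        (n + w) := by simp [hs']
    have e15 : s'.nmem 15 = Function.update (s.nmem 15) (n + w) (s.nmem 14 (T.parent w)) := by
      simp [hs', n1]
    have e20 : s'.nreg 20 = j + 1 := by simp [hs']
    clear hs'
    have hH : HeapLE s s' := .of_eq (f.nreg 14 (by decide)) (f.nmem 24 (by simp)) (f.rmem 3 (by simp))
    have hI : ∀ i, i ≠ T.parent w → i ≠ n + w → SameAt i s s' := by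
      refine fun i h1 h2 => ⟨fun a _ _ => ?_, by rw [f.rmem 4 (by simp)]⟩
      by_cases h3 : a = 13
      · rw [h3, e13, Function.update_of_ne h2]
      by_cases h4 : a = 14
      · rw [h4, e14, Function.update_of_ne h1, Function.update_of_ne h2]
      by_cases h5 : a = 15
      · rw [h5, e15, Function.update_of_ne h2]
      · rw [f.nmem a (by simp [h3, h4, h5])]
    have hids : ∀ v, ∀ i ∈ (T.kids n j v).ids, i ≠ T.parent w ∧ i ≠ n + w := by
      intro v i hi
      rcases mem_kids_ids (by omega) hi with h1 | ⟨u, h1, h2, rfl | rfl⟩ <;> omega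
    have hk : ∀ v, v + j < n → StoresTree s' (T.kids n j v) := fun v hv =>
      (h.kids v hv).2.mono hH fun i hi => hI i (hids v i hi).1 (hids v i hi).2
    have hsingle : ∀ i < n, StoresCluster s' i (T.single n i) ∧ s'.nmem 13 i = 1 := by
      intro i hi
      obtain ⟨h1, h2⟩ := h.single i hi
      refine ⟨⟨?_, ?_, ?_, ?_, ?_⟩, ?_⟩
      · rw [f.nmem 16 (by decide), f.nmem 17 (by decide)]; exact h1.qt.mono hH
      · rw [f.nmem 18 (by decide), f.nmem 19 (by decide)]; exact h1.qb.mono hH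
      · rw [f.nmem 20 (by decide), f.nmem 21 (by decide)]; exact h1.ct.mono hH
      · rw [f.nmem 22 (by decide), f.nmem 23 (by decide)]; exact h1.cb.mono hH
      · rw [f.rmem 4 (by simp)]; exact h1.len
      · rw [e13, Function.update_of_ne (by omega)]; exact h2
    refine ⟨ht, e20, h.laid.frame f (by decide) (by decide) (by decide), hsingle, ?_⟩
    intro v hv
    have hvw : v ≠ n + w := by omega
    rw [IndexedTree.kids, hw']
    by_cases hvp : v = T.parent w
    · subst hvp
      rw [Function.update_self]
      refine ⟨by simp [e14, ClTree.root], by simp [e13], by simp [e14, n1.symm, ClTree.root], ?_, ?_,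
        hk _ (by omega)⟩
      · simp [e15, (h.kids (T.parent w) (by omega)).1]
      · refine ⟨(hsingle w (by omega)).2, ?_, (hsingle w (by omega)).1, hk _ (by omega)⟩
        rw [e14, Function.update_of_ne (by omega), Function.update_of_ne (by omega)]
        exact (h.kids w (by omega)).1
    · rw [Function.update_of_ne hvp, e14, Function.update_of_ne hvp, Function.update_of_ne hvw]
      exact ⟨(h.kids v (by omega)).1, hk v (by omega)⟩
  · intro t s' h ht
    refine ⟨?_, (h.single 0 hn).2, (h.kids 0 (by omega)).1, (h.single 0 hn).1, (h.kids 0 (by omega)).2⟩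
    simp only [NExpr.cost] at ht
    omega

theorem val_self {i : ℕ} (hi : i < n) :
    (T.queries n).val i i = (if T.rad i < 0 then T.pen i else 0) ∧
    (T.queries n).val (n + n + i) i = (if T.rad i < 0 then T.pen i else 0) ∧
    (T.queries n).val (n + i) i = (if T.rad i < T.cost i then T.pen i else 0) := by
  have h1 : ¬ n + n + i < n := by omega
  have h2 : ¬ n + i < n := by omega
  have h3 : T.Below i i := .refl
  have h4 : ¬ n + n + i < n + n := by omega
  have h5 : n + n ≤ n + n + i := by omega
  have h6 : n + i < n + n := by omega
  refine ⟨?_, ?_, ?_⟩ <;>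
    simp [QuerySystem.val, IndexedTree.queries, hi, h1, h2, h3, h4, h5, h6, IndexedTree.dist_self,
      IndexedTree.dist_parent]

/-- Answer all queries. -/
def answerQueries : Program := makeSingles ;; linkNodes ;; contractTree

theorem run_answerQueries (hn : 0 < n) {m : ℕ} (hm : 3 * n ≤ 2 ^ m) {s : State} (hT : T.Laid n s)
    (hs : Blank s) : Run answerQueries s fun t s' =>
      t ≤ n * 358 + 6 * m * (7000 * n + 40) + 26 ∧
      ∀ i < n, ∀ q ∈ [i, n + n + i, n + i],
        s'.rmem 5 q = ∑ u ∈ Finset.range n, (T.queries n).val q u := by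
  refine Run.seq ((run_makeSingles hT hs).mono ?_)
  rintro t₁ s₁ ⟨ht₁, h₁⟩
  refine Run.seq ((Run.frame (nr := linkNodes.writes.1) (rr := linkNodes.writes.2.1)
      (nm := linkNodes.writes.2.2.1) (rm := linkNodes.writes.2.2.2) (by simp)
      (run_linkNodes hn h₁)).mono ?_)
  rintro t₂ s₂ ⟨⟨ht₂, h₂⟩, f₂⟩
  obtain ⟨hw, hc⟩ := IndexedTree.clTree_weight (T := T) hn
  refine (run_contractTree (S := T.queries n) (7 * n) m (T.clTree n) s₂ (by omega) hw rfl h₂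
    ⟨0, IndexedTree.clTree_valid hn⟩ (IndexedTree.answered_clTree hn fun i hi q hq => ?_)
    (IndexedTree.clTree_ids_nodup hn) (IndexedTree.clTree_aq_nodup hn)
    (h₁.laid.frame f₂ (by decide) (by decide) (by decide)).pen).mono ?_
  · obtain ⟨a1, a2, a3⟩ := h₁.acc i hi
    obtain ⟨v1, v2, v3⟩ := val_self (T := T) hi
    rw [f₂.rmem 5 (by decide)]
    simp only [List.mem_cons, List.not_mem_nil, or_false] at hq
    rcases hq with rfl | rfl | rfl
    · rw [a1, v1]
    · rw [a2, v2]
    · rw [a3, v3]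
  · rintro t₃ s₃ ⟨ht₃, h₃⟩
    refine ⟨?_, fun i hi q hq => ?_⟩
    · rw [show 1000 * (7 * n) = 7000 * n by ring] at ht₃
      omega
    · have hp := IndexedTree.clTree_pts (T := T) hn
      rw [h₃ q ?_, (hp.map _).sum_eq, Finset.sum, Finset.range_val, Multiset.range,
        Multiset.map_coe, Multiset.sum_coe]
      rw [IndexedTree.clTree_aq hn, List.mem_flatMap]
      exact ⟨i, hp.mem_iff.2 (by simpa using hi), hq⟩

end RealRAM

/-! ## Optimal subtrees of indexed trees -/

namespace IndexedTree

variable (T : IndexedTree) {n : ℕ}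

/-- `S` is the node set of a subtree with the root `v`. -/
structure IsSub (n : ℕ) (S : Finset ℕ) (v : ℕ) : Prop where
  root_mem : v ∈ S
  lt_size : ∀ i ∈ S, i < n
  closed : ∀ i ∈ S, i ≠ v → v < i ∧ T.parent i ∈ S

open Classical in
/-- The penalties of the nodes that `S` does not cover. -/
noncomputable def penaltySum (n : ℕ) (S : Finset ℕ) : ℝ :=
  ∑ u ∈ Finset.range n, if ∀ y ∈ S, T.rad u < T.dist u y then T.pen u else 0

/-- The cost of the subtree with the node set `S` and the root `v`. -/
noncomputable def subCost (n : ℕ) (S : Finset ℕ) (v : ℕ) : ℝ :=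
  ∑ i ∈ S.erase v, T.cost i + T.penaltySum n S

/-- The answer to the query `q`. -/
noncomputable def answer (n q : ℕ) : ℝ := ∑ u ∈ Finset.range n, (T.queries n).val q u

/-- The change of the cost when the node `i` is added to a subtree. -/
noncomputable def delta (n i : ℕ) : ℝ := T.cost i + T.answer n (n + n + i) - T.answer n (n + i)

/-- The least change of the cost of the subtree `{v}` that can be achieved by adding nodes
below `v`. -/
noncomputable def gain (n v : ℕ) : ℝ :=
  ∑ w ∈ ((Finset.Ioo v n).filter fun w => T.parent w = v).attach,
    min (T.delta n w.1 + gain n w.1) 0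
termination_by n - v
decreasing_by
  have := w.2
  simp only [Finset.mem_filter, Finset.mem_Ioo] at this
  omega

/-- The least change of the cost by adding the node `i` and nodes below it. -/
noncomputable def branch (n i : ℕ) : ℝ := T.delta n i + T.gain n i

variable {T}

/-- Writing the recursion as a sum over a fixed range with an indicator allows to interchange it
with sums over `v`. The condition `v < w` is automatic for children. -/
theorem gain_eq (v : ℕ) : T.gain n v =
    ∑ w ∈ Finset.range n, if 0 < w ∧ T.parent w = v then min (T.branch n w) 0 else 0 := by
  rw [gain, Finset.sum_attach _ fun w => min (T.delta n w + T.gain n w) 0, ← Finset.sum_filter]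
  refine Finset.sum_congr ?_ fun _ _ => rfl
  ext w
  simp only [Finset.mem_filter, Finset.mem_Ioo, Finset.mem_range]
  constructor
  · rintro ⟨⟨h1, h2⟩, h3⟩
    exact ⟨h2, by omega, h3⟩
  · rintro ⟨h1, h2, h3⟩
    exact ⟨⟨h3 ▸ T.parent_lt w h2, h1⟩, h3⟩

theorem dist_nonneg (i j : ℕ) : 0 ≤ T.dist i j := by
  induction hn : i + j using Nat.strong_induction_on generalizing i j with
  | _ n ih =>
    rcases lt_trichotomy i j with h | rfl | h
    · have := T.parent_lt j (by omega)
      rw [dist_of_gt h]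
      exact add_nonneg (T.cost_nonneg j) (ih _ (by omega) _ _ rfl)
    · rw [dist_self]
    · have := T.parent_lt i (by omega)
      rw [dist_of_lt h]
      exact add_nonneg (T.cost_nonneg i) (ih _ (by omega) _ _ rfl)

theorem answer_node {v : ℕ} (hv : v < n) : T.answer n v = T.penaltySum n {v} := by
  simp [answer, penaltySum, QuerySystem.val, queries, hv]

open Classical in
theorem answer_parent {w : ℕ} (hw : w < n) : T.answer n (n + w) =
    ∑ u ∈ Finset.range n, if T.Below w u ∧ T.rad u < T.dist u (T.parent w) then T.pen u else 0 := by
  have h1 : ¬ n + w < n := by omega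
  have h2 : ¬ n ≤ w := by omega
  simp [answer, QuerySystem.val, queries, h1, h2, hw]

open Classical in
theorem answer_top {w : ℕ} : T.answer n (n + n + w) =
    ∑ u ∈ Finset.range n, if T.Below w u ∧ T.rad u < T.dist u w then T.pen u else 0 := by
  have h1 : ¬ n + n + w < n := by omega
  have h2 : ¬ n + n + w < n + n := by omega
  simp [answer, QuerySystem.val, queries, h1, h2]

theorem IsSub.le {S : Finset ℕ} {v i : ℕ} (h : T.IsSub n S v) (hi : i ∈ S) : v ≤ i := by
  rcases eq_or_ne i v with rfl | hne
  · exact le_rfl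
  · exact (h.closed i hi hne).1.le

/-- A new last node of a subtree decides about the nodes below it, and about no others. -/
theorem penaltySum_insert {S : Finset ℕ} {m : ℕ} (hm : 0 < m) (hmn : m < n)
    (hp : T.parent m ∈ S) (hS : ∀ y ∈ S, y < m) :
    T.penaltySum n (insert m S) =
      T.penaltySum n S + T.answer n (n + n + m) - T.answer n (n + m) := by
  rw [answer_parent hmn, answer_top, penaltySum, penaltySum, ← Finset.sum_add_distrib,
    ← Finset.sum_sub_distrib]
  refine Finset.sum_congr rfl fun u _ => ?_
  by_cases hb : T.Below m u
  · have key : ∀ y ∈ S, T.dist u (T.parent m) ≤ T.dist u y := fun y hy => by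
      rw [dist_of_below hm hb fun h => (hS y hy).not_ge h.le]
      exact le_add_of_nonneg_right (dist_nonneg _ _)
    have key' : T.dist u m ≤ T.dist u (T.parent m) := by
      rw [dist_comm u (T.parent m), dist_parent_of_below hm hb, dist_comm u m]
      exact le_add_of_nonneg_left (T.cost_nonneg m)
    have e1 : (∀ y ∈ insert m S, T.rad u < T.dist u y) ↔ T.rad u < T.dist u m :=
      ⟨fun h => h m (Finset.mem_insert_self _ _), fun h y hy => by
        rcases Finset.mem_insert.1 hy with rfl | hy
        · exact h
        · exact h.trans_le (key'.trans (key y hy))⟩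
    have e2 : (∀ y ∈ S, T.rad u < T.dist u y) ↔ T.rad u < T.dist u (T.parent m) :=
      ⟨fun h => h _ hp, fun h y hy => h.trans_le (key y hy)⟩
    simp only [e1, e2, hb, true_and]
    ring
  -- From outside the subtree of `m`, the node `m` is no nearer than its parent, which is in `S`
  -- already.
  · have e : (∀ y ∈ insert m S, T.rad u < T.dist u y) ↔ ∀ y ∈ S, T.rad u < T.dist u y := by
      refine ⟨fun h y hy => h y (Finset.mem_insert_of_mem hy), fun h y hy => ?_⟩
      rcases Finset.mem_insert.1 hy with rfl | hy
      · refine (h _ hp).trans_le ?_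
        rw [dist_comm u y, dist_of_below hm .refl hb, dist_comm _ u]
        exact le_add_of_nonneg_left (dist_nonneg _ _)
      · exact h y hy
    simp only [e, hb, false_and, if_false, add_zero, sub_zero]

/-- The greatest node of `S` is a leaf of the subtree, because parents are smaller. Removing it
changes the cost by its `delta` according to `penaltySum_insert`. -/
theorem IsSub.subCost_eq {S : Finset ℕ} {v : ℕ} (h : T.IsSub n S v) :
    T.subCost n S v = T.answer n v + ∑ i ∈ S.erase v, T.delta n i := by
  induction hc : S.card using Nat.strong_induction_on generalizing S with
  | _ c ih =>
    set m := S.max' ⟨v, h.root_mem⟩ with hm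
    have hmS : m ∈ S := S.max'_mem _
    rcases eq_or_ne m v with hmv | hmv
    · have hS : S = {v} := by
        refine Finset.eq_singleton_iff_unique_mem.2 ⟨h.root_mem, fun i hi => ?_⟩
        exact le_antisymm (hmv ▸ S.le_max' i hi) (h.le hi)
      subst hS
      simp [subCost, answer_node (h.lt_size v (by simp))]
    · obtain ⟨hvm, hp⟩ := h.closed m hmS hmv
      have hpm := T.parent_lt m (by omega)
      have hlt : ∀ y ∈ S.erase m, y < m := fun y hy =>
        lt_of_le_of_ne (S.le_max' y (Finset.mem_of_mem_erase hy)) (Finset.ne_of_mem_erase hy)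
      have hsub : T.IsSub n (S.erase m) v := by
        refine ⟨Finset.mem_erase.2 ⟨hmv.symm, h.root_mem⟩,
          fun i hi => h.lt_size i (Finset.mem_of_mem_erase hi), fun i hi hiv => ?_⟩
        obtain ⟨h1, h2⟩ := h.closed i (Finset.mem_of_mem_erase hi) hiv
        have := hlt i hi
        have := T.parent_lt i (by omega)
        exact ⟨h1, Finset.mem_erase.2 ⟨by omega, h2⟩⟩
      have h1 := ih _ (hc ▸ Finset.card_erase_lt_of_mem hmS) hsub rfl
      have hp' : T.parent m ∈ S.erase m := Finset.mem_erase.2 ⟨hpm.ne, hp⟩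
      have h2 := penaltySum_insert (by omega) (h.lt_size m hmS) hp' hlt
      rw [Finset.insert_erase hmS] at h2
      have hmv' : m ∈ S.erase v := Finset.mem_erase.2 ⟨hmv, hmS⟩
      rw [subCost, h2, ← Finset.add_sum_erase _ _ hmv', ← Finset.add_sum_erase _ _ hmv',
        Finset.erase_right_comm]
      rw [subCost] at h1
      have hd : T.delta n m = T.cost m + T.answer n (n + n + m) - T.answer n (n + m) := rfl
      linarith

/-- Summing `gain` over `S` counts `min (branch w) 0` once for each `w` whose parent is in `S`; such
`w` either lie in `S` or just outside. Substituting `branch = delta + gain` leaves the gain of the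
root and two corrections: for nodes that were taken though not profitable, and for profitable nodes
that were left out. -/
theorem IsSub.sum_delta {S : Finset ℕ} {v : ℕ} (h : T.IsSub n S v) :
    ∑ i ∈ S.erase v, T.delta n i = T.gain n v +
      ∑ i ∈ S.erase v, (T.branch n i - min (T.branch n i) 0) -
      ∑ w ∈ Finset.range n, if 0 < w ∧ w ∉ S ∧ T.parent w ∈ S then min (T.branch n w) 0 else 0 := by
  have e1 : ∑ i ∈ S, T.gain n i =
      ∑ w ∈ Finset.range n, if 0 < w ∧ T.parent w ∈ S then min (T.branch n w) 0 else 0 := by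
    simp_rw [gain_eq]
    rw [Finset.sum_comm]
    refine Finset.sum_congr rfl fun w _ => ?_
    by_cases hw : 0 < w
    · simp [hw]
    · simp [hw]
  have e2 : (∑ w ∈ Finset.range n, if 0 < w ∧ T.parent w ∈ S then min (T.branch n w) 0 else 0) =
      ∑ i ∈ S.erase v, min (T.branch n i) 0 +
      ∑ w ∈ Finset.range n, if 0 < w ∧ w ∉ S ∧ T.parent w ∈ S then min (T.branch n w) 0 else 0 := by
    have hsub : S.erase v ⊆ Finset.range n := fun i hi =>
      Finset.mem_range.2 (h.lt_size i (Finset.mem_of_mem_erase hi))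
    rw [← Finset.inter_eq_right.2 hsub, ← Finset.sum_ite_mem, ← Finset.sum_add_distrib]
    refine Finset.sum_congr rfl fun w _ => ?_
    by_cases hw : w ∈ S.erase v
    · obtain ⟨hwv, hwS⟩ := Finset.mem_erase.1 hw
      obtain ⟨h1, h2⟩ := h.closed w hwS hwv
      have : 0 < w := by omega
      simp [hw, hwS, h2, this]
    · by_cases hwv : w = v
      -- The root `v` contributes to neither side, since its parent is smaller than all elements of
      -- `S`.
      · have : ¬ (0 < v ∧ T.parent v ∈ S) := fun ⟨h1, h2⟩ =>
          absurd (h.le h2) (T.parent_lt v h1).not_ge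
        have this' : ¬ (0 < v ∧ v ∉ S ∧ T.parent v ∈ S) := fun h' => this ⟨h'.1, h'.2.2⟩
        rw [hwv] at hw ⊢
        rw [if_neg this, if_neg hw, if_neg this', add_zero]
      · have hwS : w ∉ S := fun h' => hw (Finset.mem_erase.2 ⟨hwv, h'⟩)
        simp [hw, hwS]
  rw [← Finset.add_sum_erase _ _ h.root_mem] at e1
  have e3 : ∑ i ∈ S.erase v, T.branch n i =
      ∑ i ∈ S.erase v, T.delta n i + ∑ i ∈ S.erase v, T.gain n i := by
    rw [← Finset.sum_add_distrib]; rfl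
  rw [Finset.sum_sub_distrib]
  linarith

/-- Both corrections in `IsSub.sum_delta` increase the cost. -/
theorem IsSub.le_subCost {S : Finset ℕ} {v : ℕ} (h : T.IsSub n S v) :
    T.answer n v + T.gain n v ≤ T.subCost n S v := by
  rw [h.subCost_eq, h.sum_delta]
  have h1 : 0 ≤ ∑ i ∈ S.erase v, (T.branch n i - min (T.branch n i) 0) :=
    Finset.sum_nonneg fun i _ => sub_nonneg.2 (min_le_left _ _)
  have h2 : (∑ w ∈ Finset.range n,
      if 0 < w ∧ w ∉ S ∧ T.parent w ∈ S then min (T.branch n w) 0 else 0) ≤ 0 :=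
    Finset.sum_nonpos fun w _ => by split_ifs <;> simp
  linarith

/-- The subtree of `v` that the profitable nodes form. -/
theorem subCost_of_mem_iff {S : Finset ℕ} {v : ℕ} (hv : v < n) (hS : ∀ i, i ∈ S ↔ i < n ∧
    (i = v ∨ (0 < i ∧ T.parent i ∈ S ∧ T.branch n i < 0))) :
    T.IsSub n S v ∧ T.subCost n S v = T.answer n v + T.gain n v := by
  have hle : ∀ i, i ∈ S → v ≤ i := by
    intro i
    induction i using Nat.strong_induction_on with
    | _ i ih =>
      intro hi
      rcases ((hS i).1 hi).2 with rfl | ⟨h1, h2, -⟩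
      · exact le_rfl
      · exact (ih _ (T.parent_lt i h1) h2).trans (T.parent_lt i h1).le
  have h : T.IsSub n S v := by
    refine ⟨(hS v).2 ⟨hv, .inl rfl⟩, fun i hi => ((hS i).1 hi).1, fun i hi hiv => ?_⟩
    rcases ((hS i).1 hi).2 with rfl | ⟨h1, h2, -⟩
    · exact absurd rfl hiv
    · exact ⟨(hle _ h2).trans_lt (T.parent_lt i h1), h2⟩
  refine ⟨h, ?_⟩
  -- Both corrections vanish: the nodes taken have a negative branch, and a child of a taken node
  -- that was left out has not.
  rw [h.subCost_eq, h.sum_delta, Finset.sum_eq_zero, Finset.sum_eq_zero]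
  · ring
  · intro w hw
    split_ifs with hc
    · obtain ⟨h1, h2, h3⟩ := hc
      refine min_eq_right (not_lt.1 fun hb => h2 ((hS w).2 ⟨Finset.mem_range.1 hw, .inr ⟨h1, h3, hb⟩⟩))
    · rfl
  · intro i hi
    obtain ⟨h1, h2⟩ := Finset.mem_erase.1 hi
    rcases ((hS i).1 h2).2 with rfl | ⟨-, -, h3⟩
    · exact absurd rfl h1
    · rw [min_eq_left h3.le, sub_self]

theorem isSub_singleton {v : ℕ} (hv : v < n) : T.IsSub n {v} v :=
  ⟨by simp, by simpa using hv, by simp⟩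

theorem subCost_singleton {v : ℕ} (hv : v < n) : T.subCost n {v} v = T.answer n v := by
  simp [(isSub_singleton hv).subCost_eq]

end IndexedTree

/-! ## Finding an optimal subtree -/

namespace RealRAM

variable {T : IndexedTree} {n : ℕ}

/-- The answers to all queries are in the real array `5`. -/
def AllAnswered (T : IndexedTree) (n : ℕ) (s : State) : Prop :=
  ∀ i < n, s.rmem 5 i = T.answer n i ∧ s.rmem 5 (n + n + i) = T.answer n (n + n + i) ∧
    s.rmem 5 (n + i) = T.answer n (n + i)

/-- Compute the least possible changes of the cost, and mark the profitable nodes. -/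
def computeGains : Program :=
  .setN 20 (.const 0) ;; .count 20 (.sub (.reg 0) (.const 1))
    (.setN 21 (.sub (.sub (.reg 0) (.const 1)) (.reg 20)) ;; .setN 22 (.mem 11 (.reg 21)) ;;
      .setR 10 (.add (.sub (.add (.mem 0 (.mem 12 (.reg 21)))
        (.mem 5 (.add (.add (.reg 0) (.reg 0)) (.reg 21)))) (.mem 5 (.add (.reg 0) (.reg 21))))
        (.mem 6 (.reg 21))) ;;
      .ite (.rle (.const 0) (.reg 10)) .skip
        (.storeR 6 (.reg 22) (.add (.mem 6 (.reg 22)) (.reg 10)) ;; .storeN 26 (.reg 21) (.const 1)))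

open Classical in
/-- The state after the last `j` nodes have been treated. -/
structure Gained (T : IndexedTree) (n j : ℕ) (s : State) : Prop where
  index : s.nreg 20 = j
  laid : T.Laid n s
  answered : AllAnswered T n s
  gain : ∀ v, s.rmem 6 v = ∑ w ∈ Finset.range n,
    if (0 < w ∧ T.parent w = v) ∧ n ≤ w + j then min (T.branch n w) 0 else 0
  take : ∀ i, s.nmem 26 i = if i < n ∧ n ≤ i + j ∧ T.branch n i < 0 then 1 else 0

-- Nodes are treated in decreasing order, so all children of `w` have added their share before `w`
-- is treated. The root needs no treatment, hence `n - 1` iterations.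
open Classical in
theorem run_computeGains (hn : 0 < n) {s : State} (hT : T.Laid n s) (ha : AllAnswered T n s)
    (h6 : s.rmem 6 = 0) (h26 : s.nmem 26 = 0) :
    Run computeGains s fun t s' => t ≤ n * 70 + 10 ∧ (∀ v, s'.rmem 6 v = T.gain n v) ∧
      ∀ i, 0 < i → i < n → s'.nmem 26 i = if T.branch n i < 0 then 1 else 0 := by
  refine Run.seq (Run.mono (Run.frame (nr := [20]) (rr := []) (nm := [])
    (rm := []) (by simp [Program.writes]) (Run.straight
      (Q := fun t s' => t ≤ 2 ∧ s'.nreg 20 = 0) 2 rfl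
      (by decide) fun t s' ht hs' => ⟨ht, by simp [hs', Program.eff, NExpr.eval]⟩)) ?_)
  rintro t₁ s₁ ⟨⟨ht₁, h20⟩, f₁⟩
  refine Run.count (Gained T n) (n - 1) 60 0
    (fun k s h => ⟨h.index, by simp [NExpr.eval, h.laid.size]⟩) (Nat.zero_le _)
    ⟨h20, hT.frame f₁ (by decide) (by decide) (by decide), ?_, ?_, ?_⟩ ?_ ?_
  · rw [AllAnswered, f₁.rmem 5 (by simp)]; exact ha
  · intro v
    rw [f₁.rmem 6 (by simp), h6, Finset.sum_eq_zero]
    · rfl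
    · intro w hw
      have := Finset.mem_range.1 hw
      rw [if_neg (by omega)]
  · intro i
    rw [f₁.nmem 26 (by simp), h26, if_neg (by omega)]
    rfl
  · intro j hj _ s h
    obtain ⟨w, hw⟩ : ∃ w, j + w + 1 = n := ⟨n - 1 - j, by omega⟩
    have hw' : n - 1 - j = w := by omega
    have hw0 : 0 < w := by omega
    have hwn : w < n := by omega
    -- The children of `w` are larger than `w` and have therefore all been treated.
    have hg : s.rmem 6 w = T.gain n w := by
      rw [h.gain, IndexedTree.gain_eq]
      refine Finset.sum_congr rfl fun i hi => ?_
      refine if_congr ⟨fun h => h.1, fun h => ⟨h, ?_⟩⟩ rfl rfl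
      have := T.parent_lt i h.1
      omega
    obtain ⟨-, a2, a3⟩ := h.answered w hwn
    have hx : T.cost w + T.answer n (n + n + w) - T.answer n (n + w) + T.gain n w = T.branch n w :=
      rfl
    have hsum : ∀ v, (∑ i ∈ Finset.range n,
        if (0 < i ∧ T.parent i = v) ∧ n ≤ i + (j + 1) then min (T.branch n i) 0 else 0) =
        (∑ i ∈ Finset.range n,
          if (0 < i ∧ T.parent i = v) ∧ n ≤ i + j then min (T.branch n i) 0 else 0) +
        if T.parent w = v then min (T.branch n w) 0 else 0 := by
      intro v
      have : (if T.parent w = v then min (T.branch n w) 0 else 0) =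
          ∑ i ∈ Finset.range n, if w = i then (if T.parent w = v then min (T.branch n w) 0 else 0)
            else 0 := by
        rw [Finset.sum_ite_eq, if_pos (Finset.mem_range.2 hwn)]
      rw [this, ← Finset.sum_add_distrib]
      refine Finset.sum_congr rfl fun i hi => ?_
      by_cases hiw : w = i
      · subst hiw
        have e1 : n ≤ w + (j + 1) := by omega
        have e2 : ¬ n ≤ w + j := by omega
        simp [e1, e2, hw0]
      · have : n ≤ i + (j + 1) ↔ n ≤ i + j := by omega
        simp [this, hiw]
    have htake : ∀ i, (i < n ∧ n ≤ i + (j + 1) ∧ T.branch n i < 0) ↔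
        (i < n ∧ n ≤ i + j ∧ T.branch n i < 0) ∨ (i = w ∧ T.branch n w < 0) := by
      intro i
      constructor
      · rintro ⟨h1, h2, h3⟩
        by_cases hi : i = w
        · exact .inr ⟨hi, hi ▸ h3⟩
        · exact .inl ⟨h1, by omega, h3⟩
      · rintro (⟨h1, h2, h3⟩ | ⟨rfl, h3⟩)
        · exact ⟨h1, by omega, h3⟩
        · exact ⟨hwn, by omega, h3⟩
    refine (Run.frame (nr := [20, 21, 22]) (rr := [10]) (nm := [26]) (rm := [6])
      (by simp [Program.writes])
      (Run.straight (Q := fun t s' => t ≤ 60 ∧ s' = Program.eff _ s) 60 rfl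
      (by decide) fun t s' ht hs' => ⟨ht, hs'⟩)).mono ?_
    rintro t s' ⟨⟨ht, hs'⟩, f⟩
    have hpw := h.laid.parent w hwn
    have hcw := h.laid.cost w hwn
    have hans : AllAnswered T n s' := by
      rw [AllAnswered, f.rmem 5 (by simp)]; exact h.answered
    have hlaid := h.laid.frame f (by decide) (by decide) (by decide)
    by_cases hb : 0 ≤ T.branch n w
    · simp [Program.eff, Test.eval, NExpr.eval, RExpr.eval, h.laid.size, h.index, hw', hpw, hcw, a2,
        a3, hg, hx, hb] at hs'
      refine ⟨ht, by simp [hs'], hlaid, hans, fun v => ?_, fun i => ?_⟩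
      · rw [hsum, min_eq_right hb, ite_self, add_zero, ← h.gain v]
        simp [hs']
      · have : s'.nmem 26 i = s.nmem 26 i := by simp [hs']
        rw [this, h.take]
        refine if_congr ?_ rfl rfl
        rw [htake]
        simp [hb.not_gt]
    · simp [Program.eff, Test.eval, NExpr.eval, RExpr.eval, h.laid.size, h.index, hw', hpw, hcw, a2,
        a3, hg, hx, hb] at hs'
      refine ⟨ht, by simp [hs'], hlaid, hans, fun v => ?_, fun i => ?_⟩
      · rw [hsum, min_eq_left (not_le.1 hb).le, ← h.gain v]
        by_cases hv : T.parent w = v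
        · simp [hs', hv]
        · simp [hs', hv, Ne.symm hv]
      · rw [if_congr (htake i) rfl rfl]
        by_cases hi : i = w
        · simp [hs', hi, not_le.1 hb]
        · simp [hs', hi, h.take]
  · intro t s' h ht
    refine ⟨by simp only [NExpr.cost] at ht; omega, fun v => ?_, fun i h1 h2 => ?_⟩
    · rw [h.gain, IndexedTree.gain_eq]
      refine Finset.sum_congr rfl fun i hi => ?_
      exact if_congr ⟨fun h => h.1, fun h => ⟨h, by omega⟩⟩ rfl rfl
    · rw [h.take]
      exact if_congr ⟨fun h => h.2.2, fun h => ⟨h2, by omega, h⟩⟩ rfl rfl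

/-- Find an index below the number in register `0` with the least sum of entries of the real arrays
`5` and `6`. -/
def findBest : Program :=
  (.setN 20 (.const 0) ;; .setN 21 (.const 0) ;;
    .setR 0 (.add (.mem 5 (.reg 20)) (.mem 6 (.reg 20)))) ;;
  .count 20 (.reg 0) (.setR 11 (.add (.mem 5 (.reg 20)) (.mem 6 (.reg 20))) ;;
    .ite (.rle (.reg 0) (.reg 11)) .skip (.setR 0 (.reg 11) ;; .setN 21 (.reg 20)))

theorem run_findBest (hn : 0 < n) {s : State} (h0 : s.nreg 0 = n) :
    Run findBest s fun t s' => t ≤ n * 40 + 20 ∧ s'.nreg 21 < n ∧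
      s'.rreg 0 = s.rmem 5 (s'.nreg 21) + s.rmem 6 (s'.nreg 21) ∧
      ∀ i < n, s'.rreg 0 ≤ s.rmem 5 i + s.rmem 6 i := by
  refine Run.seq (Run.straight 11 rfl (by decide) fun t₁ s₁ ht₁ hs₁ => ?_)
  simp only [Program.eff, NExpr.eval, RExpr.eval] at hs₁
  refine Run.count (fun k s' => s'.nreg 20 = k ∧ s'.nreg 0 = n ∧ s'.rmem = s.rmem ∧
    s'.nreg 21 < n ∧ s'.rreg 0 = s.rmem 5 (s'.nreg 21) + s.rmem 6 (s'.nreg 21) ∧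
      ∀ i < k, s'.rreg 0 ≤ s.rmem 5 i + s.rmem 6 i) n 25 0 (fun k s h => ⟨h.1, h.2.1⟩)
    (Nat.zero_le _) (by simp [hs₁, h0, hn]) ?_ ?_
  · rintro k hk - s₂ ⟨e1, e2, e3, e4, e5, e6⟩
    refine Run.straight 25 rfl (by decide) fun t s' ht hs' => ⟨ht, ?_⟩
    by_cases hc : s₂.rreg 0 ≤ s.rmem 5 k + s.rmem 6 k
    · simp [Program.eff, Test.eval, NExpr.eval, RExpr.eval, e1, e3, hc] at hs'
      refine ⟨by simp [hs'], by simp [hs', e2], by simp [hs'], by simp [hs', e4],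
        by simp [hs', e5], fun i hi => ?_⟩
      have : s'.rreg 0 = s₂.rreg 0 := by simp [hs']
      rw [this]
      rcases Nat.lt_succ_iff_lt_or_eq.1 hi with hi | rfl
      exacts [e6 i hi, hc]
    · simp [Program.eff, Test.eval, NExpr.eval, RExpr.eval, e1, e3, hc] at hs'
      refine ⟨by simp [hs'], by simp [hs', e2], by simp [hs'], by simp [hs', hk],
        by simp [hs'], fun i hi => ?_⟩
      have : s'.rreg 0 = s.rmem 5 k + s.rmem 6 k := by simp [hs']
      rw [this]
      rcases Nat.lt_succ_iff_lt_or_eq.1 hi with hi | rfl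
      exacts [(not_le.1 hc).le.trans (e6 i hi), le_rfl]
  · rintro t s' ⟨-, -, -, h1, h2, h3⟩ ht
    exact ⟨by simp only [NExpr.cost] at ht; omega, h1, h2, h3⟩

/-- Mark the nodes and the edges of the subtree of profitable nodes below the node in register
`21`. -/
def markSubtree : Program :=
  (.storeN 2 (.mem 10 (.reg 21)) (.const 1) ;; .setN 20 (.const 1)) ;;
  .count 20 (.reg 0) (.ite (.and (.nle (.const 1) (.mem 2 (.mem 10 (.mem 11 (.reg 20)))))
      (.nle (.const 1) (.mem 26 (.reg 20))))
    (.storeN 2 (.mem 10 (.reg 20)) (.const 1) ;; .storeN 3 (.mem 12 (.reg 20)) (.const 1)) .skip)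

open Classical in
/-- The state after the first `k` nodes have been treated. -/
structure Marked (T : IndexedTree) (n v k : ℕ) (o e : ℕ → ℕ) (s : State) : Prop where
  index : s.nreg 20 = k
  laid : T.Laid n s
  nodes : s.nmem 10 = o
  edges : s.nmem 12 = e
  take : ∀ i, 0 < i → i < n → s.nmem 26 i = if T.branch n i < 0 then 1 else 0
  old : ∀ i < n, i < k → s.nmem 2 (o i) =
    if i = v ∨ (0 < i ∧ s.nmem 2 (o (T.parent i)) = 1 ∧ T.branch n i < 0) then 1 else 0
  new : ∀ i < n, k ≤ i → s.nmem 2 (o i) = if i = v then 1 else 0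
  below : ∀ i < n, s.nmem 2 (o i) = 1 → v ≤ i
  edge : ∀ i < n, 0 < i → s.nmem 3 (e i) = if i < k ∧ s.nmem 2 (o i) = 1 ∧ i ≠ v then 1 else 0

-- Going through the nodes in increasing order, the mark of a parent is final when its child is
-- examined. Only `v` is marked without a marked parent, so the marks spread exactly over the
-- profitable nodes that are connected to `v` from above. The maps `o` and `e` must be injective in
-- order that marks of different nodes or edges do not interfere. The loop starts with 1 because
-- node 0 has no edge to a parent.
open Classical in
theorem run_markSubtree {v : ℕ} {o e : ℕ → ℕ} (hv : v < n)
    (ho : ∀ i < n, ∀ j < n, o i = o j → i = j)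
    (he : ∀ i < n, ∀ j < n, 0 < i → 0 < j → e i = e j → i = j) {s : State} (hT : T.Laid n s)
    (h21 : s.nreg 21 = v) (h10 : s.nmem 10 = o) (h12 : s.nmem 12 = e)
    (h26 : ∀ i, 0 < i → i < n → s.nmem 26 i = if T.branch n i < 0 then 1 else 0)
    (h2 : s.nmem 2 = 0) (h3 : s.nmem 3 = 0) :
    Run markSubtree s fun t s' => t ≤ n * 50 + 20 ∧ ∃ S : Finset ℕ,
      T.IsSub n S v ∧ T.subCost n S v = T.answer n v + T.gain n v ∧
      (∀ i < n, s'.nmem 2 (o i) = if i ∈ S then 1 else 0) ∧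
      ∀ i < n, 0 < i → s'.nmem 3 (e i) = if i ∈ S.erase v then 1 else 0 := by
  refine Run.seq (Run.mono (Run.frame (nr := [20]) (rr := []) (nm := [2])
    (rm := []) (by simp [Program.writes]) (Run.straight
      (Q := fun t s' => t ≤ 10 ∧ s' = Program.eff _ s) 10 rfl
      (by decide) fun t s' ht hs' => ⟨ht, hs'⟩)) ?_)
  rintro t₁ s₁ ⟨⟨ht₁, hs₁⟩, f₁⟩
  simp only [Program.eff, NExpr.eval, h21, h10, h2] at hs₁
  have hmem : ∀ i < n, s₁.nmem 2 (o i) = if i = v then 1 else 0 := by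
    intro i hi
    by_cases hiv : i = v
    · simp [hs₁, hiv]
    · have : o i ≠ o v := fun h => hiv (ho i hi v hv h)
      simp [hs₁, hiv, this]
  refine Run.count (fun k s => Marked T n v k o e s) n 40 1 (fun k s h => ⟨h.index, h.laid.size⟩)
    (by omega) ⟨by simp [hs₁], hT.frame f₁ (by decide) (by decide) (by decide),
      (f₁.nmem 10 (by decide)).trans h10, (f₁.nmem 12 (by decide)).trans h12, ?_, ?_, ?_, ?_, ?_⟩ ?_ ?_
  · rw [f₁.nmem 26 (by decide)]; exact h26
  · intro i hi hi1
    obtain rfl : i = 0 := by omega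
    rw [hmem 0 hi]
    exact if_congr (by simp) rfl rfl
  · exact fun i hi _ => hmem i hi
  · intro i hi h
    rw [hmem i hi] at h
    have : i = v := by by_contra hne; simp [hne] at h
    exact this.ge
  · intro i hi h0
    rw [f₁.nmem 3 (by decide), h3, if_neg (by omega)]
    rfl
  · intro k hk hk1 s h
    have hp := T.parent_lt k hk1
    refine (Run.frame (nr := [20]) (rr := []) (nm := [2, 3]) (rm := [])
      (by simp [Program.writes])
      (Run.straight (Q := fun t s' => t ≤ 40 ∧ s' = Program.eff _ s) 40 rfl
      (by decide) fun t s' ht hs' => ⟨ht, hs'⟩)).mono ?_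
    rintro t s' ⟨⟨ht, hs'⟩, f⟩
    have hpar := h.laid.parent k hk
    have hlaid := h.laid.frame f (by decide) (by decide) (by decide)
    have htk : 1 ≤ s.nmem 26 k ↔ T.branch n k < 0 := by
      rw [h.take k hk1 hk]; split_ifs with hb <;> simp [hb]
    have h01 : ∀ i < n, s.nmem 2 (o i) = 0 ∨ s.nmem 2 (o i) = 1 := by
      intro i hi
      rcases lt_or_ge i k with hik | hik
      · rw [h.old i hi hik]; split_ifs <;> simp
      · rw [h.new i hi hik]; split_ifs <;> simp
    have hmk : 1 ≤ s.nmem 2 (o (T.parent k)) ↔ s.nmem 2 (o (T.parent k)) = 1 := by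
      rcases h01 (T.parent k) (by omega) with h1 | h1 <;> simp [h1]
    have htake : ∀ i, 0 < i → i < n → s'.nmem 26 i = if T.branch n i < 0 then 1 else 0 := by
      rw [f.nmem 26 (by decide)]; exact h.take
    -- Marked nodes are at least `v`, whereas the parent of `v` is smaller. So the edge above `v` is
    -- never marked.
    have hvk : s.nmem 2 (o (T.parent k)) = 1 → k ≠ v := fun h1 h2 =>
      absurd (h.below _ (by omega) h1) (by omega)
    by_cases hc : s.nmem 2 (o (T.parent k)) = 1 ∧ T.branch n k < 0
    · have hkv := hvk hc.1
      simp [Program.eff, Test.eval, NExpr.eval, h.index, hpar, h.nodes, h.edges, htk, hc] at hs'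
      have e2 : s'.nmem 2 = Function.update (s.nmem 2) (o k) 1 := by simp [hs']
      have e3 : s'.nmem 3 = Function.update (s.nmem 3) (e k) 1 := by simp [hs']
      have e2' : ∀ i < n, i ≠ k → s'.nmem 2 (o i) = s.nmem 2 (o i) := fun i hi hik => by
        rw [e2, Function.update_of_ne fun h => hik (ho i hi k hk h)]
      refine ⟨ht, by simp [hs'], hlaid, (f.nmem 10 (by decide)).trans h.nodes,
        (f.nmem 12 (by decide)).trans h.edges, htake, ?_, ?_, ?_, ?_⟩
      · intro i hi hik
        rcases Nat.eq_zero_or_pos i with rfl | hi0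
        · rw [e2' 0 hi (by omega), h.old 0 hi (by omega)]
          simp
        have := T.parent_lt i hi0
        rw [e2' (T.parent i) (by omega) (by omega)]
        rcases Nat.lt_succ_iff_lt_or_eq.1 hik with hik | rfl
        · rw [e2' i hi (by omega), h.old i hi hik]
        · rw [if_pos (.inr ⟨hi0, hc⟩), e2, Function.update_self]
      · intro i hi hik
        rw [e2' i hi (by omega), h.new i hi (by omega)]
      · intro i hi h1
        by_cases hik : i = k
        · have := h.below _ (by omega) hc.1
          omega
        · exact h.below i hi (by rwa [e2' i hi hik] at h1)
      · intro i hi hi0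
        by_cases hik : i = k
        · subst hik
          rw [e3, e2, Function.update_self, Function.update_self, if_pos ⟨by omega, rfl, hkv⟩]
        · rw [e2' i hi hik, e3, Function.update_of_ne fun h => hik (he i hi k hk hi0 hk1 h),
            h.edge i hi hi0]
          exact if_congr (and_congr_left fun _ => by omega) rfl rfl
    · have hcf : ¬ (1 ≤ s.nmem 2 (o (T.parent k)) ∧ 1 ≤ s.nmem 26 k) := by rwa [hmk, htk]
      simp only [Program.eff, Test.eval, NExpr.eval, h.index, hpar, h.nodes, hcf,
        if_false] at hs'
      have e2 : s'.nmem = s.nmem := by simp [hs']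
      refine ⟨ht, by simp [hs'], hlaid, (f.nmem 10 (by decide)).trans h.nodes,
        (f.nmem 12 (by decide)).trans h.edges, htake, ?_, ?_, ?_, ?_⟩
      · intro i hi hik
        rw [e2]
        rcases Nat.lt_succ_iff_lt_or_eq.1 hik with hik | rfl
        · exact h.old i hi hik
        · rw [h.new i hi le_rfl]
          exact if_congr ⟨.inl, fun h => h.resolve_right fun h => hc h.2⟩ rfl rfl
      · intro i hi hik
        rw [e2]
        exact h.new i hi (by omega)
      · rw [e2]; exact h.below
      · intro i hi hi0
        rw [e2, h.edge i hi hi0]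
        refine if_congr ⟨fun h => ⟨by omega, h.2⟩, fun h' => ⟨?_, h'.2⟩⟩ rfl rfl
        by_contra hik
        obtain rfl : i = k := by omega
        obtain ⟨-, h1, h2⟩ := h'
        rw [h.new i hi le_rfl, if_neg h2] at h1
        exact absurd h1 (by decide)
  · intro t s' h ht
    refine ⟨by simp only [NExpr.cost] at ht; omega,
      (Finset.range n).filter fun i => s'.nmem 2 (o i) = 1, ?_⟩
    have h01 : ∀ i < n, s'.nmem 2 (o i) = 0 ∨ s'.nmem 2 (o i) = 1 := by
      intro i hi
      rw [h.old i hi hi]; split_ifs <;> simp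
    obtain ⟨g1, g2⟩ := IndexedTree.subCost_of_mem_iff (T := T) (n := n) (v := v)
      (S := (Finset.range n).filter fun i => s'.nmem 2 (o i) = 1) hv fun i => by
        simp only [Finset.mem_filter, Finset.mem_range]
        refine and_congr_right fun hi => ?_
        rw [h.old i hi hi]
        have h5 : 0 < i → T.parent i < n := fun h0 => (T.parent_lt i h0).trans hi
        constructor
        · intro h6
          by_contra hcon
          rw [if_neg fun h7 => hcon (h7.imp id fun h8 => ⟨h8.1, ⟨h5 h8.1, h8.2.1⟩, h8.2.2⟩)] at h6
          exact absurd h6 (by decide)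
        · intro h6
          rw [if_pos (h6.imp id fun h8 => ⟨h8.1, h8.2.1.2, h8.2.2⟩)]
    refine ⟨g1, g2, fun i hi => ?_, fun i hi hi0 => ?_⟩
    · rcases h01 i hi with h1 | h1 <;> simp [h1, hi]
    · rw [h.edge i hi hi0]
      refine if_congr ?_ rfl rfl
      simp only [Finset.mem_erase, Finset.mem_filter, Finset.mem_range]
      tauto

end RealRAM

/-! ### The two solvers on a tree that has been laid out -/

namespace RealRAM

variable {T : IndexedTree} {n : ℕ}

/-- The memory outside the input and the layout of the tree is empty. -/
structure Unused (s : State) : Prop extends Blank s where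
  outNodes : s.nmem 2 = 0
  outEdges : s.nmem 3 = 0
  take : s.nmem 26 = 0
  gain : s.rmem 6 = 0

/-- Find an optimal subtree. -/
def solveSubtree : Program := answerQueries ;; computeGains ;; findBest ;; markSubtree

/-- Find an optimal node. -/
def solveNode : Program := answerQueries ;; findBest ;; .setN 1 (.mem 10 (.reg 21))

/-- A bound on the time that it takes to answer all queries. -/
def answerTime (n m : ℕ) : ℕ := n * 358 + 6 * m * (7000 * n + 40) + 26

theorem allAnswered {s : State} (h : ∀ i < n, ∀ q ∈ [i, n + n + i, n + i],
    s.rmem 5 q = ∑ u ∈ Finset.range n, (T.queries n).val q u) : AllAnswered T n s :=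
  fun i hi => ⟨h i hi _ (by simp), h i hi _ (by simp), h i hi _ (by simp)⟩

theorem run_solveSubtree (hn : 0 < n) {m : ℕ} (hm : 3 * n ≤ 2 ^ m) {s : State} {o e : ℕ → ℕ}
    (hT : T.Laid n s) (hs : Unused s) (h10 : s.nmem 10 = o) (h12 : s.nmem 12 = e)
    (ho : ∀ i < n, ∀ j < n, o i = o j → i = j)
    (he : ∀ i < n, ∀ j < n, 0 < i → 0 < j → e i = e j → i = j) :
    Run solveSubtree s fun t s' => t ≤ answerTime n m + n * 160 + 50 ∧ ∃ (S : Finset ℕ) (v : ℕ),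
      T.IsSub n S v ∧ (∀ S' v', T.IsSub n S' v' → T.subCost n S v ≤ T.subCost n S' v') ∧
      s'.rreg 0 = T.subCost n S v ∧ (∀ i < n, s'.nmem 2 (o i) = if i ∈ S then 1 else 0) ∧
      ∀ i < n, 0 < i → s'.nmem 3 (e i) = if i ∈ S.erase v then 1 else 0 := by
  refine Run.seq ((Run.frame (nr := answerQueries.writes.1) (rr := answerQueries.writes.2.1)
      (nm := answerQueries.writes.2.2.1) (rm := answerQueries.writes.2.2.2) (by simp)
      (run_answerQueries hn hm hT hs.toBlank)).mono ?_)
  rintro t₁ s₁ ⟨⟨ht₁, h₁⟩, f₁⟩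
  have hT₁ := hT.frame f₁ (by decide) (by decide) (by decide)
  have ha₁ := allAnswered h₁
  refine Run.seq ((Run.frame (nr := computeGains.writes.1) (rr := computeGains.writes.2.1)
      (nm := computeGains.writes.2.2.1) (rm := computeGains.writes.2.2.2) (by simp)
      (run_computeGains hn hT₁ ha₁ ((f₁.rmem 6 (by decide)).trans hs.gain)
        ((f₁.nmem 26 (by decide)).trans hs.take))).mono ?_)
  rintro t₂ s₂ ⟨⟨ht₂, hg₂, htk₂⟩, f₂⟩
  have hT₂ := hT₁.frame f₂ (by decide) (by decide) (by decide)
  have h5₂ := f₂.rmem 5 (by decide)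
  refine Run.seq ((Run.frame (nr := findBest.writes.1) (rr := findBest.writes.2.1)
      (nm := findBest.writes.2.2.1) (rm := findBest.writes.2.2.2) (by simp)
      (run_findBest hn hT₂.size)).mono ?_)
  rintro t₃ s₃ ⟨⟨ht₃, hv₃, hval₃, hbest₃⟩, f₃⟩
  have hT₃ := hT₂.frame f₃ (by decide) (by decide) (by decide)
  refine (Run.frame (nr := markSubtree.writes.1) (rr := markSubtree.writes.2.1)
      (nm := markSubtree.writes.2.2.1) (rm := markSubtree.writes.2.2.2) (by simp)
      (run_markSubtree (o := o) (e := e) hv₃ ho he hT₃ rfl ?_ ?_ ?_ ?_ ?_)).mono ?_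
  · rw [f₃.nmem 10 (by decide), f₂.nmem 10 (by decide), f₁.nmem 10 (by decide), h10]
  · rw [f₃.nmem 12 (by decide), f₂.nmem 12 (by decide), f₁.nmem 12 (by decide), h12]
  · rw [f₃.nmem 26 (by decide)]; exact htk₂
  · rw [f₃.nmem 2 (by decide), f₂.nmem 2 (by decide), f₁.nmem 2 (by decide), hs.outNodes]
  · rw [f₃.nmem 3 (by decide), f₂.nmem 3 (by decide), f₁.nmem 3 (by decide), hs.outEdges]
  rintro t₄ s₄ ⟨⟨ht₄, S, h1, h2, h3, h4⟩, f₄⟩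
  have hval : ∀ i < n, s₂.rmem 5 i + s₂.rmem 6 i = T.answer n i + T.gain n i := fun i hi => by
    rw [h5₂, (ha₁ i hi).1, hg₂]
  have hcost : s₃.rreg 0 = T.subCost n S (s₃.nreg 21) := by rw [h2, hval₃, hval _ hv₃]
  refine ⟨by unfold answerTime; omega, S, _, h1, fun S' v' h' => ?_, ?_, h3, h4⟩
  · have hv' := h'.lt_size v' h'.root_mem
    refine le_trans ?_ h'.le_subCost
    rw [← hcost, ← hval v' hv']
    exact hbest₃ v' hv'
  · rw [f₄.rreg 0 (by decide), hcost]

theorem run_solveNode (hn : 0 < n) {m : ℕ} (hm : 3 * n ≤ 2 ^ m) {s : State} {o : ℕ → ℕ}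
    (hT : T.Laid n s) (hs : Unused s) (h10 : s.nmem 10 = o) :
    Run solveNode s fun t s' => t ≤ answerTime n m + n * 160 + 50 ∧ ∃ v < n,
      (∀ i < n, T.subCost n {v} v ≤ T.subCost n {i} i) ∧
      s'.rreg 0 = T.subCost n {v} v ∧ s'.nreg 1 = o v := by
  refine Run.seq ((Run.frame (nr := answerQueries.writes.1) (rr := answerQueries.writes.2.1)
      (nm := answerQueries.writes.2.2.1) (rm := answerQueries.writes.2.2.2) (by simp)
      (run_answerQueries hn hm hT hs.toBlank)).mono ?_)
  rintro t₁ s₁ ⟨⟨ht₁, h₁⟩, f₁⟩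
  have hT₁ := hT.frame f₁ (by decide) (by decide) (by decide)
  have ha₁ := allAnswered h₁
  refine Run.seq ((Run.frame (nr := findBest.writes.1) (rr := findBest.writes.2.1)
      (nm := findBest.writes.2.2.1) (rm := findBest.writes.2.2.2) (by simp)
      (run_findBest hn hT₁.size)).mono ?_)
  rintro t₂ s₂ ⟨⟨ht₂, hv₂, hval₂, hbest₂⟩, f₂⟩
  refine Run.straight 4 rfl (by decide) fun t₃ s₃ ht₃ hs₃ => ?_
  simp only [Program.eff, NExpr.eval, f₂.nmem 10 (by decide), f₁.nmem 10 (by decide), h10] at hs₃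
  -- Without `computeGains` the real array `6` is still zero, so `findBest` compares the costs of
  -- single nodes.
  have hval : ∀ i < n, s₁.rmem 5 i + s₁.rmem 6 i = T.subCost n {i} i := fun i hi => by
    rw [(ha₁ i hi).1, f₁.rmem 6 (by decide), hs.gain, IndexedTree.subCost_singleton hi]
    exact add_zero _
  refine ⟨by unfold answerTime; omega, _, hv₂, fun i hi => ?_, ?_, by simp [hs₃]⟩
  · rw [← hval _ hv₂, ← hval i hi, ← hval₂]
    exact hbest₂ i hi
  · rw [← hval _ hv₂, ← hval₂]
    simp [hs₃]

end RealRAM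

/-! ## Trees with numbered nodes -/

namespace CoverInstance

variable {n : ℕ} {I : CoverInstance n} {T : IndexedTree} {ν : ℕ → Fin n}

/-- The indexed tree `T` is the tree of the instance, under the names `ν` of its nodes. -/
structure Numbering (I : CoverInstance n) (T : IndexedTree) (ν : ℕ → Fin n) : Prop where
  inj : ∀ i < n, ∀ j < n, ν i = ν j → i = j
  adj : ∀ i < n, 0 < i → I.graph.Adj (ν i) (ν (T.parent i))
  cost : ∀ i < n, 0 < i → T.cost i = I.cost s(ν i, ν (T.parent i))
  pen : ∀ i < n, T.pen i = I.penalty (ν i)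
  rad : ∀ i < n, T.rad i = I.radius (ν i)

/-- The subgraph induced by a set of indices. -/
def subgraphOf (I : CoverInstance n) (ν : ℕ → Fin n) (S : Finset ℕ) : I.graph.Subgraph :=
  (⊤ : I.graph.Subgraph).induce {x | ∃ i ∈ S, ν i = x}

namespace Numbering

variable (h : I.Numbering T ν)
include h

theorem surj (u : Fin n) : ∃ i < n, ν i = u := by
  have : Function.Injective fun i : Fin n => ν i := fun i j hij =>
    Fin.ext (h.inj i i.2 j j.2 hij)
  obtain ⟨i, hi⟩ := (Finite.injective_iff_surjective.1 this) u
  exact ⟨i, i.2, hi⟩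

theorem edge_inj {i j : ℕ} (hi : i < n) (hj : j < n) (hi0 : 0 < i) (hj0 : 0 < j)
    (he : s(ν i, ν (T.parent i)) = s(ν j, ν (T.parent j))) : i = j := by
  have h1 := T.parent_lt i hi0
  have h2 := T.parent_lt j hj0
  rcases Sym2.eq_iff.1 he with ⟨h3, -⟩ | ⟨h3, h4⟩
  · exact h.inj i hi j hj h3
  · have := h.inj _ hi _ (by omega) h3
    have := h.inj _ (by omega) _ hj h4
    omega

/-- The edges from the nodes `1, …, n - 1` to their parents are distinct, and a tree has only `n -
1` edges. -/
theorem mem_edgeSet (e : Sym2 (Fin n)) :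
    e ∈ I.graph.edgeSet ↔ ∃ i < n, 0 < i ∧ e = s(ν i, ν (T.parent i)) := by
  classical
  refine ⟨fun he => ?_, ?_⟩
  · have hsub : (Finset.Ioo 0 n).image (fun i => s(ν i, ν (T.parent i))) ⊆ I.graph.edgeFinset := by
      intro e he
      obtain ⟨i, hi, rfl⟩ := Finset.mem_image.1 he
      have hi := Finset.mem_Ioo.1 hi
      exact SimpleGraph.mem_edgeFinset.2 (h.adj i hi.2 hi.1)
    have hcard := I.isTree.card_edgeFinset
    have heq := Finset.eq_of_subset_of_card_le hsub (by
      rw [Finset.card_image_of_injOn, Nat.card_Ioo]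
      · rw [Fintype.card_fin] at hcard
        omega
      · intro i hi j hj hij
        have hi := Finset.mem_Ioo.1 hi
        have hj := Finset.mem_Ioo.1 hj
        exact h.edge_inj hi.2 hj.2 hi.1 hj.1 hij)
    rw [← SimpleGraph.mem_edgeFinset, ← heq] at he
    obtain ⟨i, hi, rfl⟩ := Finset.mem_image.1 he
    have hi := Finset.mem_Ioo.1 hi
    exact ⟨i, hi.2, hi.1, rfl⟩
  · rintro ⟨i, hi, hi0, rfl⟩
    exact h.adj i hi hi0

theorem adj_iff {i j : ℕ} (hi : i < n) (hj : j < n) : I.graph.Adj (ν i) (ν j) ↔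
    (0 < i ∧ T.parent i = j) ∨ (0 < j ∧ T.parent j = i) := by
  rw [← SimpleGraph.mem_edgeSet, h.mem_edgeSet]
  constructor
  · rintro ⟨k, hk, hk0, he⟩
    have hp := T.parent_lt k hk0
    rcases Sym2.eq_iff.1 he with ⟨h1, h2⟩ | ⟨h1, h2⟩
    · obtain rfl := h.inj _ hi _ hk h1
      exact .inl ⟨hk0, (h.inj _ hj _ (by omega) h2).symm⟩
    · obtain rfl := h.inj _ hj _ hk h2
      exact .inr ⟨hk0, (h.inj _ hi _ (by omega) h1).symm⟩
  · rintro (⟨h0, rfl⟩ | ⟨h0, rfl⟩)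
    · exact ⟨i, hi, h0, rfl⟩
    · exact ⟨j, hj, h0, Sym2.eq_swap⟩

/-- Follows the recursion of `IndexedTree.dist`: the larger end moves to its parent. The bound on
the indices in the support shows that the larger end is not visited again. -/
theorem exists_path (i j : ℕ) (hi : i < n) (hj : j < n) : ∃ p : I.graph.Walk (ν i) (ν j), p.IsPath ∧
    (∀ x ∈ p.support, ∃ k ≤ max i j, x = ν k) ∧ (p.edges.map I.cost).sum = T.dist i j := by
  induction hs : i + j using Nat.strong_induction_on generalizing i j with
  | _ m ih =>
    have key : ∀ i j, i < n → j < i → i + j = m → ∃ p : I.graph.Walk (ν i) (ν j), p.IsPath ∧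
        (∀ x ∈ p.support, ∃ k ≤ max i j, x = ν k) ∧ (p.edges.map I.cost).sum = T.dist i j := by
      intro i j hi hij hm
      have hp := T.parent_lt i (by omega)
      obtain ⟨p, hp1, hp2, hp3⟩ := ih _ (by omega) (T.parent i) j (by omega) (by omega) rfl
      refine ⟨.cons (h.adj i hi (by omega)) p, hp1.cons fun hmem => ?_, ?_, ?_⟩
      · obtain ⟨k, hk, hk'⟩ := hp2 _ hmem
        have := h.inj i hi k (by omega) hk'
        omega
      · intro x hx
        rcases List.mem_cons.1 hx with rfl | hx
        · exact ⟨i, by omega, rfl⟩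
        · obtain ⟨k, hk, hk'⟩ := hp2 x hx
          exact ⟨k, by omega, hk'⟩
      · rw [SimpleGraph.Walk.edges_cons, List.map_cons, List.sum_cons, hp3,
          IndexedTree.dist_of_lt hij, h.cost i hi (by omega)]
    rcases lt_trichotomy i j with hij | rfl | hij
    · obtain ⟨p, hp1, hp2, hp3⟩ := key j i hj hij (by omega)
      refine ⟨p.reverse, hp1.reverse, fun x hx => ?_, ?_⟩
      · rw [SimpleGraph.Walk.support_reverse, List.mem_reverse] at hx
        rw [max_comm]
        exact hp2 x hx
      · rw [SimpleGraph.Walk.edges_reverse, List.map_reverse, List.sum_reverse, hp3,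
          IndexedTree.dist_comm]
    · exact ⟨.nil, .nil, fun x hx => ⟨i, by omega, by simpa using hx⟩,
        by simp [IndexedTree.dist_self]⟩
    · exact key i j hi hij hs

/-- Paths in an acyclic graph are unique, so the infimum is the value at the path from
`exists_path`. -/
theorem dist_eq {i j : ℕ} (hi : i < n) (hj : j < n) : I.dist (ν i) (ν j) = T.dist i j := by
  obtain ⟨p, hp, -, hd⟩ := h.exists_path i j hi hj
  have := I.isTree.isAcyclic.subsingleton_path (ν i) (ν j)
  rw [CoverInstance.dist, ciInf_subsingleton (⟨p, hp⟩ : I.graph.Path (ν i) (ν j)), hd]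

theorem penaltyCost_eq {Y : I.graph.Subgraph} {S : Finset ℕ} (hne : Y.verts.Nonempty)
    (hS : ∀ i, i ∈ S ↔ i < n ∧ ν i ∈ Y.verts) : I.penaltyCost Y = T.penaltySum n S := by
  classical
  have hcov : ∀ u < n, I.setDist (ν u) Y.verts ≤ I.radius (ν u) ↔
      ¬ ∀ y ∈ S, T.rad u < T.dist u y := by
    intro u hu
    have : Nonempty Y.verts := hne.to_subtype
    push Not
    rw [setDist, ← h.rad u hu]
    constructor
    · intro hle
      obtain ⟨y, hy⟩ := exists_eq_ciInf_of_finite (f := fun y : Y.verts => I.dist (ν u) y)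
      obtain ⟨i, hi, hiy⟩ := h.surj y
      refine ⟨i, (hS i).2 ⟨hi, hiy ▸ y.2⟩, ?_⟩
      rw [← h.dist_eq hu hi, hiy]
      exact hy.trans_le hle
    · rintro ⟨y, hy, hle⟩
      obtain ⟨hyn, hyY⟩ := (hS y).1 hy
      rw [← h.dist_eq hu hyn] at hle
      exact (ciInf_le (Finite.bddBelow_range fun y : Y.verts => I.dist (ν u) y) ⟨_, hyY⟩).trans hle
  symm
  refine Finset.sum_bij (fun i _ => ν i) (fun _ _ => Finset.mem_univ _)
    (fun i hi j hj => h.inj i (Finset.mem_range.1 hi) j (Finset.mem_range.1 hj)) ?_ ?_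
  · intro u _
    obtain ⟨i, hi, hiu⟩ := h.surj u
    exact ⟨i, Finset.mem_range.2 hi, hiu⟩
  · intro u hu
    have hu := Finset.mem_range.1 hu
    rw [imposedPenalty, ← h.pen u hu]
    by_cases hc : ∀ y ∈ S, T.rad u < T.dist u y
    · rw [if_pos hc, if_neg fun h' => (hcov u hu).1 h' hc]
    · rw [if_neg hc, if_pos ((hcov u hu).2 hc)]

/-- A connected subgraph contains the edges from its nodes to their parents, except at its root. -/
theorem adj_parent {Z : I.graph.Subgraph} (hZ : Z.coe.Connected) {v i : ℕ} (hv : v < n)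
    (hvZ : ν v ∈ Z.verts) (hi : i < n) (hiZ : ν i ∈ Z.verts) (hvi : v < i) :
    Z.Adj (ν i) (ν (T.parent i)) := by
  by_contra hadj
  -- The edge from `i` to its parent is the only exit from the subtree of `i`. A walk in `Z` that
  -- starts at `i` cannot use it, so it never reaches `v`, which is smaller than `i`.
  have key : ∀ (x y : Z.verts) (_ : Z.coe.Walk x y), (∃ a < n, ν a = x ∧ T.Below i a) →
      ∃ a < n, ν a = y ∧ T.Below i a := by
    intro x y p
    induction p with
    | nil => exact id
    | @cons x z y hxz p ih =>
      rintro ⟨a, ha, hax, hb⟩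
      refine ih ?_
      obtain ⟨b, hbn, hbz⟩ := h.surj z
      refine ⟨b, hbn, hbz, ?_⟩
      have hxz' : Z.Adj (ν a) (ν b) := by rw [hax, hbz]; exact hxz
      rcases (h.adj_iff ha hbn).1 hxz'.adj_sub with ⟨h0, rfl⟩ | ⟨h0, rfl⟩
      · refine hb.parent ?_
        rintro rfl
        exact hadj hxz'
      · exact .step (hb.le.trans_lt (T.parent_lt b h0)) hb
  obtain ⟨p⟩ := hZ.preconnected ⟨ν i, hiZ⟩ ⟨ν v, hvZ⟩
  obtain ⟨a, ha, hav, hb⟩ := key _ _ p ⟨i, hi, rfl, .refl⟩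
  obtain rfl := h.inj a ha v hv hav
  exact absurd hb.le (by omega)

/-- The least index of a connected subgraph is its root. By `adj_parent` every other node is joined
to its parent within `Z`, and there are no other edges in the whole graph. So the edges of `Z`
correspond to the elements of `S.erase v`. -/
theorem subtree {Z : I.graph.Subgraph} (hZ : Z.coe.Connected) {S : Finset ℕ} {v : ℕ}
    (hS : ∀ i, i ∈ S ↔ i < n ∧ ν i ∈ Z.verts) (hv : v ∈ S) (hle : ∀ i ∈ S, v ≤ i) :
    T.IsSub n S v ∧ (∀ e, e ∈ Z.edgeSet ↔ ∃ i ∈ S.erase v, e = s(ν i, ν (T.parent i))) ∧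
      I.totalCost Z = T.subCost n S v := by
  classical
  obtain ⟨hvn, hvZ⟩ := (hS v).1 hv
  have hadj : ∀ i ∈ S, i ≠ v → Z.Adj (ν i) (ν (T.parent i)) := fun i hi hiv =>
    h.adj_parent hZ hvn hvZ ((hS i).1 hi).1 ((hS i).1 hi).2 (lt_of_le_of_ne (hle i hi) hiv.symm)
  have hsub : T.IsSub n S v := by
    refine ⟨hv, fun i hi => ((hS i).1 hi).1, fun i hi hiv => ?_⟩
    have hvi := lt_of_le_of_ne (hle i hi) hiv.symm
    have := T.parent_lt i (by omega)
    have := ((hS i).1 hi).1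
    exact ⟨hvi, (hS _).2 ⟨by omega, (hadj i hi hiv).snd_mem⟩⟩
  have hedge : ∀ e, e ∈ Z.edgeSet ↔ ∃ i ∈ S.erase v, e = s(ν i, ν (T.parent i)) := by
    intro e
    constructor
    · intro he
      obtain ⟨i, hi, hi0, rfl⟩ := (h.mem_edgeSet e).1 (Z.edgeSet_subset he)
      have hp := T.parent_lt i hi0
      have hz := SimpleGraph.Subgraph.mem_edgeSet.1 he
      refine ⟨i, Finset.mem_erase.2 ⟨?_, (hS i).2 ⟨hi, hz.fst_mem⟩⟩, rfl⟩
      rintro rfl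
      exact absurd (hle _ ((hS _).2 ⟨by omega, hz.snd_mem⟩)) (by omega)
    · rintro ⟨i, hi, rfl⟩
      exact hadj i (Finset.mem_of_mem_erase hi) (Finset.ne_of_mem_erase hi)
  refine ⟨hsub, hedge, ?_⟩
  rw [totalCost, IndexedTree.subCost, h.penaltyCost_eq ⟨_, hvZ⟩ hS, setupCost]
  congr 1
  have hpos : ∀ i ∈ S.erase v, i < n ∧ 0 < i := fun i hi => by
    obtain ⟨h1, h2⟩ := Finset.mem_erase.1 hi
    have := hle i h2
    exact ⟨((hS i).1 h2).1, by omega⟩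
  symm
  refine Finset.sum_bij (fun i _ => s(ν i, ν (T.parent i))) ?_ ?_ ?_ ?_
  · intro i hi
    exact Finset.mem_filter.2 ⟨Finset.mem_univ _, (hedge _).2 ⟨i, hi, rfl⟩⟩
  · intro i hi j hj hij
    exact h.edge_inj (hpos i hi).1 (hpos j hj).1 (hpos i hi).2 (hpos j hj).2 hij
  · intro e he
    obtain ⟨i, hi, rfl⟩ := (hedge e).1 (Finset.mem_filter.1 he).2
    exact ⟨i, hi, rfl⟩
  · intro i hi
    exact h.cost i (hpos i hi).1 (hpos i hi).2

/-- The cost of a tree is that of its set of indices. -/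
theorem exists_subtree {Z : I.graph.Subgraph} (hZ : Z.coe.IsTree) :
    ∃ S v, T.IsSub n S v ∧ I.totalCost Z = T.subCost n S v := by
  classical
  obtain ⟨x⟩ := hZ.connected.nonempty
  obtain ⟨i, hi, hix⟩ := h.surj x
  set S := (Finset.range n).filter fun i => ν i ∈ Z.verts
  have hS : ∀ i, i ∈ S ↔ i < n ∧ ν i ∈ Z.verts := by simp [S]
  have hne : S.Nonempty := ⟨i, (hS i).2 ⟨hi, hix ▸ x.2⟩⟩
  have := h.subtree hZ.connected hS (S.min'_mem hne) fun i hi => S.min'_le i hi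
  exact ⟨S, _, this.1, this.2.2⟩

theorem mem_subgraphOf {S : Finset ℕ} {v : ℕ} (hS : T.IsSub n S v) (i : ℕ) :
    i ∈ S ↔ i < n ∧ ν i ∈ (I.subgraphOf ν S).verts := by
  simp only [subgraphOf, SimpleGraph.Subgraph.induce_verts, Set.mem_ofPred_eq]
  refine ⟨fun hi => ⟨hS.lt_size i hi, i, hi, rfl⟩, ?_⟩
  rintro ⟨hi, j, hj, hij⟩
  exact h.inj j (hS.lt_size j hj) i hi hij ▸ hj

/-- Going from parent to parent leads every node to `v` within `S`; acyclicity is inherited. -/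
theorem subgraphOf_isTree {S : Finset ℕ} {v : ℕ} (hS : T.IsSub n S v) :
    (I.subgraphOf ν S).coe.IsTree := by
  refine ⟨(SimpleGraph.connected_iff_exists_forall_reachable _).2
    ⟨⟨ν v, v, hS.root_mem, rfl⟩, ?_⟩, I.isTree.isAcyclic.subgraph _⟩
  rintro ⟨_, i, hi, rfl⟩
  induction i using Nat.strong_induction_on with
  | _ i ih =>
    by_cases hiv : i = v
    · subst hiv
      exact .refl _
    · obtain ⟨h1, h2⟩ := hS.closed i hi hiv
      refine (ih _ (T.parent_lt i (by omega)) h2).trans (SimpleGraph.Adj.reachable ?_)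
      exact ⟨⟨_, h2, rfl⟩, ⟨i, hi, rfl⟩, (h.adj i (hS.lt_size i hi) (by omega)).symm⟩

theorem isOptimalSubtree {S : Finset ℕ} {v : ℕ} (hS : T.IsSub n S v)
    (hopt : ∀ S' v', T.IsSub n S' v' → T.subCost n S v ≤ T.subCost n S' v') :
    I.IsOptimalSubtree (I.subgraphOf ν S) ∧
      I.totalCost (I.subgraphOf ν S) = T.subCost n S v ∧
      ∀ e, e ∈ (I.subgraphOf ν S).edgeSet ↔ ∃ i ∈ S.erase v, e = s(ν i, ν (T.parent i)) := by
  have ht := h.subgraphOf_isTree hS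
  obtain ⟨-, h2, h3⟩ := h.subtree ht.connected (h.mem_subgraphOf hS) hS.root_mem fun i => hS.le
  refine ⟨⟨ht, fun Z hZ => ?_⟩, h3, h2⟩
  obtain ⟨S', v', h4, h5⟩ := h.exists_subtree hZ
  rw [h3, h5]
  exact hopt S' v' h4

theorem totalCost_singleton {i : ℕ} (hi : i < n) :
    I.totalCost (I.graph.singletonSubgraph (ν i)) = T.subCost n {i} i :=
  (h.subtree (SimpleGraph.IsTree.coe_singletonSubgraph _ _).connected (S := {i}) (v := i)
    (fun j => by
      simp only [Finset.mem_singleton, SimpleGraph.singletonSubgraph_verts, Set.mem_singleton_iff]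
      exact ⟨fun hj => ⟨hj.symm ▸ hi, by rw [hj]⟩, fun hj => h.inj j hj.1 i hi hj.2⟩) (by simp) (by simp)).2.2

theorem isOptimalNode {v : ℕ} (hv : v < n)
    (hopt : ∀ i < n, T.subCost n {v} v ≤ T.subCost n {i} i) : I.IsOptimalNode (ν v) := by
  intro z
  obtain ⟨i, hi, rfl⟩ := h.surj z
  rw [h.totalCost_singleton hi, h.totalCost_singleton hv]
  exact hopt i hi

end Numbering

end CoverInstance

/-! ## Peeling off leaves -/

/-- The edges `k < n - 1` with the ends `a k` and `b k` that lie within `A`. -/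
def aliveEdges (n : ℕ) (a b : ℕ → ℕ) (A : Finset ℕ) : Finset ℕ :=
  (Finset.range (n - 1)).filter fun k => a k ∈ A ∧ b k ∈ A

/-- The edges within `A` at the node `v`. -/
def edgesAt (n : ℕ) (a b : ℕ → ℕ) (A : Finset ℕ) (v : ℕ) : Finset ℕ :=
  (aliveEdges n a b A).filter fun k => v = a k ∨ v = b k

/-- Some edge leaves every nonempty proper subset of `A` within `A`. -/
def CutConnected (n : ℕ) (a b : ℕ → ℕ) (A : Finset ℕ) : Prop :=
  ∀ B ⊆ A, B.Nonempty → B ≠ A →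
    ∃ k ∈ aliveEdges n a b A, (a k ∈ B ∧ b k ∉ B) ∨ (b k ∈ B ∧ a k ∉ B)

section

variable {n : ℕ} {a b : ℕ → ℕ} {A : Finset ℕ}

theorem mem_aliveEdges {k : ℕ} : k ∈ aliveEdges n a b A ↔ k < n - 1 ∧ a k ∈ A ∧ b k ∈ A := by
  simp [aliveEdges]

theorem mem_edgesAt {k v : ℕ} :
    k ∈ edgesAt n a b A v ↔ k ∈ aliveEdges n a b A ∧ (v = a k ∨ v = b k) := by
  simp [edgesAt]

/-- Double counting of incidences: each edge has at most two ends, so if all degrees were at least 2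
there would be at least as many edges as nodes. -/
theorem exists_leaf (h : (aliveEdges n a b A).card < A.card) :
    ∃ v ∈ A, (edgesAt n a b A v).card ≤ 1 := by
  by_contra! hcon
  have := Finset.card_mul_le_card_mul (s := A) (t := aliveEdges n a b A) (m := 2) (n := 2)
    (fun v k => v = a k ∨ v = b k) (fun v hv => hcon v hv) fun k _ => by
      refine (Finset.card_le_card (t := {a k, b k}) fun v hv => ?_).trans Finset.card_le_two
      simpa [Finset.bipartiteBelow] using (Finset.mem_filter.1 hv).2
  omega

/-- A leaf of a connected graph with at least two nodes has a unique edge. -/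
theorem CutConnected.edgesAt_eq (hA : CutConnected n a b A) {v : ℕ} (hv : v ∈ A)
    (h2 : 2 ≤ A.card) (hd : (edgesAt n a b A v).card ≤ 1) :
    ∃ e ∈ aliveEdges n a b A, edgesAt n a b A v = {e} ∧ (v = a e ∨ v = b e) := by
  obtain ⟨e, he, hc⟩ := hA {v} (by simpa using hv) (by simp) (by rintro rfl; simp at h2)
  simp only [Finset.mem_singleton] at hc
  have hev : e ∈ edgesAt n a b A v := mem_edgesAt.2 ⟨he, by rcases hc with h | h <;> simp [h.1]⟩
  exact ⟨e, he, Finset.eq_singleton_iff_unique_mem.2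
    ⟨hev, fun k hk => Finset.card_le_one.1 hd k hk e hev⟩, (mem_edgesAt.1 hev).2⟩

theorem aliveEdges_erase {v e : ℕ} (he : edgesAt n a b A v = {e}) :
    aliveEdges n a b (A.erase v) = (aliveEdges n a b A).erase e := by
  ext k
  have : k ∈ edgesAt n a b A v ↔ k = e := by rw [he, Finset.mem_singleton]
  rw [mem_edgesAt] at this
  simp only [mem_aliveEdges, Finset.mem_erase] at this ⊢
  constructor
  · rintro ⟨h1, ⟨h2, h3⟩, h4, h5⟩
    exact ⟨fun hk => by have := (this.2 hk).2; omega, h1, h3, h5⟩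
  · rintro ⟨h1, h2, h3, h4⟩
    have h5 : ¬ (v = a k ∨ v = b k) := fun h => h1 (this.1 ⟨⟨h2, h3, h4⟩, h⟩)
    exact ⟨h2, ⟨by omega, h3⟩, by omega, h4⟩

/-- Given a cut of the smaller set, put `v` on the side of its only neighbour. The edge that crosses
this cut of `A` is not the edge at `v`, so it survives. -/
theorem CutConnected.erase (hA : CutConnected n a b A) {v e : ℕ} (hv : v ∈ A)
    (he : edgesAt n a b A v = {e}) : CutConnected n a b (A.erase v) := by
  intro B hB hne hBA
  have hvB : v ∉ B := fun h => Finset.notMem_erase v A (hB h)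
  have hBA' : B ⊆ A := hB.trans (Finset.erase_subset _ _)
  have hiff : ∀ k ∈ aliveEdges n a b A, (v = a k ∨ v = b k) → k = e := fun k hk h => by
    have : k ∈ edgesAt n a b A v := mem_edgesAt.2 ⟨hk, h⟩
    rwa [he, Finset.mem_singleton] at this
  have heA : e ∈ edgesAt n a b A v := by simp [he]
  obtain ⟨heA, hev⟩ := mem_edgesAt.1 heA
  by_cases hw : a e ∈ B ∨ b e ∈ B
  · obtain ⟨k, hk, hc⟩ := hA (insert v B) (Finset.insert_subset hv hBA') (by simp) fun h => hBA (by
      rw [← h, Finset.erase_insert hvB])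
    simp only [Finset.mem_insert, not_or] at hc
    have hke : k ≠ e := by
      rintro rfl
      rcases hev with h | h <;> rcases hw with h' | h' <;> rcases hc with ⟨h3, h4⟩ | ⟨h3, h4⟩ <;>
        simp_all
    have hkv : ¬ (v = a k ∨ v = b k) := fun h => hke (hiff k hk h)
    refine ⟨k, by rw [aliveEdges_erase he]; exact Finset.mem_erase.2 ⟨hke, hk⟩, ?_⟩
    rcases hc with ⟨h3, h4⟩ | ⟨h3, h4⟩
    · exact .inl ⟨h3.resolve_left (by omega), h4.2⟩
    · exact .inr ⟨h3.resolve_left (by omega), h4.2⟩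
  · obtain ⟨k, hk, hc⟩ := hA B hBA' hne fun h => hvB (h ▸ hv)
    have hke : k ≠ e := by
      rintro rfl
      exact hw (hc.imp (fun h => h.1) fun h => h.1)
    exact ⟨k, by rw [aliveEdges_erase he]; exact Finset.mem_erase.2 ⟨hke, hk⟩, hc⟩

theorem edgesAt_erase {v e u : ℕ} (he : edgesAt n a b A v = {e}) :
    edgesAt n a b (A.erase v) u = (edgesAt n a b A u).erase e := by
  rw [edgesAt, aliveEdges_erase he, Finset.filter_erase]
  rfl

/-- The nodes in `q 0`, …, `q (h - 1)` have been peeled off, those in `q h`, …, `q (m - 1)` are the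
leaves of the remaining tree, whose degrees are in `deg`, and `sum` holds the sums of the names of
the edges at its nodes.  The nodes that have been peeled off have their parents in `par` and the
edges to them in `pe`. -/
structure Peeling (n : ℕ) (a b : ℕ → ℕ) (h m : ℕ) (q deg sum par pe : ℕ → ℕ) (A : Finset ℕ) :
    Prop where
  mem_iff : ∀ v, v ∈ A ↔ v < n ∧ ∀ i < h, q i ≠ v
  lt_size : ∀ i < m, q i < n
  inj : ∀ i < m, ∀ j < m, q i = q j → i = j
  deg_eq : ∀ v ∈ A, deg v = (edgesAt n a b A v).card
  sum_eq : ∀ v ∈ A, sum v = ∑ k ∈ edgesAt n a b A v, k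
  leaf : ∀ v ∈ A, (∃ i, h ≤ i ∧ i < m ∧ q i = v) ↔ (edgesAt n a b A v).card ≤ 1
  conn : CutConnected n a b A
  card : A.card + h = n
  edges : (aliveEdges n a b A).card + h + 1 = n
  done : ∀ i < h, pe (q i) < n - 1 ∧ par (q i) < n ∧ (∀ j ≤ i, q j ≠ par (q i)) ∧
    ((a (pe (q i)) = q i ∧ b (pe (q i)) = par (q i)) ∨
      (b (pe (q i)) = q i ∧ a (pe (q i)) = par (q i)))

variable {h m : ℕ} {q deg sum par pe : ℕ → ℕ}

/-- What is to be known about the next node to be peeled off. -/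
theorem Peeling.next (P : Peeling n a b h m q deg sum par pe A) (hab : ∀ k < n - 1, a k ≠ b k)
    (hn : h + 1 < n) : h < m ∧ q h ∈ A ∧ ∃ e w, sum (q h) = e ∧ a e + b e - q h = w ∧
      e < n - 1 ∧ w ∈ A.erase (q h) ∧ edgesAt n a b A (q h) = {e} ∧
      ((a e = q h ∧ b e = w) ∨ (b e = q h ∧ a e = w)) := by
  have hc := P.card
  have hc' := P.edges
  obtain ⟨u, hu, hd⟩ := exists_leaf (n := n) (a := a) (b := b) (A := A) (by omega)
  obtain ⟨i, h1, h2, h3⟩ := (P.leaf u hu).2 hd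
  have hm : h < m := by omega
  have hA : q h ∈ A := (P.mem_iff _).2 ⟨P.lt_size h hm, fun i hi hq => by
    have := P.inj i (by omega) h hm hq; omega⟩
  obtain ⟨e, he, hs, hev⟩ := P.conn.edgesAt_eq hA (by omega) ((P.leaf _ hA).1 ⟨h, le_rfl, hm, rfl⟩)
  obtain ⟨h4, h5, h6⟩ := mem_aliveEdges.1 he
  have := hab e h4
  refine ⟨hm, hA, e, _, by rw [P.sum_eq _ hA, hs, Finset.sum_singleton], rfl, h4, ?_, hs, ?_⟩
  · rcases hev with hev | hev
    · have : a e + b e - q h = b e := by omega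
      rw [this]
      exact Finset.mem_erase.2 ⟨by omega, h6⟩
    · have : a e + b e - q h = a e := by omega
      rw [this]
      exact Finset.mem_erase.2 ⟨by omega, h5⟩
  · omega

/-- Removing the leaf `v` affects only its neighbour `w`, which loses the edge `e`. The node `w`
enters the queue if its degree drops to exactly 1. If it drops to 0, then `w` was a leaf before and
is in the queue already. -/
theorem Peeling.step (P : Peeling n a b h m q deg sum par pe A) {v e w m' : ℕ} {q' : ℕ → ℕ}
    (hv : q h = v) (hhm : h < m) (hvA : v ∈ A) (hw : w ∈ A.erase v)
    (he1 : edgesAt n a b A v = {e}) (hen : e < n - 1)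
    (hends : (a e = v ∧ b e = w) ∨ (b e = v ∧ a e = w))
    (hq' : (deg w - 1 = 1 ∧ m' = m + 1 ∧ q' = Function.update q m w) ∨
      (deg w - 1 ≠ 1 ∧ m' = m ∧ q' = q)) :
    Peeling n a b (h + 1) m' q' (Function.update deg w (deg w - 1))
      (Function.update sum w (sum w - e)) (Function.update par v w) (Function.update pe v e)
      (A.erase v) := by
  obtain ⟨hwv, hwA⟩ := Finset.mem_erase.1 hw
  have heA : e ∈ aliveEdges n a b A := (mem_edgesAt.1 (he1 ▸ Finset.mem_singleton_self e)).1
  have hqq : ∀ i < m, q' i = q i := by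
    intro i hi
    rcases hq' with ⟨-, -, rfl⟩ | ⟨-, -, rfl⟩
    · rw [Function.update_of_ne hi.ne]
    · rfl
  have hewA : e ∈ edgesAt n a b A w := mem_edgesAt.2 ⟨heA, by omega⟩
  have hother : ∀ u ∈ A.erase v, u ≠ w → edgesAt n a b (A.erase v) u = edgesAt n a b A u := by
    intro u hu huw
    rw [edgesAt_erase he1]
    refine Finset.erase_eq_of_notMem fun h' => ?_
    have := (mem_edgesAt.1 h').2
    have := Finset.ne_of_mem_erase hu
    omega
  have hdw : (edgesAt n a b (A.erase v) w).card = deg w - 1 := by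
    rw [edgesAt_erase he1, Finset.card_erase_of_mem hewA, P.deg_eq w hwA]
  have hwlt : w < n := ((P.mem_iff w).1 hwA).1
  -- A node that is waiting in the queue has degree at most 1, whereas here the old degree is 2.
  have hwold : deg w - 1 = 1 → ∀ i < m, q i ≠ w := by
    intro hd i hi hqi
    rcases lt_or_ge i h with hih | hih
    · exact ((P.mem_iff w).1 hwA).2 i hih hqi
    · have := (P.leaf w hwA).1 ⟨i, hih, hi, hqi⟩
      rw [← P.deg_eq w hwA] at this
      omega
  have hmm : m ≤ m' := by omega
  refine ⟨?_, ?_, ?_, ?_, ?_, ?_, P.conn.erase hvA he1, ?_, ?_, ?_⟩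
  · intro u
    rw [Finset.mem_erase, P.mem_iff]
    constructor
    · rintro ⟨h1, h2, h3⟩
      refine ⟨h2, fun i hi => ?_⟩
      rw [hqq i (by omega)]
      rcases Nat.lt_succ_iff_lt_or_eq.1 hi with hi | rfl
      · exact h3 i hi
      · rw [hv]; exact h1.symm
    · rintro ⟨h1, h2⟩
      refine ⟨?_, h1, fun i hi => ?_⟩
      · rw [← hv, ← hqq h hhm]; exact (h2 h (by omega)).symm
      · rw [← hqq i (by omega)]; exact h2 i (by omega)
  · intro i hi
    rcases lt_or_ge i m with him | him
    · rw [hqq i him]; exact P.lt_size i him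
    · rcases hq' with ⟨-, h2, rfl⟩ | ⟨-, h2, -⟩
      · obtain rfl : i = m := by omega
        rwa [Function.update_self]
      · omega
  · intro i hi j hj hij
    rcases hq' with ⟨h1, h2, h3⟩ | ⟨-, h2, rfl⟩
    · have hm : q' m = w := by rw [h3, Function.update_self]
      rcases lt_or_ge i m with him | him <;> rcases lt_or_ge j m with hjm | hjm
      · rw [hqq i him, hqq j hjm] at hij
        exact P.inj i him j hjm hij
      · obtain rfl : j = m := by omega
        rw [hm, hqq i him] at hij
        exact absurd hij (hwold h1 i him)
      · obtain rfl : i = m := by omega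
        rw [hm, hqq j hjm] at hij
        exact absurd hij.symm (hwold h1 j hjm)
      · omega
    · exact P.inj i (by omega) j (by omega) hij
  · intro u hu
    by_cases huw : u = w
    · rw [huw, Function.update_self, hdw]
    · rw [Function.update_of_ne huw, hother u hu huw]
      exact P.deg_eq u (Finset.mem_of_mem_erase hu)
  · intro u hu
    by_cases huw : u = w
    · rw [huw, Function.update_self, edgesAt_erase he1, P.sum_eq w hwA,
        ← Finset.add_sum_erase _ _ hewA, Nat.add_sub_cancel_left]
    · rw [Function.update_of_ne huw, hother u hu huw]
      exact P.sum_eq u (Finset.mem_of_mem_erase hu)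
  · intro u hu
    have huA := Finset.mem_of_mem_erase hu
    have huv := Finset.ne_of_mem_erase hu
    have hold : (∃ i, h + 1 ≤ i ∧ i < m ∧ q' i = u) ↔ (edgesAt n a b A u).card ≤ 1 := by
      rw [← P.leaf u huA]
      constructor
      · rintro ⟨i, h1, h2, h3⟩
        exact ⟨i, by omega, h2, by rwa [hqq i h2] at h3⟩
      · rintro ⟨i, h1, h2, h3⟩
        have : i ≠ h := by rintro rfl; exact huv (h3.symm.trans hv)
        exact ⟨i, by omega, h2, by rwa [hqq i h2]⟩
    by_cases huw : u = w
    · subst huw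
      rw [hdw]
      rw [← P.deg_eq u huA] at hold
      rcases hq' with ⟨h1, h2, h3⟩ | ⟨h1, h2, h3⟩
      · exact ⟨fun _ => h1.le, fun _ => ⟨m, by omega, by omega, by rw [h3, Function.update_self]⟩⟩
      · rw [h2, hold]
        omega
    · rw [hother u hu huw, ← hold]
      constructor
      · rintro ⟨i, h1, h2, h3⟩
        refine ⟨i, h1, ?_, h3⟩
        by_contra him
        rcases hq' with ⟨g1, g2, g3⟩ | ⟨g1, g2, g3⟩
        · obtain rfl : i = m := by omega
          rw [g3, Function.update_self] at h3
          exact huw h3.symm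
        · omega
      · rintro ⟨i, h1, h2, h3⟩
        exact ⟨i, h1, h2.trans_le hmm, h3⟩
  · have := P.card
    rw [Finset.card_erase_of_mem hvA]
    have := Finset.card_pos.2 ⟨v, hvA⟩
    omega
  · have := P.edges
    rw [aliveEdges_erase he1, Finset.card_erase_of_mem heA]
    have := Finset.card_pos.2 ⟨e, heA⟩
    omega
  · intro i hi
    rw [hqq i (by omega)]
    rcases Nat.lt_succ_iff_lt_or_eq.1 hi with hi | rfl
    · have hne : q i ≠ v := fun h' => by
        have := P.inj i (by omega) h hhm (h'.trans hv.symm)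
        omega
      rw [Function.update_of_ne hne, Function.update_of_ne hne]
      obtain ⟨h1, h2, h3, h4⟩ := P.done i hi
      exact ⟨h1, h2, fun j hj => by rw [hqq j (by omega)]; exact h3 j hj, h4⟩
    · rw [hv, Function.update_self, Function.update_self]
      refine ⟨hen, hwlt, fun j hj => ?_, hends⟩
      rw [hqq j (by omega)]
      rcases hj.lt_or_eq with hj | rfl
      · exact ((P.mem_iff w).1 hwA).2 j hj
      · rw [hv]; exact hwv.symm

/-- In the end all nodes are in the queue, each before its parent. -/
theorem Peeling.final (P : Peeling n a b h m q deg sum par pe A) (hn : h + 1 = n) :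
    (∀ i < n, q i < n) ∧ (∀ i < n, ∀ j < n, q i = q j → i = j) ∧
      ∀ i, i + 1 < n → pe (q i) < n - 1 ∧ (∃ j, i < j ∧ j < n ∧ par (q i) = q j) ∧
        ((a (pe (q i)) = q i ∧ b (pe (q i)) = par (q i)) ∨
          (b (pe (q i)) = q i ∧ a (pe (q i)) = par (q i))) := by
  have hA : A.card = 1 := by have := P.card; omega
  obtain ⟨r, rfl⟩ := Finset.card_eq_one.1 hA
  have hr : (edgesAt n a b {r} r).card ≤ 1 := by
    have := P.edges
    have := Finset.card_le_card (Finset.filter_subset (fun k => r = a k ∨ r = b k)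
      (aliveEdges n a b {r}))
    unfold edgesAt
    omega
  -- The last node has no edge left and so counts as a leaf. It is in the queue behind the `n - 1`
  -- nodes that have been peeled off.
  obtain ⟨i₀, h1, h2, -⟩ := (P.leaf r (by simp)).2 hr
  have hnm : n ≤ m := by omega
  have hinj : ∀ i < n, ∀ j < n, q i = q j → i = j := fun i hi j hj =>
    P.inj i (by omega) j (by omega)
  have hlt : ∀ i < n, q i < n := fun i hi => P.lt_size i (by omega)
  refine ⟨hlt, hinj, fun i hi => ?_⟩
  obtain ⟨g1, g2, g3, g4⟩ := P.done i (by omega)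
  refine ⟨g1, ?_, g4⟩
  have hf : Function.Injective fun i : Fin n => (⟨q i, hlt i i.2⟩ : Fin n) := fun i j hij =>
    Fin.ext (hinj i i.2 j j.2 (by simpa using hij))
  obtain ⟨j, hj⟩ := Finite.injective_iff_surjective.1 hf ⟨par (q i), g2⟩
  have hj' : q j = par (q i) := by simpa using hj
  refine ⟨j, ?_, j.2, hj'.symm⟩
  by_contra hji
  exact g3 j (by omega) hj'

end

/-! ### Leaf peeling and numbering on the machine -/

namespace RealRAM

variable {n : ℕ} {a b : ℕ → ℕ}

/-- The natural arrays `0` and `1` hold the ends of the edges of a tree with `n` nodes. -/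
structure HoldsEdges (n : ℕ) (a b : ℕ → ℕ) (s : State) : Prop where
  size : s.nreg 0 = n
  src : s.nmem 0 = a
  dst : s.nmem 1 = b

theorem HoldsEdges.frame {s s' : State} {nr rr nm rm : List ℕ} (h : HoldsEdges n a b s)
    (hf : Frame nr rr nm rm s s') (h0 : 0 ∉ nr) (h1 : 0 ∉ nm) (h2 : 1 ∉ nm) :
    HoldsEdges n a b s' :=
  ⟨(hf.nreg 0 h0).trans h.size, (hf.nmem 0 h1).trans h.src, (hf.nmem 1 h2).trans h.dst⟩

/-- Compute the degrees of the nodes and the sums of the names of the edges at the nodes. -/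
def countDegrees : Program :=
  .setN 20 (.const 0) ;; .count 20 (.sub (.reg 0) (.const 1))
    (.setN 21 (.mem 0 (.reg 20)) ;; .setN 22 (.mem 1 (.reg 20)) ;;
      .storeN 4 (.reg 21) (.add (.mem 4 (.reg 21)) (.const 1)) ;;
      .storeN 5 (.reg 21) (.add (.mem 5 (.reg 21)) (.reg 20)) ;;
      .storeN 4 (.reg 22) (.add (.mem 4 (.reg 22)) (.const 1)) ;;
      .storeN 5 (.reg 22) (.add (.mem 5 (.reg 22)) (.reg 20)))

/-- As there are no loops, the updates for the two ends of an edge concern different cells. The sums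
serve to recover the last edge at a node without adjacency lists. -/
theorem run_countDegrees (hab : ∀ k < n - 1, a k ≠ b k) {s : State} (hs : HoldsEdges n a b s)
    (h4 : s.nmem 4 = 0) (h5 : s.nmem 5 = 0) :
    Run countDegrees s fun t s' => t ≤ n * 50 + 10 ∧
      (∀ v, s'.nmem 4 v = ((Finset.range (n - 1)).filter fun k => v = a k ∨ v = b k).card) ∧
      ∀ v, s'.nmem 5 v = ∑ k ∈ (Finset.range (n - 1)).filter fun k => v = a k ∨ v = b k, k := by
  refine Run.seq (Run.mono (Run.frame (nr := [20]) (rr := []) (nm := [])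
    (rm := []) (by simp [Program.writes]) (Run.straight
      (Q := fun t s' => t ≤ 2 ∧ s'.nreg 20 = 0) 2 rfl
      (by decide) fun t s' ht hs' => ⟨ht, by simp [hs', Program.eff, NExpr.eval]⟩)) ?_)
  rintro t₁ s₁ ⟨⟨ht₁, h20⟩, f₁⟩
  refine Run.count (fun j s => s.nreg 20 = j ∧ HoldsEdges n a b s ∧
      (∀ v, s.nmem 4 v = ((Finset.range j).filter fun k => v = a k ∨ v = b k).card) ∧
      ∀ v, s.nmem 5 v = ∑ k ∈ (Finset.range j).filter fun k => v = a k ∨ v = b k, k) (n - 1) 44 0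
    (fun k s h => ⟨h.1, by simp [NExpr.eval, h.2.1.size]⟩) (Nat.zero_le _)
    ⟨h20, hs.frame f₁ (by decide) (by decide) (by decide), ?_, ?_⟩ ?_ ?_
  · intro v; rw [f₁.nmem 4 (by simp), h4]; simp
  · intro v; rw [f₁.nmem 5 (by simp), h5]; simp
  · rintro j hj - s ⟨e20, hE, hd, hS⟩
    refine (Run.frame (nr := [20, 21, 22]) (rr := []) (nm := [4, 5]) (rm := [])
      (by simp [Program.writes])
      (Run.straight (Q := fun t s' => t ≤ 44 ∧ s' = Program.eff _ s) 44 rfl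
      (by decide) fun t s' ht hs' => ⟨ht, hs'⟩)).mono ?_
    rintro t s' ⟨⟨ht, hs'⟩, f⟩
    simp only [Program.eff, NExpr.eval, e20, hE.src, hE.dst, Function.update_self, ne_eq,
      Nat.reduceEqDiff, not_false_eq_true, Function.update_of_ne] at hs'
    have hne := hab j hj
    have hnot : j ∉ Finset.range j := by simp
    refine ⟨ht, by simp [hs'], hE.frame f (by decide) (by decide) (by decide), fun v => ?_,
      fun v => ?_⟩
    · rw [Finset.range_add_one, Finset.filter_insert]
      by_cases h1 : v = a j
      · subst h1
        rw [if_pos (.inl rfl), Finset.card_insert_of_notMem (by simp), ← hd]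
        simp [hs', hne]
      · by_cases h2 : v = b j
        · subst h2
          rw [if_pos (.inr rfl), Finset.card_insert_of_notMem (by simp), ← hd]
          simp [hs', hne.symm]
        · rw [if_neg (by tauto), ← hd]
          simp [hs', h1, h2]
    · rw [Finset.range_add_one, Finset.filter_insert]
      by_cases h1 : v = a j
      · subst h1
        rw [if_pos (.inl rfl), Finset.sum_insert (by simp), ← hS]
        simp [hs', hne, add_comm]
      · by_cases h2 : v = b j
        · subst h2
          rw [if_pos (.inr rfl), Finset.sum_insert (by simp), ← hS]
          simp [hs', hne.symm, add_comm]
        · rw [if_neg (by tauto), ← hS]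
          simp [hs', h1, h2]
  · rintro t s' ⟨-, -, h1, h2⟩ ht
    exact ⟨by simp only [NExpr.cost] at ht; omega, h1, h2⟩

/-- Put the leaves into the queue. -/
def collectLeaves : Program :=
  (.setN 20 (.const 0) ;; .setN 22 (.const 0)) ;; .count 20 (.reg 0)
    (.ite (.nle (.mem 4 (.reg 20)) (.const 1))
      (.storeN 6 (.reg 22) (.reg 20) ;; .setN 22 (.add (.reg 22) (.const 1))) .skip)

theorem run_collectLeaves {s : State} (h0 : s.nreg 0 = n) :
    Run collectLeaves s fun t s' => t ≤ n * 30 + 10 ∧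
      (∀ i < s'.nreg 22, s'.nmem 6 i < n) ∧
      (∀ i < s'.nreg 22, ∀ j < s'.nreg 22, s'.nmem 6 i = s'.nmem 6 j → i = j) ∧
      ∀ v < n, (∃ i < s'.nreg 22, s'.nmem 6 i = v) ↔ s.nmem 4 v ≤ 1 := by
  refine Run.seq (Run.straight 4 rfl (by decide) fun t₁ s₁ ht₁ hs₁ => ?_)
  simp only [Program.eff, NExpr.eval] at hs₁
  refine Run.count (fun k s' => s'.nreg 20 = k ∧ s'.nreg 0 = n ∧ s'.nmem 4 = s.nmem 4 ∧
      (∀ i < s'.nreg 22, s'.nmem 6 i < k) ∧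
      (∀ i < s'.nreg 22, ∀ j < s'.nreg 22, s'.nmem 6 i = s'.nmem 6 j → i = j) ∧
      ∀ v < k, (∃ i < s'.nreg 22, s'.nmem 6 i = v) ↔ s.nmem 4 v ≤ 1) n 20 0
    (fun k s h => ⟨h.1, h.2.1⟩) (Nat.zero_le _) (by simp [hs₁, h0]) ?_ ?_
  · rintro k hk - s₂ ⟨e1, e2, e3, e4, e5, e6⟩
    refine Run.straight 20 rfl (by decide) fun t s' ht hs' => ⟨ht, ?_⟩
    by_cases hc : s.nmem 4 k ≤ 1
    · simp [Program.eff, Test.eval, NExpr.eval, e1, e3, hc] at hs'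
      have g1 : s'.nreg 22 = s₂.nreg 22 + 1 := by simp [hs']
      have g2 : s'.nmem 6 = Function.update (s₂.nmem 6) (s₂.nreg 22) k := by simp [hs']
      refine ⟨by simp [hs'], by simp [hs', e2], by simp [hs', e3], ?_, ?_, ?_⟩
      · intro i hi
        rw [g2]
        rw [g1] at hi
        rcases Nat.lt_succ_iff_lt_or_eq.1 hi with hi | rfl
        · rw [Function.update_of_ne hi.ne]
          have := e4 i hi
          omega
        · rw [Function.update_self]; omega
      · intro i hi j hj hij
        rw [g2] at hij
        rw [g1] at hi hj
        rcases Nat.lt_succ_iff_lt_or_eq.1 hi with hi | rfl <;>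
          rcases Nat.lt_succ_iff_lt_or_eq.1 hj with hj | rfl
        · rw [Function.update_of_ne hi.ne, Function.update_of_ne hj.ne] at hij
          exact e5 i hi j hj hij
        · rw [Function.update_of_ne hi.ne, Function.update_self] at hij
          have := e4 i hi
          omega
        · rw [Function.update_of_ne hj.ne, Function.update_self] at hij
          have := e4 j hj
          omega
        · rfl
      · intro v hv
        rw [g1, g2]
        rcases Nat.lt_succ_iff_lt_or_eq.1 hv with hv | rfl
        · rw [← e6 v hv]
          constructor
          · rintro ⟨i, hi, hiv⟩
            rcases Nat.lt_succ_iff_lt_or_eq.1 hi with hi | rfl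
            · exact ⟨i, hi, by rwa [Function.update_of_ne hi.ne] at hiv⟩
            · rw [Function.update_self] at hiv
              omega
          · rintro ⟨i, hi, hiv⟩
            exact ⟨i, by omega, by rwa [Function.update_of_ne hi.ne]⟩
        · exact ⟨fun _ => hc, fun _ => ⟨_, Nat.lt_succ_self _, Function.update_self ..⟩⟩
    · simp only [Program.eff, Test.eval, NExpr.eval, e1, e3, hc, if_false] at hs'
      have g1 : s'.nreg 22 = s₂.nreg 22 := by simp [hs']
      have g2 : s'.nmem 6 = s₂.nmem 6 := by simp [hs']
      refine ⟨by simp [hs'], by simp [hs', e2], by simp [hs', e3], ?_, ?_, ?_⟩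
      · intro i hi
        rw [g2]
        rw [g1] at hi
        exact (e4 i hi).trans (Nat.lt_succ_self k)
      · rw [g1, g2]; exact e5
      · intro v hv
        rw [g1, g2]
        rcases Nat.lt_succ_iff_lt_or_eq.1 hv with hv | rfl
        · exact e6 v hv
        · refine ⟨?_, fun h => absurd h hc⟩
          rintro ⟨i, hi, hiv⟩
          exact absurd hiv (e4 i hi).ne
  · rintro t s' ⟨-, -, -, h1, h2, h3⟩ ht
    exact ⟨by simp only [NExpr.cost] at ht; omega, h1, h2, h3⟩

/-- Peel off the leaves one after the other. -/
def peelLeaves : Program :=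
  .setN 20 (.const 0) ;; .count 20 (.sub (.reg 0) (.const 1))
    (.setN 21 (.mem 6 (.reg 20)) ;; .setN 10 (.mem 5 (.reg 21)) ;;
      .setN 11 (.sub (.add (.mem 0 (.reg 10)) (.mem 1 (.reg 10))) (.reg 21)) ;;
      .storeN 7 (.reg 21) (.reg 11) ;; .storeN 8 (.reg 21) (.reg 10) ;;
      .storeN 4 (.reg 11) (.sub (.mem 4 (.reg 11)) (.const 1)) ;;
      .storeN 5 (.reg 11) (.sub (.mem 5 (.reg 11)) (.reg 10)) ;;
      .ite (.and (.nle (.mem 4 (.reg 11)) (.const 1)) (.nle (.const 1) (.mem 4 (.reg 11))))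
        (.storeN 6 (.reg 22) (.reg 11) ;; .setN 22 (.add (.reg 22) (.const 1))) .skip)

theorem run_peelLeaves (hn : 0 < n) (hab : ∀ k < n - 1, a k ≠ b k) {s : State} {A : Finset ℕ}
    (hs : HoldsEdges n a b s) (hP : Peeling n a b 0 (s.nreg 22) (s.nmem 6) (s.nmem 4) (s.nmem 5)
      (s.nmem 7) (s.nmem 8) A) :
    Run peelLeaves s fun t s' => t ≤ n * 80 + 10 ∧ ∃ m A', Peeling n a b (n - 1) m (s'.nmem 6)
      (s'.nmem 4) (s'.nmem 5) (s'.nmem 7) (s'.nmem 8) A' := by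
  refine Run.seq (Run.mono (Run.frame (nr := [20]) (rr := []) (nm := [])
    (rm := []) (by simp [Program.writes]) (Run.straight
      (Q := fun t s' => t ≤ 2 ∧ s'.nreg 20 = 0) 2 rfl
      (by decide) fun t s' ht hs' => ⟨ht, by simp [hs', Program.eff, NExpr.eval]⟩)) ?_)
  rintro t₁ s₁ ⟨⟨ht₁, h20⟩, f₁⟩
  refine Run.count (fun h s => s.nreg 20 = h ∧ HoldsEdges n a b s ∧ ∃ A, Peeling n a b h (s.nreg 22)
      (s.nmem 6) (s.nmem 4) (s.nmem 5) (s.nmem 7) (s.nmem 8) A) (n - 1) 70 0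
    (fun k s h => ⟨h.1, by simp [NExpr.eval, h.2.1.size]⟩) (Nat.zero_le _)
    ⟨h20, hs.frame f₁ (by decide) (by decide) (by decide), A, ?_⟩ ?_ ?_
  · rw [f₁.nreg 22 (by decide), f₁.nmem 4 (by simp), f₁.nmem 5 (by simp), f₁.nmem 6 (by simp),
      f₁.nmem 7 (by simp), f₁.nmem 8 (by simp)]
    exact hP
  · rintro h hh - s ⟨e20, hE, A, P⟩
    obtain ⟨g1, g2, e, w, g3, g4, g5, g6, g7, g8⟩ := P.next hab (by omega)
    refine (Run.frame (nr := [20, 21, 22, 10, 11]) (rr := []) (nm := [4, 5, 6, 7, 8]) (rm := [])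
      (by simp [Program.writes])
      (Run.straight (Q := fun t s' => t ≤ 70 ∧ s' = Program.eff _ s) 70 rfl
      (by decide) fun t s' ht hs' => ⟨ht, hs'⟩)).mono ?_
    rintro t s' ⟨⟨ht, hs'⟩, f⟩
    have hstep := fun m' q' => P.step (v := s.nmem 6 h) (m' := m') (q' := q') rfl g1 g2 g6 g7 g5 g8
    have hE' := hE.frame f (by decide) (by decide) (by decide)
    by_cases hd : s.nmem 4 w - 1 ≤ 1 ∧ 1 ≤ s.nmem 4 w - 1
    · simp only [Program.eff, Test.eval, NExpr.eval, e20, hE.src, hE.dst, g3, g4, hd,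
        Function.update_self, ne_eq, Nat.reduceEqDiff, not_false_eq_true, Function.update_of_ne,
        if_true, and_self] at hs'
      have := hstep (s.nreg 22 + 1) (Function.update (s.nmem 6) (s.nreg 22) w)
        (.inl ⟨by omega, rfl, rfl⟩)
      exact ⟨ht, by simp [hs'], hE', A.erase (s.nmem 6 h), by simpa [hs'] using this⟩
    · simp only [Program.eff, Test.eval, NExpr.eval, e20, hE.src, hE.dst, g3, g4, hd,
        Function.update_self, ne_eq, Nat.reduceEqDiff, not_false_eq_true, Function.update_of_ne,
        if_false] at hs'
      have := hstep (s.nreg 22) (s.nmem 6) (.inr ⟨by omega, rfl, rfl⟩)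
      exact ⟨ht, by simp [hs'], hE', A.erase (s.nmem 6 h), by simpa [hs'] using this⟩
  · rintro t s' ⟨-, -, A', h⟩ ht
    exact ⟨by simp only [NExpr.cost] at ht; omega, _, A', h⟩

/-- Number the nodes in the reverse order of the queue. -/
def numberNodes : Program :=
  .setN 20 (.const 0) ;; .count 20 (.reg 0)
    (.setN 21 (.mem 6 (.sub (.sub (.reg 0) (.const 1)) (.reg 20))) ;;
      .storeN 10 (.reg 20) (.reg 21) ;; .storeN 9 (.reg 21) (.reg 20))

/-- In the queue each node precedes its parent, so the reverse order gives parents the smaller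
numbers and the root the number 0. The natural array `9` becomes the inverse of the numbering. -/
theorem run_numberNodes {s : State} (h0 : s.nreg 0 = n)
    (hinj : ∀ i < n, ∀ j < n, s.nmem 6 i = s.nmem 6 j → i = j) :
    Run numberNodes s fun t s' => t ≤ n * 30 + 10 ∧
      (∀ i < n, s'.nmem 10 i = s.nmem 6 (n - 1 - i)) ∧
      ∀ j < n, s'.nmem 9 (s.nmem 6 j) = n - 1 - j := by
  refine Run.seq (Run.straight 2 rfl (by decide) fun t₁ s₁ ht₁ hs₁ => ?_)
  simp only [Program.eff, NExpr.eval] at hs₁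
  refine Run.count (fun k s' => s'.nreg 20 = k ∧ s'.nreg 0 = n ∧ s'.nmem 6 = s.nmem 6 ∧
      (∀ i < k, s'.nmem 10 i = s.nmem 6 (n - 1 - i)) ∧
      ∀ j < n, n ≤ j + k → s'.nmem 9 (s.nmem 6 j) = n - 1 - j) n 20 0
    (fun k s h => ⟨h.1, h.2.1⟩) (Nat.zero_le _) ?_ ?_ ?_
  · refine ⟨by simp [hs₁], by simp [hs₁, h0], by simp [hs₁], fun i hi => by omega,
      fun j hj h => by omega⟩
  · rintro k hk - s₂ ⟨e1, e2, e3, e4, e5⟩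
    refine Run.straight 20 rfl (by decide) fun t s' ht hs' => ⟨ht, ?_⟩
    simp only [Program.eff, NExpr.eval, e1, e2, e3] at hs'
    refine ⟨by simp [hs', e1], by simp [hs', e2], by simp [hs', e3], fun i hi => ?_, fun j hj h => ?_⟩
    · rcases Nat.lt_succ_iff_lt_or_eq.1 hi with hi | rfl
      · rw [← e4 i hi]
        simp [hs', hi.ne, e1]
      · simp [hs', e1]
    · by_cases hjk : n ≤ j + k
      · have hne : s.nmem 6 j ≠ s.nmem 6 (n - 1 - k) := fun h => by
          have := hinj j hj _ (by omega) h
          omega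
        rw [← e5 j hj hjk]
        simp [hs', hne]
      · obtain rfl : k = n - 1 - j := by omega
        have : n - 1 - (n - 1 - j) = j := by omega
        simp [hs', this, e1]
  · rintro t s' ⟨-, -, -, h1, h2⟩ ht
    exact ⟨by simp only [NExpr.cost] at ht; omega, h1, fun j hj => h2 j hj (by omega)⟩

/-- Translate the parents, and store the names of the edges to the parents. -/
def translateParents : Program :=
  .setN 20 (.const 0) ;; .count 20 (.reg 0)
    (.setN 21 (.mem 10 (.reg 20)) ;; .storeN 11 (.reg 20) (.mem 9 (.mem 7 (.reg 21))) ;;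
      .storeN 12 (.reg 20) (.mem 8 (.reg 21))) ;;
  .storeN 11 (.const 0) (.const 0) ;; .storeN 12 (.const 0) (.reg 0)

/-- The loop also writes meaningless entries for the root, which are replaced afterwards: the root
becomes its own parent, with `n` as the name of a fictitious edge. -/
theorem run_translateParents {s : State} (h0 : s.nreg 0 = n) :
    Run translateParents s fun t s' => t ≤ n * 30 + 20 ∧ s'.nmem 11 0 = 0 ∧ s'.nmem 12 0 = n ∧
      ∀ i < n, 0 < i → s'.nmem 11 i = s.nmem 9 (s.nmem 7 (s.nmem 10 i)) ∧
        s'.nmem 12 i = s.nmem 8 (s.nmem 10 i) := by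
  refine Run.seq (Run.straight 2 rfl (by decide) fun t₁ s₁ ht₁ hs₁ => ?_)
  simp only [Program.eff, NExpr.eval] at hs₁
  refine Run.seq ?_
  refine Run.count (fun k s' => s'.nreg 20 = k ∧ s'.nreg 0 = n ∧
      (∀ r ∈ [7, 8, 9, 10], s'.nmem r = s.nmem r) ∧
      (∀ i < k, s'.nmem 11 i = s.nmem 9 (s.nmem 7 (s.nmem 10 i)) ∧
        s'.nmem 12 i = s.nmem 8 (s.nmem 10 i))) n 20 0
    (fun k s h => ⟨h.1, h.2.1⟩) (Nat.zero_le _) ?_ ?_ ?_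
  · simp [hs₁, h0]
  · rintro k hk - s₂ ⟨e1, e2, e3, e4⟩
    refine Run.straight 20 rfl (by decide) fun t s' ht hs' => ⟨ht, ?_⟩
    simp only [List.mem_cons, List.not_mem_nil, or_false, forall_eq_or_imp, forall_eq] at e3 ⊢
    simp only [Program.eff, NExpr.eval, e1] at hs'
    refine ⟨by simp [hs', e1], by simp [hs', e2], by simp [hs', e3], fun i hi => ?_⟩
    rcases Nat.lt_succ_iff_lt_or_eq.1 hi with hi | rfl
    · rw [← (e4 i hi).1, ← (e4 i hi).2]
      simp [hs', hi.ne, e1]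
    · simp [hs', e1, e3]
  · rintro t₂ s₂ ⟨-, e2, -, e4⟩ ht₂
    refine Run.straight 6 rfl (by decide) fun t s' ht hs' => ?_
    simp only [Program.eff, NExpr.eval, e2] at hs'
    refine ⟨by simp only [NExpr.cost] at ht₂; omega, by simp [hs'], by simp [hs'], fun i hi hi0 => ?_⟩
    rw [← (e4 i hi).1, ← (e4 i hi).2]
    simp [hs', hi0.ne']

/-- Lay out the tree as an indexed tree. -/
def layOut : Program :=
  countDegrees ;; collectLeaves ;; peelLeaves ;; numberNodes ;; translateParents

theorem run_layOut (hn : 0 < n) (hab : ∀ k < n - 1, a k ≠ b k)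
    (hlt : ∀ k < n - 1, a k < n ∧ b k < n) (hconn : CutConnected n a b (Finset.range n)) {s : State}
    (hs : HoldsEdges n a b s) (h4 : s.nmem 4 = 0) (h5 : s.nmem 5 = 0) :
    Run layOut s fun t s' => t ≤ n * 220 + 60 ∧ s'.nmem 11 0 = 0 ∧ s'.nmem 12 0 = n ∧
      (∀ i < n, s'.nmem 10 i < n) ∧
      (∀ i < n, ∀ j < n, s'.nmem 10 i = s'.nmem 10 j → i = j) ∧
      ∀ i < n, 0 < i → s'.nmem 11 i < i ∧ s'.nmem 12 i < n - 1 ∧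
        ((a (s'.nmem 12 i) = s'.nmem 10 i ∧ b (s'.nmem 12 i) = s'.nmem 10 (s'.nmem 11 i)) ∨
          (b (s'.nmem 12 i) = s'.nmem 10 i ∧ a (s'.nmem 12 i) = s'.nmem 10 (s'.nmem 11 i))) := by
  have hal : aliveEdges n a b (Finset.range n) = Finset.range (n - 1) := by
    ext k
    simp only [mem_aliveEdges, Finset.mem_range]
    exact ⟨fun h => h.1, fun h => ⟨h, hlt k h⟩⟩
  refine Run.seq ((Run.frame (nr := countDegrees.writes.1) (rr := countDegrees.writes.2.1)
      (nm := countDegrees.writes.2.2.1) (rm := countDegrees.writes.2.2.2) (by simp)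
      (run_countDegrees hab hs h4 h5)).mono ?_)
  rintro t₁ s₁ ⟨⟨ht₁, hd₁, hS₁⟩, f₁⟩
  have hs₁ := hs.frame f₁ (by decide) (by decide) (by decide)
  refine Run.seq ((Run.frame (nr := collectLeaves.writes.1) (rr := collectLeaves.writes.2.1)
      (nm := collectLeaves.writes.2.2.1) (rm := collectLeaves.writes.2.2.2) (by simp)
      (run_collectLeaves hs₁.size)).mono ?_)
  rintro t₂ s₂ ⟨⟨ht₂, hq₂, hi₂, hl₂⟩, f₂⟩
  have hs₂ := hs₁.frame f₂ (by decide) (by decide) (by decide)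
  have h4₂ := f₂.nmem 4 (by decide)
  have h5₂ := f₂.nmem 5 (by decide)
  have hP : Peeling n a b 0 (s₂.nreg 22) (s₂.nmem 6) (s₂.nmem 4) (s₂.nmem 5) (s₂.nmem 7)
      (s₂.nmem 8) (Finset.range n) := by
    refine ⟨by simp, hq₂, hi₂, fun v _ => ?_, fun v _ => ?_, fun v hv => ?_, hconn,
      by simp, by rw [hal, Finset.card_range]; omega, fun i hi => by omega⟩
    · rw [h4₂, hd₁, edgesAt, hal]
    · rw [h5₂, hS₁, edgesAt, hal]
    · rw [edgesAt, hal, ← hd₁, ← hl₂ v (Finset.mem_range.1 hv)]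
      simp
  refine Run.seq ((Run.frame (nr := peelLeaves.writes.1) (rr := peelLeaves.writes.2.1)
      (nm := peelLeaves.writes.2.2.1) (rm := peelLeaves.writes.2.2.2) (by simp)
      (run_peelLeaves hn hab hs₂ hP)).mono ?_)
  rintro t₃ s₃ ⟨⟨ht₃, m, A, hP₃⟩, f₃⟩
  have hs₃ := hs₂.frame f₃ (by decide) (by decide) (by decide)
  obtain ⟨hlt₃, hinj₃, hpar₃⟩ := hP₃.final (by omega)
  refine Run.seq ((Run.frame (nr := numberNodes.writes.1) (rr := numberNodes.writes.2.1)
      (nm := numberNodes.writes.2.2.1) (rm := numberNodes.writes.2.2.2) (by simp)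
      (run_numberNodes hs₃.size hinj₃)).mono ?_)
  rintro t₄ s₄ ⟨⟨ht₄, ho₄, hp₄⟩, f₄⟩
  have hs₄ := hs₃.frame f₄ (by decide) (by decide) (by decide)
  refine (Run.frame (nr := translateParents.writes.1) (rr := translateParents.writes.2.1)
      (nm := translateParents.writes.2.2.1) (rm := translateParents.writes.2.2.2) (by simp)
      (run_translateParents hs₄.size)).mono ?_
  rintro t₅ s₅ ⟨⟨ht₅, h11, h12, hpar⟩, f₅⟩
  have h10 := f₅.nmem 10 (by decide)
  rw [h10]
  refine ⟨by omega, h11, h12, fun i hi => ?_, fun i hi j hj hij => ?_, fun i hi hi0 => ?_⟩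
  · rw [ho₄ i hi]; exact hlt₃ _ (by omega)
  · rw [ho₄ i hi, ho₄ j hj] at hij
    have := hinj₃ _ (by omega) _ (by omega) hij
    omega
  · obtain ⟨e1, e2⟩ := hpar i hi hi0
    obtain ⟨g1, ⟨j, g2, g3, g4⟩, g5⟩ := hpar₃ (n - 1 - i) (by omega)
    rw [ho₄ i hi, f₄.nmem 8 (by decide)] at e2
    rw [ho₄ i hi, f₄.nmem 7 (by decide), g4, hp₄ j g3] at e1
    have e3 : s₄.nmem 10 (s₅.nmem 11 i) = s₃.nmem 7 (s₃.nmem 6 (n - 1 - i)) := by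
      rw [e1, ho₄ _ (by omega), g4]
      congr 1
      omega
    rw [e2, e3, ho₄ i hi]
    exact ⟨by omega, g1, g5⟩

end RealRAM

/-! ## The two problems -/

open RealRAM

namespace CoverInstance.EdgeList

variable {n : ℕ} {I : CoverInstance n} (L : I.EdgeList)

theorem pos_of_instance (I : CoverInstance n) : 0 < n := by
  obtain ⟨x⟩ := I.isTree.connected.nonempty
  exact x.pos

theorem inputState_src {k : ℕ} (hk : k < n - 1) : L.inputState.nmem 0 k = L.src ⟨k, hk⟩ := by
  simp [inputState, hk]

theorem inputState_dst {k : ℕ} (hk : k < n - 1) : L.inputState.nmem 1 k = L.dst ⟨k, hk⟩ := by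
  simp [inputState, hk]

theorem inputState_nmem {a : ℕ} (ha : 2 ≤ a) : L.inputState.nmem a = 0 := by
  have h0 : a ≠ 0 := by omega
  have h1 : a ≠ 1 := by omega
  funext k
  simp [inputState, h0, h1]

theorem inputState_rmem {a : ℕ} (ha : 3 ≤ a) : L.inputState.rmem a = 0 := by
  have h0 : a ≠ 0 := by omega
  have h1 : a ≠ 1 := by omega
  have h2 : a ≠ 2 := by omega
  funext k
  simp [inputState, h0, h1, h2]

theorem adj (k : Fin (n - 1)) : I.graph.Adj (L.src k) (L.dst k) :=
  L.bijOn.mapsTo (Set.mem_univ k)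

/-- A walk from a node in `B` to one outside of `B` crosses the boundary somewhere, and the edge on
which it does so is in the list. -/
theorem cutConnected : CutConnected n (L.inputState.nmem 0) (L.inputState.nmem 1)
    (Finset.range n) := by
  intro B hB ⟨x, hx⟩ hne
  obtain ⟨y, hy, hyB⟩ : ∃ y ∈ Finset.range n, y ∉ B := by
    by_contra! hcon
    exact hne (Finset.Subset.antisymm hB hcon)
  obtain ⟨p⟩ := I.isTree.connected.preconnected ⟨x, Finset.mem_range.1 (hB hx)⟩
    ⟨y, Finset.mem_range.1 hy⟩
  obtain ⟨d, -, h1, h2⟩ := p.exists_boundary_dart {v | (v : ℕ) ∈ B} hx hyB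
  obtain ⟨k, -, hk⟩ := L.bijOn.surjOn (show d.edge ∈ I.graph.edgeSet from d.edge_mem)
  have hd : s(L.src k, L.dst k) = s(d.fst, d.snd) := hk
  refine ⟨k, mem_aliveEdges.2 ⟨k.2, ?_⟩, ?_⟩
  · rw [L.inputState_src k.2, L.inputState_dst k.2]
    simp
  · rw [L.inputState_src k.2, L.inputState_dst k.2]
    rcases Sym2.eq_iff.1 hd with ⟨h3, h4⟩ | ⟨h3, h4⟩
    · exact .inl ⟨by simpa [h3] using h1, by simpa [h4] using h2⟩
    · exact .inr ⟨by simpa [h4] using h1, by simpa [h3] using h2⟩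

/-- The tree of the instance has been laid out in the memory. -/
structure LaidOut (T : IndexedTree) (ν : ℕ → Fin n) (s : State) : Prop where
  laid : T.Laid n s
  unused : Unused s
  numbering : I.Numbering T ν
  node : ∀ i < n, s.nmem 10 i = ν i
  edge : ∀ i < n, 0 < i → ∃ k : Fin (n - 1), s.nmem 12 i = k ∧
    s(L.src k, L.dst k) = s(ν i, ν (T.parent i))

theorem run_layOut_input : Run layOut L.inputState fun t s =>
    t ≤ n * 220 + 60 ∧ ∃ T ν, L.LaidOut T ν s := by
  have hn := pos_of_instance I
  refine (Run.frame (nr := layOut.writes.1) (rr := layOut.writes.2.1)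
    (nm := layOut.writes.2.2.1) (rm := layOut.writes.2.2.2) (by simp)
    (run_layOut (s := L.inputState) hn ?_ ?_ L.cutConnected ⟨by simp [inputState], rfl, rfl⟩
      (L.inputState_nmem (by decide)) (L.inputState_nmem (by decide)))).mono ?_
  · intro k hk h
    rw [L.inputState_src hk, L.inputState_dst hk] at h
    exact (L.adj ⟨k, hk⟩).ne (Fin.ext h)
  · intro k hk
    rw [L.inputState_src hk, L.inputState_dst hk]
    simp
  rintro t s ⟨⟨ht, h11, h12, hlt, hinj, hpar⟩, f⟩
  refine ⟨ht, ?_⟩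
  have hr0 := f.rmem 0 (by decide)
  have hr1 := f.rmem 1 (by decide)
  have hr2 := f.rmem 2 (by decide)
  let ν : ℕ → Fin n := fun i => if h : s.nmem 10 i < n then ⟨s.nmem 10 i, h⟩ else ⟨0, hn⟩
  have hν : ∀ i < n, s.nmem 10 i = ν i := fun i hi => by simp [ν, hlt i hi]
  have hends : ∀ i < n, 0 < i → ∃ k : Fin (n - 1), s.nmem 12 i = k ∧
      s(L.src k, L.dst k) = s(ν i, ν (s.nmem 11 i)) := by
    intro i hi hi0
    obtain ⟨h1, h2, h3⟩ := hpar i hi hi0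
    rw [L.inputState_src h2, L.inputState_dst h2, hν i hi, hν _ (by omega)] at h3
    refine ⟨⟨_, h2⟩, rfl, ?_⟩
    rcases h3 with ⟨h3, h4⟩ | ⟨h3, h4⟩
    · rw [Fin.ext h3, Fin.ext h4]
    · rw [Fin.ext h3, Fin.ext h4, Sym2.eq_swap]
  have hcost : ∀ i < n, 0 < i → s.rmem 0 (s.nmem 12 i) = I.cost s(ν i, ν (s.nmem 11 i)) := by
    intro i hi hi0
    obtain ⟨k, h1, h2⟩ := hends i hi hi0
    rw [hr0, h1, ← h2]
    simp [inputState]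
  have hadj : ∀ i < n, 0 < i → I.graph.Adj (ν i) (ν (s.nmem 11 i)) := by
    intro i hi hi0
    obtain ⟨k, h1, h2⟩ := hends i hi hi0
    rw [← SimpleGraph.mem_edgeSet, ← h2]
    exact L.adj k
  -- An `IndexedTree` lives on all natural numbers. Beyond `n` every node gets the parent 0 and the
  -- cost 0, which satisfies the conditions trivially.
  let T : IndexedTree :=
    { parent := fun i => if i < n then s.nmem 11 i else 0
      parent_lt := fun i hi => by
        split_ifs with h
        exacts [(hpar i h hi).1, hi]
      parent_zero := by simp [hn, h11]
      cost := fun i => if 0 < i ∧ i < n then s.rmem 0 (s.nmem 12 i) else 0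
      cost_nonneg := fun i => by
        split_ifs with h
        · rw [hcost i h.2 h.1]
          exact I.cost_nonneg _ (hadj i h.2 h.1)
        · exact le_rfl
      cost_zero := by simp
      pen := penalties s
      rad := fun i => s.rmem 2 (s.nmem 10 i) }
  have hTp : ∀ i < n, T.parent i = s.nmem 11 i := fun i hi => if_pos hi
  refine ⟨T, ν, ⟨?_, fun i hi => (hTp i hi).symm, fun i hi => ?_, rfl, fun i hi => rfl⟩, ?_, ?_, hν, ?_⟩
  · rw [f.nreg 0 (by decide)]; simp [inputState]
  · rcases Nat.eq_zero_or_pos i with rfl | hi0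
    · rw [T.cost_zero, hr0, h12]
      simp [inputState]
    · exact (if_pos ⟨hi0, hi⟩).symm
  · refine ⟨⟨fun a h1 h2 => ?_, ?_, ?_⟩, ?_, ?_, ?_, ?_⟩
    · refine (f.nmem a ?_).trans (L.inputState_nmem (by omega))
      simp [layOut, countDegrees, collectLeaves, peelLeaves, numberNodes, translateParents,
        Program.count, Program.writes]
      omega
    · rw [f.rmem 4 (by decide), L.inputState_rmem (by decide)]
    · rw [f.rmem 5 (by decide), L.inputState_rmem (by decide)]
    · rw [f.nmem 2 (by decide), L.inputState_nmem (by decide)]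
    · rw [f.nmem 3 (by decide), L.inputState_nmem (by decide)]
    · rw [f.nmem 26 (by decide), L.inputState_nmem (by decide)]
    · rw [f.rmem 6 (by decide), L.inputState_rmem (by decide)]
  · refine ⟨fun i hi j hj hij => hinj i hi j hj ?_, fun i hi hi0 => ?_, fun i hi hi0 => ?_,
      fun i hi => ?_, fun i hi => ?_⟩
    · rw [hν i hi, hν j hj, hij]
    · rw [hTp i hi]; exact hadj i hi hi0
    · rw [hTp i hi, ← hcost i hi hi0]
      exact if_pos ⟨hi0, hi⟩
    · show s.rmem 1 (s.nmem 10 i) = _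
      rw [hr1, hν i hi]
      simp [inputState]
    · show s.rmem 2 (s.nmem 10 i) = _
      rw [hr2, hν i hi]
      simp [inputState]
  · intro i hi hi0
    rw [hTp i hi]
    exact hends i hi hi0

end CoverInstance.EdgeList

/-! ### The total running time -/

namespace RealRAM

/-- A bound on the time that it takes to solve an instance with `n` nodes. -/
def solveTime (n : ℕ) : ℕ := n * 380 + answerTime n (Nat.log 2 n + 3) + 110

/-- The tree of clusters has fewer than `3 n` nodes, so `Nat.log 2 n + 3` halvings contract it to a
single one. -/
theorem three_mul_le_two_pow (n : ℕ) : 3 * n ≤ 2 ^ (Nat.log 2 n + 3) := by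
  have := Nat.lt_pow_succ_log_self (b := 2) (by decide) n
  rw [pow_add _ _ 3]
  rw [pow_succ] at this
  omega

theorem solveTime_isBigO : (fun n => (solveTime n : ℝ)) =O[atTop] fun n : ℕ => (n : ℝ) * Real.log n := by
  -- For `n ≥ 2` both `n` and `n * Nat.log 2 n` are at most `2 * n * Real.log n`. The leading terms
  -- `42000 * n * Nat.log 2 n` and about `127000 * n` then stay below this generous constant, with
  -- room for the rest.
  refine IsBigO.of_bound 400000 ?_
  filter_upwards [eventually_ge_atTop 2] with n hn
  have hn' : (2 : ℝ) ≤ n := by exact_mod_cast hn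
  have h2 : 1 / 2 ≤ Real.log 2 := by have := Real.log_two_gt_d9; linarith
  have hlog : Real.log 2 ≤ Real.log n := Real.log_le_log (by norm_num) hn'
  have hl : (Nat.log 2 n : ℝ) ≤ 2 * Real.log n := by
    have h3 : (2 : ℝ) ^ Nat.log 2 n ≤ n := by exact_mod_cast Nat.pow_log_le_self 2 (by omega)
    have h4 := Real.log_le_log (by positivity) h3
    rw [Real.log_pow] at h4
    have h5 : (Nat.log 2 n : ℝ) * (1 / 2) ≤ Nat.log 2 n * Real.log 2 :=
      mul_le_mul_of_nonneg_left h2 (by positivity)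
    linarith
  have h6 : (0 : ℝ) ≤ n * Real.log n := mul_nonneg (by linarith) (by linarith)
  rw [Real.norm_of_nonneg (by positivity), Real.norm_of_nonneg h6]
  have h7 : (n : ℝ) * Nat.log 2 n ≤ n * (2 * Real.log n) :=
    mul_le_mul_of_nonneg_left hl (by linarith)
  have h8 : (n : ℝ) * (1 / 2) ≤ n * Real.log n :=
    mul_le_mul_of_nonneg_left (h2.trans hlog) (by linarith)
  simp only [solveTime, answerTime]
  push_cast
  nlinarith

end RealRAM

/-! ### The two problems solved -/

open CoverInstance EdgeList

theorem solvable_subtree :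
    SolvableInTime (fun L s => L.OutputsOptimalSubtree s) (fun n => (n : ℝ) * Real.log n) := by
  refine ⟨layOut ;; solveSubtree, solveTime, solveTime_isBigO, fun n I L => ?_⟩
  have hn := pos_of_instance I
  refine Run.seq (L.run_layOut_input.mono ?_)
  rintro t₁ s₁ ⟨ht₁, T, ν, h⟩
  have num := h.numbering
  refine (run_solveSubtree hn (three_mul_le_two_pow n) h.laid h.unused rfl rfl
    (fun i hi j hj hij => ?_) fun i hi j hj hi0 hj0 hij => ?_).mono ?_
  · rw [h.node i hi, h.node j hj] at hij
    exact num.inj i hi j hj (Fin.ext hij)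
  · obtain ⟨k, h1, h2⟩ := h.edge i hi hi0
    obtain ⟨k', h3, h4⟩ := h.edge j hj hj0
    have hk : k = k' := Fin.ext (h1.symm.trans (hij.trans h3))
    exact num.edge_inj hi hj hi0 hj0 (h2.symm.trans (hk ▸ h4))
  rintro t₂ s₂ ⟨ht₂, S, v, hS, hopt, hval, hnode, hedge⟩
  refine ⟨by unfold solveTime; omega, I.subgraphOf ν S, ?_⟩
  obtain ⟨h1, h2, h3⟩ := num.isOptimalSubtree hS hopt
  refine ⟨h1, fun u => ?_, fun k => ?_, hval.trans h2.symm⟩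
  · obtain ⟨i, hi, rfl⟩ := num.surj u
    have := hnode i hi
    rw [h.node i hi] at this
    rw [this]
    classical
    refine if_congr ?_ rfl rfl
    rw [num.mem_subgraphOf hS i]
    exact and_iff_right hi
  -- The machine marks an edge under the name stored for the lower end `i`. Since the list has no
  -- repetitions, this name is `k` itself.
  · obtain ⟨i, hi, hi0, he⟩ := (num.mem_edgeSet s(L.src k, L.dst k)).1 (L.adj k)
    obtain ⟨k', h4, h5⟩ := h.edge i hi hi0
    have hk : k' = k := L.bijOn.injOn (Set.mem_univ _) (Set.mem_univ _) (h5.trans he.symm)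
    have := hedge i hi hi0
    rw [h4, hk] at this
    rw [this]
    classical
    refine if_congr ?_ rfl rfl
    rw [h3, he]
    refine ⟨fun hiS => ⟨i, hiS, rfl⟩, ?_⟩
    rintro ⟨j, hj, hij⟩
    have hj' := Finset.mem_erase.1 hj
    have hjn := hS.lt_size j hj'.2
    have hvj := (hS.closed j hj'.2 hj'.1).1
    rwa [num.edge_inj hi hjn hi0 (by omega) hij]

theorem solvable_node :
    SolvableInTime (fun L s => L.OutputsOptimalNode s) (fun n => (n : ℝ) * Real.log n) := by
  refine ⟨layOut ;; solveNode, solveTime, solveTime_isBigO, fun n I L => ?_⟩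
  have hn := pos_of_instance I
  refine Run.seq (L.run_layOut_input.mono ?_)
  rintro t₁ s₁ ⟨ht₁, T, ν, h⟩
  have num := h.numbering
  refine (run_solveNode hn (three_mul_le_two_pow n) h.laid h.unused rfl).mono ?_
  rintro t₂ s₂ ⟨ht₂, v, hv, hopt, hval, hnode⟩
  refine ⟨by unfold solveTime; omega, ν v, num.isOptimalNode hv hopt, hnode.trans (h.node v hv), ?_⟩
  rw [num.totalCost_singleton hv, hval]

theorem mainTheorem1 :
    SolvableInTime (fun L s => L.OutputsOptimalSubtree s) (fun n => (n : ℝ) * Real.log n) ∧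
    SolvableInTime (fun L s => L.OutputsOptimalNode s) (fun n => (n : ℝ) * Real.log n) :=
  ⟨solvable_subtree, solvable_node⟩
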